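/- **Theorem (Local regression distribution estimation: standard errors).** Let $x_1,x_2,\dots$ be i.i.d. real random variables with distribution function $F$ and support $\mathcal X\subseteq\mathbb R$ (the topological support of their law), and fix $\mathsf x\in\mathcal X$. Let $K:\mathbb R\to\mathbb R$, let $R:\mathbb R\to\mathbb R^d$ be measurable, and assume: (i) For some $\delta>0$, $F$ is absolutely continuous on $[\mathsf x-\delta,\mathsf x+\delta]$ with a density $f$ admitting constants $f(\mathsf x-),f(\mathsf x+),\dot f(\mathsf x-),\dot f(\mathsf x+)$ such that $$\sup_{u\in[-\delta,0)}\frac{f(\mathsf x+u)-f(\mathsf x-)-u\dot f(\mathsf x-)}{u^2}+\sup_{u\in(0,\delta]}\frac{f(\mathsf x+u)-f(\mathsf x+)-u\dot f(\mathsf x+)}{u^2}<\infty .$$ (ii) $K$ is nonnegative and symmetric, vanishes outside $[-1,1]$, is continuous on $[-1,1]$, and $\int K=1$. (iii) $R$ is locally bounded, and for each $h>0$ there is a positive-definite diagonal matrix $\Upsilon_h$ with $\Upsilon_hR(u)=R(u/h)$ for all $u$. (iv) For all sufficiently small $h>0$, the minimum eigenvalues of $\Gamma_h$ and of $h^{-1}\Sigma_h$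 are bounded below by a positive constant independent of $h$, where, with $(\mathcal X-\mathsf x)/h=\{u:\mathsf x+hu\in\mathcal X\}$, $$\Gamma_h=\int_{\frac{\mathcal X-\mathsf x}{h}}R(u)R(u)'K(u)f(\mathsf x+hu)\,du,$$ $$\Sigma_h=\iint_{\frac{\mathcal X-\mathsf x}{h}}R(u)R(v)'\big[F(\mathsf x+h(u\wedge v))-F(\mathsf x+hu)F(\mathsf x+hv)\big]K(u)K(v)f(\mathsf x+hu)f(\mathsf x+hv)\,du\,dv .$$ Let $h=h_n>0$ satisfy $h\to0$ and $nh^2\to\infty$ as $n\to\infty$, and let $c\in\mathbb R^d$ be nonzero. Put $\hat F(y)=\frac1n\sum_{i=1}^n\mathbb 1(x_i\le y)$, $W_j=\frac1hK\big(\frac{x_j-\mathsf x}{h}\big)$, $$\hat\Gamma_h=\frac1n\sum_{i=1}^n\Upsilon_hR(x_i-\mathsf x)R(x_i-\mathsf x)'\Upsilon_hW_i,\qquad \hat\Sigma_h=\frac1n\sum_{i=1}^n\hat\psi_i\hat\psi_i',\qquad \hat\psi_i=\frac1n\sum_{j=1}^n\Upsilon_hR(x_j-\mathsf x)\big[\mathbb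 1(x_i\le x_j)-\hat F(x_j)\big]W_j .$$ Then $$\left|\frac{c'\hat\Gamma_h^{-1}\hat\Sigma_h\hat\Gamma_h^{-1}c}{c'\Gamma_h^{-1}\Sigma_h\Gamma_h^{-1}c}-1\right|=O_{\mathbb P}\left(\sqrt{\frac1{nh^2}}\right).$$ Moreover, let $\theta\in\mathbb R^d$, let $\varrho(h)=\sup_{|y-\mathsf x|\le h}|F(y)-R(y-\mathsf x)'\theta|$, and for each $n$ let $\hat\theta$ be a measurable minimizer over $\vartheta\in\mathbb R^d$ of $\sum_{i=1}^n\big(\hat F(x_i)-R(x_i-\mathsf x)'\vartheta\big)^2W_i$. If in addition $n\varrho(h)^2/h\to0$, then $$\frac{c'(\hat\theta-\theta)}{\sqrt{c'\Upsilon_h\hat\Gamma_h^{-1}\hat\Sigma_h\hat\Gamma_h^{-1}\Upsilon_hc/n}}\rightsquigarrow\mathcal N(0,1).$$ (On the event, of probability tending to zero, that $\hat\Gamma_h$ is singular or the standard error vanishes, the quantities displayed may be given any fixed measurable value.) -/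

import Mathlib

open MeasureTheory ProbabilityTheory Filter Topology Matrix

noncomputable section

namespace LocReg

/-- `Y n = O_P(a n)`: for every `ε > 0` there is `M` such that `|Y n| > M |a n|` has probability at
most `ε` for all large `n`. -/
def IsBigOP {Ω : Type*} [MeasurableSpace Ω] (P : Measure Ω) (Y : ℕ → Ω → ℝ) (a : ℕ → ℝ) : Prop :=
  ∀ ε : ℝ, 0 < ε → ∃ M : ℝ, ∀ᶠ n in atTop, P {ω | M * |a n| < |Y n ω|} ≤ ENNReal.ofReal ε

/-- `F` is absolutely continuous on `[x - δ, x + δ]` with density `f`. For a distribution function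
`F` this forces `0 ≤ f` almost everywhere on that interval. -/
def HasDensityOn (F f : ℝ → ℝ) (x δ : ℝ) : Prop :=
  IntegrableOn f (Set.Icc (x - δ) (x + δ)) ∧
    ∀ a ∈ Set.Icc (x - δ) (x + δ), ∀ b ∈ Set.Icc (x - δ) (x + δ), F b - F a = ∫ t in a..b, f t

/-- The sum of the suprema of `(f (x + u) - f(x∓) - u f'(x∓)) / u ^ 2` over `u ∈ [-δ, 0)` and over
`u ∈ (0, δ]` is finite, where `fm, fp, dfm, dfp` stand for `f(x-), f(x+), f'(x-), f'(x+)`.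
Both index sets are nonempty, so this says that each of the two families is bounded above. -/
def TwoSidedExpansion (f : ℝ → ℝ) (x δ fm fp dfm dfp : ℝ) : Prop :=
  BddAbove ((fun u => (f (x + u) - fm - u * dfm) / u ^ 2) '' Set.Ico (-δ) 0) ∧
    BddAbove ((fun u => (f (x + u) - fp - u * dfp) / u ^ 2) '' Set.Ioc 0 δ)

/-- `K` is nonnegative, symmetric, vanishes off `[-1, 1]`, is continuous on `[-1, 1]`, and
integrates to one. -/
structure IsKernel (K : ℝ → ℝ) : Prop where
  nonneg : ∀ u, 0 ≤ K u
  symm : ∀ u, K (-u) = K u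
  continuousOn : ContinuousOn K (Set.Icc (-1) 1)
  eq_zero : ∀ u, u ∉ Set.Icc (-1 : ℝ) 1 → K u = 0
  integral_eq_one : ∫ u, K u = 1

/-- `R` is a (measurable) locally bounded basis. -/
structure IsBasis {d : ℕ} (R : ℝ → Fin d → ℝ) : Prop where
  measurable : Measurable R
  locallyBounded : ∀ u, ∃ s ∈ 𝓝 u, Bornology.IsBounded (R '' s)

/-- For each `h > 0`, the diagonal matrix `Υ_h` with diagonal entries `υ h` is positive definite
and `Υ_h R(u) = R(u / h)`. -/
def IsScaling {d : ℕ} (R : ℝ → Fin d → ℝ) (υ : ℝ → Fin d → ℝ) : Prop :=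
  ∀ h : ℝ, 0 < h → (diagonal (υ h)).PosDef ∧ ∀ u, diagonal (υ h) *ᵥ R u = R (u / h)

/-- The set `(𝒳 - x) / h`, with `𝒳` the support of `μ`. -/
def rescaledSupport (μ : Measure ℝ) (x h : ℝ) : Set ℝ := {u | x + h * u ∈ μ.support}

/-- `Γ_h = ∫ R(u) R(u)' K(u) f(x + h u) du` over `(𝒳 - x) / h`. -/
def Gam {d : ℕ} (μ : Measure ℝ) (f K : ℝ → ℝ) (R : ℝ → Fin d → ℝ) (x h : ℝ) :
    Matrix (Fin d) (Fin d) ℝ :=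
  of fun k l => ∫ u in rescaledSupport μ x h, R u k * R u l * K u * f (x + h * u)

/-- `Σ_h = ∬ R(u) R(v)' [F(x + h (u ∧ v)) - F(x + h u) F(x + h v)]
K(u) K(v) f(x + h u) f(x + h v) du dv` over `(𝒳 - x) / h`, with `F` the distribution function
of `μ`. -/
def Sig {d : ℕ} (μ : Measure ℝ) (f K : ℝ → ℝ) (R : ℝ → Fin d → ℝ) (x h : ℝ) :
    Matrix (Fin d) (Fin d) ℝ :=
  of fun k l => ∫ u in rescaledSupport μ x h, ∫ v in rescaledSupport μ x h,
    R u k * R v l * (cdf μ (x + h * min u v) - cdf μ (x + h * u) * cdf μ (x + h * v)) *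
      K u * K v * f (x + h * u) * f (x + h * v)

/-- For all small `h > 0`, the eigenvalues of `A h` are bounded below by one positive constant. -/
def MinEigenvalueBoundedAway {d : ℕ} (A : ℝ → Matrix (Fin d) (Fin d) ℝ) : Prop :=
  ∃ lam : ℝ, 0 < lam ∧ ∀ᶠ h in 𝓝[>] (0 : ℝ), ∀ t ∈ spectrum ℝ (A h), lam ≤ t

/-- The approximation error `ϱ(h) = sup_{|y - x| ≤ h} |F(y) - R(y - x)' θ|`. -/
def rho {d : ℕ} (F : ℝ → ℝ) (R : ℝ → Fin d → ℝ) (θ : Fin d → ℝ) (x h : ℝ) : ℝ :=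
  sSup ((fun y => |F y - R (y - x) ⬝ᵥ θ|) '' {y | |y - x| ≤ h})

/-! Sample quantities. The sample is `z 0, …, z (n - 1)`. -/

/-- The weight `(1 / h) K((y - x) / h)`. -/
def weight (K : ℝ → ℝ) (x h y : ℝ) : ℝ := 1 / h * K ((y - x) / h)

/-- The indicator `𝟙(a ≤ b)`. -/
def indLe (a b : ℝ) : ℝ := Set.indicator (Set.Iic b) (fun _ => (1 : ℝ)) a

/-- The empirical distribution function. -/
def ecdf (n : ℕ) (z : ℕ → ℝ) (y : ℝ) : ℝ := 1 / (n : ℝ) * ∑ i ∈ Finset.range n, indLe (z i) y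

/-- The least squares criterion minimized by the local regression estimator. -/
def objective {d : ℕ} (K : ℝ → ℝ) (R : ℝ → Fin d → ℝ) (x h : ℝ) (n : ℕ) (z : ℕ → ℝ)
    (θ : Fin d → ℝ) : ℝ :=
  ∑ i ∈ Finset.range n, (ecdf n z (z i) - R (z i - x) ⬝ᵥ θ) ^ 2 * weight K x h (z i)

/-- `Γ̂_h = n⁻¹ ∑_i Υ_h R(z_i - x) R(z_i - x)' Υ_h (1 / h) K((z_i - x) / h)`. -/
def GamHat {d : ℕ} (K : ℝ → ℝ) (R : ℝ → Fin d → ℝ) (υ : ℝ → Fin d → ℝ) (x h : ℝ) (n : ℕ)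
    (z : ℕ → ℝ) : Matrix (Fin d) (Fin d) ℝ :=
  (1 / (n : ℝ)) • ∑ i ∈ Finset.range n, weight K x h (z i) •
    (diagonal (υ h) * vecMulVec (R (z i - x)) (R (z i - x)) * diagonal (υ h))

/-- The bracket in `Σ̂_h`:
`n⁻¹ ∑_j Υ_h R(z_j - x) [𝟙(z_i ≤ z_j) - F̂(z_j)] (1 / h) K((z_j - x) / h)`. -/
def influenceHat {d : ℕ} (K : ℝ → ℝ) (R : ℝ → Fin d → ℝ) (υ : ℝ → Fin d → ℝ) (x h : ℝ) (n : ℕ)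
    (z : ℕ → ℝ) (i : ℕ) : Fin d → ℝ :=
  (1 / (n : ℝ)) • ∑ j ∈ Finset.range n,
    ((indLe (z i) (z j) - ecdf n z (z j)) * weight K x h (z j)) •
      (diagonal (υ h) *ᵥ R (z j - x))

/-- `Σ̂_h`, the average of the outer products of the brackets above. -/
def SigHat {d : ℕ} (K : ℝ → ℝ) (R : ℝ → Fin d → ℝ) (υ : ℝ → Fin d → ℝ) (x h : ℝ) (n : ℕ)
    (z : ℕ → ℝ) : Matrix (Fin d) (Fin d) ℝ :=
  (1 / (n : ℝ)) • ∑ i ∈ Finset.range n,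
    vecMulVec (influenceHat K R υ x h n z i) (influenceHat K R υ x h n z i)

/-- The quadratic form `c' G⁻¹ S G⁻¹ c`. -/
def sandwich {d : ℕ} (G S : Matrix (Fin d) (Fin d) ℝ) (c : Fin d → ℝ) : ℝ :=
  c ⬝ᵥ ((G⁻¹ * S * G⁻¹) *ᵥ c)

/-- The standard error `√(c' Υ_h Γ̂_h⁻¹ Σ̂_h Γ̂_h⁻¹ Υ_h c / n)`. -/
def stdErr {d : ℕ} (K : ℝ → ℝ) (R : ℝ → Fin d → ℝ) (υ : ℝ → Fin d → ℝ) (x h : ℝ) (n : ℕ)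
    (z : ℕ → ℝ) (c : Fin d → ℝ) : ℝ :=
  √(sandwich (GamHat K R υ x h n z) (SigHat K R υ x h n z) (diagonal (υ h) *ᵥ c) / n)

end LocReg

end

noncomputable section

namespace LocReg

/-! ### Stochastic orders -/

section StochasticOrder

variable {Ω : Type*} [MeasurableSpace Ω] {P : Measure Ω}

/-! Put $r_k(z)=h^{-1}K((z-\mathsf x)/h)R_k((z-\mathsf x)/h)$ and $\varphi_k(t)=\int r_k(z)1(t\le
z)\,\mu(dz)$. The substitution $z=\mathsf x+hu$ turns $\Gamma_h$ into an expectation and $\Sigma_h$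
into the covariance matrix of $\varphi(x_1)$ (`Gam_eq`, `Sig_eq`). The window has mass $O(h)$, so
$|r|\lesssim 1/h$, $E|r|\lesssim 1$, $E r^2\lesssim 1/h$ and $|\varphi|\lesssim 1$; all rates come
from these bounds (`exists_uniformBounds`).

Standard errors. A quadratic form $w'\hat\Sigma_hw$ is the sample variance of $w'\hat\varphi(x_i)$
with $\hat\varphi(x_i)=n^{-1}\sum_jr(x_j)1(x_i\le x_j)$ (`quadratic_SigHat`). Replacing
$\hat\varphi$ by $\varphi$ and $\hat\Gamma_h^{-1}c$ by $\Gamma_h^{-1}c$ costs a mean square error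
$E=O_P(1/(nh))$. The target variance $V$ is at least $\kappa h$, and the difference of two sample
variances is at most $E+2\sqrt{VE}$ up to lower order terms, so the relative error is
$O_P(\sqrt{E/h})=O_P(1/\sqrt{nh^2})$. The sample variance with the true $\varphi$ has the smaller
relative error $1/\sqrt{nh}$. See `abs_sampleVar_sub_le`, `Design.isBigOP_upperHat_sub`,
`Design.isBigOP_hatVar_of_norm`.

Normality. The normal equations give $c'(\hat\theta-\theta)=(\hat\Gamma_h^{-1}\Upsilon_hc)'s$ with
the score $s$ at $\theta$. A Hoeffding decomposition writes $s$ as the mean of the centered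
$\varphi(x_i)$, plus a degenerate double sum of order $1/(n\sqrt h)$, plus a bias of order
$\varrho(h)$. After multiplication by $\sqrt{n/V}\lesssim\sqrt{n/h}$ the last two become
$1/\sqrt{nh^2}$ and $\sqrt{n\varrho(h)^2/h}$, and the error in $\hat\Gamma_h^{-1}$ contributes
$1/\sqrt{nh^2}$. The leading term is a normalized sum of variables with variance one, bounded by a
multiple of $h^{-1/2}=o(\sqrt n)$, so a characteristic function argument applies
(`tendstoInDistribution_triangular`); Slutsky's theorem finishes.

Both ratios are unchanged when the direction is rescaled, so the estimates are proved for unit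
vectors that may vary with $n$. This accommodates $\Upsilon_hc$, whose length is not controlled. -/

/-- The events `E n` hold with probability approaching one. -/
def HighProb (P : Measure Ω) (E : ℕ → Ω → Prop) : Prop :=
  Tendsto (fun n => P {ω | ¬ E n ω}) atTop (𝓝 0)

lemma HighProb.and {E E' : ℕ → Ω → Prop} (hE : HighProb P E) (hE' : HighProb P E') :
    HighProb P fun n ω => E n ω ∧ E' n ω := by
  have h := hE.add hE'
  rw [add_zero] at h
  refine tendsto_of_tendsto_of_tendsto_of_le_of_le tendsto_const_nhds h (fun _ => zero_le) ?_
  intro n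
  refine (measure_mono ?_).trans (measure_union_le _ _)
  intro ω hω
  simp only [Set.mem_ofPred_eq, not_and_or] at hω
  exact hω

lemma HighProb.mono {E E' : ℕ → Ω → Prop} (hE : HighProb P E)
    (h : ∀ᶠ n in atTop, ∀ ω, E n ω → E' n ω) : HighProb P E' := by
  refine tendsto_of_tendsto_of_tendsto_of_le_of_le' tendsto_const_nhds hE
    (Eventually.of_forall fun _ => zero_le) ?_
  filter_upwards [h] with n hn
  exact measure_mono fun ω hω h' => hω (hn ω h')

lemma HighProb.of_eventually {E : ℕ → Ω → Prop} (h : ∀ᶠ n in atTop, ∀ ω, E n ω) :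
    HighProb P E := by
  refine tendsto_const_nhds.congr' ?_
  filter_upwards [h] with n hn
  simp [hn]

lemma IsBigOP.mono {Y Z : ℕ → Ω → ℝ} {a b : ℕ → ℝ} (hZ : IsBigOP P Z b)
    (hYZ : HighProb P fun n ω => |Y n ω| ≤ |Z n ω|) (hab : ∀ᶠ n in atTop, |b n| ≤ |a n|) :
    IsBigOP P Y a := by
  intro ε hε
  obtain ⟨M, hM⟩ := hZ (ε / 2) (half_pos hε)
  -- The constant supplied by `IsBigOP` may be negative; truncating at zero keeps the threshold
  -- monotone in the scale.
  refine ⟨max M 0, ?_⟩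
  have h2 : ∀ᶠ n in atTop, P {ω | ¬ |Y n ω| ≤ |Z n ω|} ≤ ENNReal.ofReal (ε / 2) :=
    (hYZ.eventually (gt_mem_nhds (by simpa using half_pos hε))).mono fun n hn => hn.le
  filter_upwards [hM, h2, hab] with n h1 h2 h3
  calc P {ω | max M 0 * |a n| < |Y n ω|}
      ≤ P ({ω | M * |b n| < |Z n ω|} ∪ {ω | ¬ |Y n ω| ≤ |Z n ω|}) := by
        refine measure_mono fun ω hω => ?_
        by_cases hc : |Y n ω| ≤ |Z n ω|
        · left
          have : M * |b n| ≤ max M 0 * |a n| :=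
            mul_le_mul (le_max_left _ _) h3 (abs_nonneg _) (le_max_right _ _)
          exact this.trans_lt (lt_of_lt_of_le hω hc)
        · right; exact hc
    _ ≤ ENNReal.ofReal (ε / 2) + ENNReal.ofReal (ε / 2) :=
        (measure_union_le _ _).trans (add_le_add h1 h2)
    _ = ENNReal.ofReal ε := by
        rw [← ENNReal.ofReal_add (half_pos hε).le (half_pos hε).le, add_halves]

lemma IsBigOP.mono_left {Y Z : ℕ → Ω → ℝ} {a : ℕ → ℝ} (hZ : IsBigOP P Z a)
    (hYZ : HighProb P fun n ω => |Y n ω| ≤ |Z n ω|) : IsBigOP P Y a :=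
  hZ.mono hYZ (Eventually.of_forall fun _ => le_rfl)

lemma IsBigOP.const_scale {Y : ℕ → Ω → ℝ} {a b : ℕ → ℝ} {C : ℝ} (hY : IsBigOP P Y b)
    (hab : ∀ᶠ n in atTop, |b n| ≤ C * |a n|) : IsBigOP P Y a := by
  intro ε hε
  obtain ⟨M, hM⟩ := hY ε hε
  refine ⟨max M 0 * C, ?_⟩
  filter_upwards [hM, hab] with n h1 h2
  refine (measure_mono fun ω hω => ?_).trans h1
  have h3 : M * |b n| ≤ max M 0 * C * |a n| := by
    rw [mul_assoc]
    exact mul_le_mul (le_max_left _ _) h2 (abs_nonneg _) (le_max_right _ _)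
  exact h3.trans_lt hω

lemma IsBigOP.add {Y Z : ℕ → Ω → ℝ} {a : ℕ → ℝ} (hY : IsBigOP P Y a) (hZ : IsBigOP P Z a) :
    IsBigOP P (fun n ω => Y n ω + Z n ω) a := by
  intro ε hε
  obtain ⟨M, hM⟩ := hY (ε / 2) (half_pos hε)
  obtain ⟨N, hN⟩ := hZ (ε / 2) (half_pos hε)
  refine ⟨M + N, ?_⟩
  filter_upwards [hM, hN] with n h1 h2
  calc P {ω | (M + N) * |a n| < |Y n ω + Z n ω|}
      ≤ P ({ω | M * |a n| < |Y n ω|} ∪ {ω | N * |a n| < |Z n ω|}) := by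
        refine measure_mono fun ω hω => ?_
        by_contra hc
        simp only [Set.mem_union, Set.mem_ofPred_eq, not_or, not_lt] at hc hω
        have := abs_add_le (Y n ω) (Z n ω)
        nlinarith [hc.1, hc.2]
    _ ≤ ENNReal.ofReal (ε / 2) + ENNReal.ofReal (ε / 2) :=
        (measure_union_le _ _).trans (add_le_add h1 h2)
    _ = ENNReal.ofReal ε := by
        rw [← ENNReal.ofReal_add (half_pos hε).le (half_pos hε).le, add_halves]

lemma IsBigOP.mul {Y Z : ℕ → Ω → ℝ} {a b : ℕ → ℝ} (hY : IsBigOP P Y a) (hZ : IsBigOP P Z b) :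
    IsBigOP P (fun n ω => Y n ω * Z n ω) (fun n => a n * b n) := by
  intro ε hε
  obtain ⟨M, hM⟩ := hY (ε / 2) (half_pos hε)
  obtain ⟨N, hN⟩ := hZ (ε / 2) (half_pos hε)
  refine ⟨|M| * |N|, ?_⟩
  filter_upwards [hM, hN] with n h1 h2
  calc P {ω | |M| * |N| * |a n * b n| < |Y n ω * Z n ω|}
      ≤ P ({ω | M * |a n| < |Y n ω|} ∪ {ω | N * |b n| < |Z n ω|}) := by
        refine measure_mono fun ω hω => ?_
        by_contra hc
        simp only [Set.mem_union, Set.mem_ofPred_eq, not_or, not_lt, abs_mul] at hc hω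
        have h3 : |Y n ω| ≤ |M| * |a n| :=
          hc.1.trans (mul_le_mul_of_nonneg_right (le_abs_self _) (abs_nonneg _))
        have h4 : |Z n ω| ≤ |N| * |b n| :=
          hc.2.trans (mul_le_mul_of_nonneg_right (le_abs_self _) (abs_nonneg _))
        have h5 := mul_le_mul h3 h4 (abs_nonneg _) (by positivity)
        linarith
    _ ≤ ENNReal.ofReal (ε / 2) + ENNReal.ofReal (ε / 2) :=
        (measure_union_le _ _).trans (add_le_add h1 h2)
    _ = ENNReal.ofReal ε := by
        rw [← ENNReal.ofReal_add (half_pos hε).le (half_pos hε).le, add_halves]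

lemma isBigOP_of_eventually_le {Y : ℕ → Ω → ℝ} {a : ℕ → ℝ} (C : ℝ)
    (h : ∀ᶠ n in atTop, ∀ ω, |Y n ω| ≤ C * |a n|) : IsBigOP P Y a := by
  refine fun ε _ => ⟨C, ?_⟩
  filter_upwards [h] with n hn
  have : {ω | C * |a n| < |Y n ω|} = ∅ := by
    ext ω; simpa using hn ω
  simp [this]

lemma IsBigOP.finset_sum {ι : Type*} (s : Finset ι) {Y : ι → ℕ → Ω → ℝ} {a : ℕ → ℝ}
    (h : ∀ i, IsBigOP P (Y i) a) : IsBigOP P (fun n ω => ∑ i ∈ s, Y i n ω) a := by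
  classical
  induction s using Finset.induction_on with
  | empty => exact isBigOP_of_eventually_le 0 (by simp)
  | insert i s hi ih =>
    simp_rw [Finset.sum_insert hi]
    exact (h i).add ih

lemma IsBigOP.abs {Y : ℕ → Ω → ℝ} {a : ℕ → ℝ} (h : IsBigOP P Y a) :
    IsBigOP P (fun n ω => |Y n ω|) a := by
  intro ε hε
  simpa using h ε hε

lemma IsBigOP.sqrt {Y : ℕ → Ω → ℝ} {a : ℕ → ℝ} (h : IsBigOP P Y fun n => a n ^ 2) :
    IsBigOP P (fun n ω => √(Y n ω)) a := by
  intro ε hε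
  obtain ⟨M, hM⟩ := h ε hε
  refine ⟨√(max M 0), ?_⟩
  filter_upwards [hM] with n hn
  refine (measure_mono fun ω hω => ?_).trans hn
  simp only [Set.mem_ofPred_eq, abs_of_nonneg (Real.sqrt_nonneg _)] at hω ⊢
  rw [Real.lt_sqrt (by positivity), mul_pow, Real.sq_sqrt (le_max_right _ _), sq_abs] at hω
  rw [abs_of_nonneg (sq_nonneg (a n))]
  exact (mul_le_mul_of_nonneg_right (le_max_left _ _) (sq_nonneg _)).trans_lt
    (hω.trans_le (le_abs_self _))

/-- Markov's inequality. -/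
lemma isBigOP_of_integral_abs [IsFiniteMeasure P] {Y : ℕ → Ω → ℝ} {a : ℕ → ℝ} (C : ℝ)
    (ha : ∀ᶠ n in atTop, 0 < a n) (hint : ∀ᶠ n in atTop, Integrable (Y n) P)
    (hb : ∀ᶠ n in atTop, ∫ ω, |Y n ω| ∂P ≤ C * a n) : IsBigOP P Y a := by
  intro ε hε
  -- The added one makes the level strictly positive, as needed to divide by it in Markov's
  -- inequality.
  refine ⟨(|C| + 1) / ε, ?_⟩
  filter_upwards [ha, hint, hb] with n h1 h2 h3
  have h4 := mul_meas_ge_le_integral_of_nonneg (μ := P) (f := fun ω => |Y n ω|)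
    (Eventually.of_forall fun _ => abs_nonneg _) h2.abs ((|C| + 1) / ε * a n)
  have h5 : 0 < (|C| + 1) / ε * a n := by positivity
  have h6 : P.real {ω | (|C| + 1) / ε * a n ≤ |Y n ω|} ≤ ε := by
    rw [← mul_le_mul_iff_right₀ h5]
    refine (h4.trans h3).trans ?_
    have : (|C| + 1) / ε * a n * ε = (|C| + 1) * a n := by field_simp
    rw [this]
    exact mul_le_mul_of_nonneg_right ((le_abs_self C).trans (by linarith)) h1.le
  refine (measure_mono (t := {ω | (|C| + 1) / ε * a n ≤ |Y n ω|}) fun ω hω => ?_).trans ?_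
  · simp only [Set.mem_ofPred_eq, abs_of_pos h1] at hω ⊢
    exact hω.le
  · rw [← ENNReal.ofReal_toReal (measure_ne_top P {ω | (|C| + 1) / ε * a n ≤ |Y n ω|})]
    exact ENNReal.ofReal_le_ofReal h6

/-- Chebyshev's inequality. -/
lemma isBigOP_of_integral_sq [IsFiniteMeasure P] {Y : ℕ → Ω → ℝ} {a : ℕ → ℝ} (C : ℝ)
    (ha : ∀ᶠ n in atTop, 0 < a n) (hint : ∀ᶠ n in atTop, Integrable (fun ω => Y n ω ^ 2) P)
    (hb : ∀ᶠ n in atTop, ∫ ω, Y n ω ^ 2 ∂P ≤ C * a n ^ 2) : IsBigOP P Y a := by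
  have h : IsBigOP P (fun n ω => Y n ω ^ 2) fun n => a n ^ 2 := by
    refine isBigOP_of_integral_abs C (ha.mono fun n hn => pow_pos hn 2) hint ?_
    simpa using hb
  refine h.sqrt.mono_left (HighProb.of_eventually (Eventually.of_forall fun n ω => ?_))
  rw [Real.sqrt_sq_eq_abs, abs_abs]

lemma IsBigOP.tendsto_measure {Y : ℕ → Ω → ℝ} {a : ℕ → ℝ} (h : IsBigOP P Y a)
    (ha : Tendsto a atTop (𝓝 0)) {ε : ℝ} (hε : 0 < ε) :
    Tendsto (fun n => P {ω | ε ≤ |Y n ω|}) atTop (𝓝 0) := by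
  rw [ENNReal.tendsto_nhds_zero]
  intro η hη
  obtain ⟨η', h1, h2⟩ : ∃ η' : ℝ, 0 < η' ∧ ENNReal.ofReal η' ≤ η := by
    by_cases ht : η = ⊤
    · exact ⟨1, one_pos, by simp [ht]⟩
    · exact ⟨η.toReal, ENNReal.toReal_pos hη.ne' ht, by rw [ENNReal.ofReal_toReal ht]⟩
  obtain ⟨M, hM⟩ := h η' h1
  have h3 : Tendsto (fun n => M * |a n|) atTop (𝓝 0) := by
    simpa using (ha.abs).const_mul M
  filter_upwards [hM, h3.eventually (gt_mem_nhds hε)] with n h4 h5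
  exact (measure_mono fun ω hω => h5.trans_le hω).trans (h4.trans h2)

lemma IsBigOP.highProb_lt {Y : ℕ → Ω → ℝ} {a : ℕ → ℝ} (h : IsBigOP P Y a)
    (ha : Tendsto a atTop (𝓝 0)) {ε : ℝ} (hε : 0 < ε) :
    HighProb P fun n ω => |Y n ω| < ε := by
  simpa [HighProb] using h.tendsto_measure ha hε

lemma IsBigOP.tendstoInMeasure {Y : ℕ → Ω → ℝ} {a : ℕ → ℝ} (h : IsBigOP P Y a)
    (ha : Tendsto a atTop (𝓝 0)) : TendstoInMeasure P Y atTop 0 := by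
  rw [tendstoInMeasure_iff_norm]
  intro ε hε
  simpa using h.tendsto_measure ha hε

end StochasticOrder

/-! ### A central limit theorem for bounded triangular arrays -/

/-- A second order Taylor expansion of the exponential. The cubic remainder is controlled by
$|g|^3\le Bg^2$, so the bound and the unit variance replace a third moment. -/
lemma norm_charFun_map_sub_le {μ : Measure ℝ} [IsProbabilityMeasure μ] {g : ℝ → ℝ} {B s : ℝ}
    (hg : Measurable g) (hB : ∀ y, |g y| ≤ B) (h0 : ∫ y, g y ∂μ = 0)
    (h1 : ∫ y, g y ^ 2 ∂μ = 1) (hs : |s| * B ≤ 1) :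
    ‖charFun (μ.map g) s - (1 - (s : ℂ) ^ 2 / 2)‖ ≤ |s| ^ 3 * B := by
  have hi : Integrable g μ := Integrable.of_bound hg.aestronglyMeasurable B
    (Eventually.of_forall hB)
  have hi2 : Integrable (fun y => g y ^ 2) μ :=
    Integrable.of_bound (hg.pow_const 2).aestronglyMeasurable (B ^ 2)
      (Eventually.of_forall fun y => by
        rw [Real.norm_eq_abs, abs_pow]; exact pow_le_pow_left₀ (abs_nonneg _) (hB y) 2)
  rw [charFun_apply_real, integral_map hg.aemeasurable (by fun_prop)]
  have hpoly : ∫ y, (1 + (s : ℂ) * Complex.I * (g y : ℂ) - (s : ℂ) ^ 2 / 2 * ((g y ^ 2 : ℝ) : ℂ)) ∂μ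
      = 1 - (s : ℂ) ^ 2 / 2 := by
    have e0 : ∫ y, (g y : ℂ) ∂μ = ((∫ y, g y ∂μ : ℝ) : ℂ) := integral_ofReal
    have e1 : ∫ y, ((g y ^ 2 : ℝ) : ℂ) ∂μ = ((∫ y, g y ^ 2 ∂μ : ℝ) : ℂ) := integral_ofReal
    rw [integral_sub, integral_add, integral_const_mul, integral_const_mul, e0, e1, h0, h1]
    · simp
    · exact integrable_const _
    · exact (hi.ofReal (𝕜 := ℂ)).const_mul _
    · exact (integrable_const _).add ((hi.ofReal (𝕜 := ℂ)).const_mul _)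
    · exact (hi2.ofReal (𝕜 := ℂ)).const_mul _
  have hexp : Integrable (fun y => Complex.exp (s * g y * Complex.I)) μ := by
    refine Integrable.of_bound (by fun_prop) 1 (Eventually.of_forall fun y => ?_)
    have : (s : ℂ) * g y * Complex.I = ((s * g y : ℝ) : ℂ) * Complex.I := by push_cast; ring
    rw [this, Complex.norm_exp_ofReal_mul_I]
  rw [← hpoly, ← integral_sub hexp]
  · have hbd : ∀ y, ‖Complex.exp (s * g y * Complex.I) -
        (1 + (s : ℂ) * Complex.I * (g y : ℂ) - (s : ℂ) ^ 2 / 2 * ((g y ^ 2 : ℝ) : ℂ))‖ ≤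
        |s| ^ 3 * B * g y ^ 2 := by
      intro y
      have hn : ‖(s : ℂ) * g y * Complex.I‖ = |s| * |g y| := by simp
      have hle : |s| * |g y| ≤ |s| * B := mul_le_mul_of_nonneg_left (hB y) (abs_nonneg _)
      have h := Complex.exp_bound (x := (s : ℂ) * g y * Complex.I)
        (by rw [hn]; exact hle.trans hs) (n := 3) (by norm_num)
      rw [hn] at h
      have he : ∑ m ∈ Finset.range 3, ((s : ℂ) * g y * Complex.I) ^ m / (m.factorial : ℂ) =
          1 + (s : ℂ) * Complex.I * (g y : ℂ) - (s : ℂ) ^ 2 / 2 * ((g y ^ 2 : ℝ) : ℂ) := by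
        simp [Finset.sum_range_succ, Nat.factorial, mul_pow]
        ring
      rw [he] at h
      refine h.trans ?_
      have h3 : (|s| * |g y|) ^ 3 = |s| ^ 3 * (|g y| * g y ^ 2) := by
        rw [← sq_abs (g y)]; ring
      have h4 : |g y| * g y ^ 2 ≤ B * g y ^ 2 :=
        mul_le_mul_of_nonneg_right (hB y) (sq_nonneg _)
      -- The factor in the exponential remainder is $4/(3!\cdot3)=2/9$.
      calc (|s| * |g y|) ^ 3 * ((Nat.succ 3 : ℕ) * (((Nat.factorial 3 : ℕ) : ℝ) * (3 : ℕ))⁻¹)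
          ≤ (|s| * |g y|) ^ 3 * 1 := by
            refine mul_le_mul_of_nonneg_left ?_ (by positivity)
            norm_num [Nat.factorial]
        _ ≤ |s| ^ 3 * B * g y ^ 2 := by
            rw [mul_one, h3, mul_assoc]
            exact mul_le_mul_of_nonneg_left h4 (by positivity)
    refine (norm_integral_le_of_norm_le (hi2.const_mul _) (Eventually.of_forall hbd)).trans ?_
    rw [integral_const_mul, h1, mul_one]
  · exact ((integrable_const _).add ((hi.ofReal (𝕜 := ℂ)).const_mul _)).sub
      ((hi2.ofReal (𝕜 := ℂ)).const_mul _)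

/-- The characteristic function of the normalized sum is an $n$-th power whose base is $1-t^2/(2n)$
up to $|t|^3B_n/n^{3/2}=o(1/n)$, so it converges to $e^{-t^2/2}$. The function may change with $n$
because the influence function depends on the bandwidth. -/
theorem tendstoInDistribution_triangular {Ω : Type*} [MeasurableSpace Ω] {P : Measure Ω}
    [IsProbabilityMeasure P] {μ : Measure ℝ} [IsProbabilityMeasure μ] {X : ℕ → Ω → ℝ}
    (hX : ∀ i, Measurable (X i)) (hindep : iIndepFun X P) (hlaw : ∀ i, P.map (X i) = μ)
    {g : ℕ → ℝ → ℝ} {B : ℕ → ℝ} (hg : ∀ n, Measurable (g n))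
    (hB : ∀ᶠ n in atTop, ∀ y, |g n y| ≤ B n) (h0 : ∀ᶠ n in atTop, ∫ y, g n y ∂μ = 0)
    (h1 : ∀ᶠ n in atTop, ∫ y, g n y ^ 2 ∂μ = 1)
    (hlim : Tendsto (fun n : ℕ => B n / √n) atTop (𝓝 0)) :
    TendstoInDistribution (fun (n : ℕ) ω => (√n)⁻¹ * ∑ i ∈ Finset.range n, g n (X i ω)) atTop
      (id : ℝ → ℝ) (fun _ => P) (gaussianReal 0 1) where
  forall_aemeasurable n := by
    have := fun i => (hg n).comp (hX i)
    exact ((Finset.measurable_fun_sum _ fun i _ => this i).const_mul _).aemeasurable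
  tendsto := by
    refine ProbabilityMeasure.tendsto_iff_tendsto_charFun.2 fun t => ?_
    have hmap : ∀ n i, P.map (fun ω => g n (X i ω)) = μ.map (g n) := fun n i => by
      rw [← hlaw i, Measure.map_map (hg n) (hX i)]; rfl
    have hcf : ∀ n : ℕ, charFun (P.map fun ω => (√n)⁻¹ * ∑ i ∈ Finset.range n, g n (X i ω)) t =
        (charFun (μ.map (g n)) ((√n)⁻¹ * t)) ^ n := by
      intro n
      have hm : ∀ i, AEMeasurable (fun ω => g n (X i ω)) P := fun i =>
        ((hg n).comp (hX i)).aemeasurable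
      have hi : iIndepFun (fun i ω => g n (X i ω)) P := hindep.comp (fun _ => g n) fun _ => hg n
      rw [charFun_map_mul_comp (Finset.aemeasurable_fun_sum _ fun i _ => hm i),
        (hi.restrict _).charFun_map_fun_finsetSum_eq_prod (fun i _ => hm i)]
      simp [hmap]
    simp only [ProbabilityMeasure.coe_mk, hcf, Measure.map_id, charFun_gaussianReal]
    have : Complex.exp (t * (0 : ℝ) * Complex.I - ((1 : NNReal) : ℝ) * t ^ 2 / 2) =
        Complex.exp (-(t ^ 2 / 2 : ℂ)) := by
      congr 1; simp
    rw [this]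
    apply Complex.tendsto_pow_exp_of_isLittleO_sub_add_div
    rw [Asymptotics.isLittleO_iff]
    intro ε hε
    have hl1 : Tendsto (fun n : ℕ => |t| * (B n / √n)) atTop (𝓝 0) := by
      simpa using hlim.const_mul |t|
    have hl2 : Tendsto (fun n : ℕ => |t| ^ 3 * (B n / √n)) atTop (𝓝 0) := by
      simpa using hlim.const_mul (|t| ^ 3)
    filter_upwards [hB, h0, h1, hl1.eventually (ge_mem_nhds one_pos),
      hl2.eventually (ge_mem_nhds hε), eventually_gt_atTop 0] with n b0 b1 b2 b3 b4 b5
    have hn : (0 : ℝ) < n := by exact_mod_cast b5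
    have hsn : 0 < √(n : ℝ) := Real.sqrt_pos.2 hn
    have habs : |(√(n : ℝ))⁻¹ * t| = |t| / √n := by
      rw [abs_mul, abs_of_pos (inv_pos.2 hsn)]; field_simp
    have key := norm_charFun_map_sub_le (hg n) b0 b1 b2 (s := (√(n : ℝ))⁻¹ * t)
      (by rw [habs]; calc _ = |t| * (B n / √n) := by ring
                     _ ≤ 1 := b3)
    have e1 : (1 : ℂ) + -((t : ℂ) ^ 2 / 2) / n = 1 - (((√(n : ℝ))⁻¹ * t : ℝ) : ℂ) ^ 2 / 2 := by
      have : (((√(n : ℝ))⁻¹ * t : ℝ) : ℂ) ^ 2 = (t : ℂ) ^ 2 / n := by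
        rw [← Complex.ofReal_pow, mul_pow, inv_pow, Real.sq_sqrt hn.le]
        push_cast; field_simp
      rw [this]; ring
    rw [e1]
    refine key.trans ?_
    rw [habs]
    have e2 : ‖(1 / n : ℂ)‖ = 1 / n := by simp
    rw [e2]
    calc (|t| / √n) ^ 3 * B n = |t| ^ 3 * (B n / √n) * (1 / (√n) ^ 2) := by
          field_simp
      _ = |t| ^ 3 * (B n / √n) * (1 / n) := by rw [Real.sq_sqrt hn.le]
      _ ≤ ε * (1 / n) := mul_le_mul_of_nonneg_right b4 (by positivity)

/-! ### The local density and the population quantities -/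

/-- An upper bound on the density is all that later estimates need, and that is what a one-sided
bound on the remainder gives. The point $\mathsf x$ is excluded because neither expansion speaks of
$f(\mathsf x)$. -/
lemma TwoSidedExpansion.exists_le {f : ℝ → ℝ} {x δ fm fp dfm dfp : ℝ} (hδ : 0 < δ)
    (h : TwoSidedExpansion f x δ fm fp dfm dfp) :
    ∃ C : ℝ, 0 < C ∧ ∀ t ∈ Set.Icc (x - δ) (x + δ), t ≠ x → f t ≤ C := by
  have aux : ∀ (s : Set ℝ) (a b : ℝ), (∀ u ∈ s, |u| ≤ δ ∧ u ≠ 0) →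
      BddAbove ((fun u => (f (x + u) - a - u * b) / u ^ 2) '' s) →
      ∃ C : ℝ, 0 < C ∧ ∀ u ∈ s, f (x + u) ≤ C := by
    rintro s a b hs ⟨M, hM⟩
    refine ⟨|a| + δ * |b| + |M| * δ ^ 2 + 1, by positivity, fun u hu => ?_⟩
    obtain ⟨h1, h2⟩ := hs u hu
    have h3 : (f (x + u) - a - u * b) / u ^ 2 ≤ M := hM ⟨u, hu, rfl⟩
    have h4 : 0 < u ^ 2 := by positivity
    rw [div_le_iff₀ h4] at h3
    have h5 : u ^ 2 ≤ δ ^ 2 := by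
      rw [← sq_abs u]; exact pow_le_pow_left₀ (abs_nonneg _) h1 2
    have h6 : M * u ^ 2 ≤ |M| * δ ^ 2 :=
      mul_le_mul (le_abs_self _) h5 h4.le (abs_nonneg _)
    have h7 : u * b ≤ δ * |b| := by
      refine (le_abs_self _).trans ?_
      rw [abs_mul]
      exact mul_le_mul_of_nonneg_right h1 (abs_nonneg _)
    linarith [le_abs_self a]
  obtain ⟨C₁, hC₁, h1⟩ := aux _ _ _ (fun u hu => ⟨by
    rw [abs_le]; exact ⟨hu.1, by linarith [hu.2]⟩, hu.2.ne⟩) h.1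
  obtain ⟨C₂, _, h2⟩ := aux _ _ _ (fun u hu => ⟨by
    rw [abs_le]; exact ⟨by linarith [hu.1], hu.2⟩, hu.1.ne'⟩) h.2
  refine ⟨max C₁ C₂, lt_max_of_lt_left hC₁, fun t ht htx => ?_⟩
  have he : f t = f (x + (t - x)) := by congr 1; ring
  rw [he]
  rcases lt_or_gt_of_ne htx with hlt | hgt
  · exact (h1 (t - x) ⟨by linarith [ht.1], by linarith⟩).trans (le_max_left _ _)
  · exact (h2 (t - x) ⟨by linarith, by linarith [ht.2]⟩).trans (le_max_right _ _)

section Density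

variable {μ : Measure ℝ} {f : ℝ → ℝ} {x δ : ℝ}

lemma HasDensityOn.integrableOn_Ioc {F : ℝ → ℝ} (hf : HasDensityOn F f x δ) :
    IntegrableOn f (Set.Ioc (x - δ) (x + δ)) :=
  hf.1.mono_set Set.Ioc_subset_Icc_self

variable [IsProbabilityMeasure μ]

/-- The sign of `f` is not prescribed, so the identity is kept free of subtraction by moving the
negative part to the side of `μ`. Two finite measures agree once they agree on half-lines, where the
increments of the distribution function decide. -/
lemma HasDensityOn.restrict_add (hδ : 0 < δ) (hf : HasDensityOn (cdf μ) f x δ) :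
    μ.restrict (Set.Ioc (x - δ) (x + δ)) +
      (volume.restrict (Set.Ioc (x - δ) (x + δ))).withDensity (fun t => ENNReal.ofReal (-f t)) =
    (volume.restrict (Set.Ioc (x - δ) (x + δ))).withDensity (fun t => ENNReal.ofReal (f t)) := by
  have hi := hf.integrableOn_Ioc
  have := isFiniteMeasure_withDensity_ofReal hi.2
  have := isFiniteMeasure_withDensity_ofReal hi.neg.2
  have : IsFiniteMeasure ((volume.restrict (Set.Ioc (x - δ) (x + δ))).withDensity
    (fun t => ENNReal.ofReal (-f t))) := this
  refine Measure.ext_of_Iic _ _ fun t => ?_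
  obtain ⟨s, hs1, hs2, hs⟩ : ∃ s, x - δ ≤ s ∧ s ≤ x + δ ∧
      Set.Iic t ∩ Set.Ioc (x - δ) (x + δ) = Set.Ioc (x - δ) s := by
    -- The endpoint is `t` clamped to the window; for `t` to the left of the window the trace is
    -- empty.
    refine ⟨max (x - δ) (min t (x + δ)), le_max_left _ _,
      max_le (by linarith) (min_le_right _ _), ?_⟩
    ext y
    simp only [Set.mem_inter_iff, Set.mem_Iic, Set.mem_Ioc, le_max_iff, le_min_iff]
    constructor
    · rintro ⟨h1, h2, h3⟩; exact ⟨h2, Or.inr ⟨h1, h3⟩⟩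
    · rintro ⟨h1, h2 | h2⟩
      · linarith
      · exact ⟨h2.1, h1, h2.2⟩
  have hi' : IntegrableOn f (Set.Ioc (x - δ) s) := hi.mono_set (Set.Ioc_subset_Ioc_right hs2)
  rw [Measure.add_apply, withDensity_apply _ measurableSet_Iic,
    withDensity_apply _ measurableSet_Iic, Measure.restrict_apply measurableSet_Iic,
    Measure.restrict_restrict measurableSet_Iic, hs]
  have hFm := (monotone_cdf μ) hs1
  have hF : cdf μ s - cdf μ (x - δ) = ∫ y in Set.Ioc (x - δ) s, f y := by
    rw [hf.2 _ ⟨le_rfl, by linarith⟩ _ ⟨hs1, hs2⟩, intervalIntegral.integral_of_le hs1]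
  have hμ : μ (Set.Ioc (x - δ) s) = ENNReal.ofReal (∫ y in Set.Ioc (x - δ) s, f y) := by
    conv_lhs => rw [← measure_cdf μ]
    rw [StieltjesFunction.measure_Ioc, hF]
  have hpos : 0 ≤ ∫ y in Set.Ioc (x - δ) s, f y := by rw [← hF]; linarith
  have hA := hi'.lintegral_lt_top.ne
  have hB := hi'.neg.lintegral_lt_top.ne
  rw [integral_eq_lintegral_pos_part_sub_lintegral_neg_part hi'] at hμ hpos
  have hA' := ENNReal.ofReal_toReal hA
  have hB' := ENNReal.ofReal_toReal hB
  simp only [Pi.neg_apply] at hB hB'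
  rw [hμ]
  conv_lhs => enter [2]; rw [← hB']
  rw [← ENNReal.ofReal_add hpos ENNReal.toReal_nonneg, sub_add_cancel, hA']

/-- Dropping the negative part in `restrict_add` leaves an inequality in the useful direction, and
the uncontrolled value at `x` sits on a Lebesgue null set. -/
lemma HasDensityOn.measureReal_Icc_le (hδ : 0 < δ) (hf : HasDensityOn (cdf μ) f x δ) {C : ℝ}
    (hC : 0 < C) (hfC : ∀ t ∈ Set.Icc (x - δ) (x + δ), t ≠ x → f t ≤ C) {h : ℝ} (h0 : 0 < h)
    (hh : h < δ) : μ.real (Set.Icc (x - h) (x + h)) ≤ 2 * C * h := by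
  have hsub : Set.Icc (x - h) (x + h) ⊆ Set.Ioc (x - δ) (x + δ) := fun y hy =>
    ⟨by linarith [hy.1], by linarith [hy.2]⟩
  have h1 : μ (Set.Icc (x - h) (x + h)) ≤ ENNReal.ofReal (2 * C * h) := by
    calc μ (Set.Icc (x - h) (x + h))
        = μ.restrict (Set.Ioc (x - δ) (x + δ)) (Set.Icc (x - h) (x + h)) := by
          rw [Measure.restrict_apply measurableSet_Icc, Set.inter_eq_left.2 hsub]
      _ ≤ (volume.restrict (Set.Ioc (x - δ) (x + δ))).withDensity
            (fun t => ENNReal.ofReal (f t)) (Set.Icc (x - h) (x + h)) := by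
          rw [← hf.restrict_add hδ, Measure.add_apply]
          exact le_self_add
      _ = ∫⁻ t in Set.Icc (x - h) (x + h), ENNReal.ofReal (f t) := by
          rw [withDensity_apply _ measurableSet_Icc, Measure.restrict_restrict measurableSet_Icc,
            Set.inter_eq_left.2 hsub]
      _ ≤ ∫⁻ _t in Set.Icc (x - h) (x + h), ENNReal.ofReal C := by
          refine lintegral_mono_ae ?_
          have hx : ∀ᵐ t ∂(volume.restrict (Set.Icc (x - h) (x + h))), t ≠ x :=
            ae_restrict_of_ae (by simp [ae_iff])
          filter_upwards [hx, ae_restrict_mem measurableSet_Icc] with t h2 h3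
          exact ENNReal.ofReal_le_ofReal (hfC t (Set.Ioc_subset_Icc_self (hsub h3)) h2)
      _ = ENNReal.ofReal (2 * C * h) := by
          rw [lintegral_const, Measure.restrict_apply MeasurableSet.univ, Set.univ_inter,
            Real.volume_Icc, ← ENNReal.ofReal_mul hC.le]
          congr 1; ring
  rw [measureReal_def]
  exact ENNReal.toReal_le_of_le_ofReal (by positivity) h1

lemma HasDensityOn.setIntegral_eq (hδ : 0 < δ) (hf : HasDensityOn (cdf μ) f x δ) {G : ℝ → ℝ}
    (hG : Measurable G) {B : ℝ} (hB : ∀ y, |G y| ≤ B) :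
    ∫ y in Set.Ioc (x - δ) (x + δ), G y ∂μ = ∫ y in Set.Ioc (x - δ) (x + δ), G y * f y := by
  have hi := hf.integrableOn_Ioc
  have hfin1 := isFiniteMeasure_withDensity_ofReal hi.2
  have hfin2 := isFiniteMeasure_withDensity_ofReal hi.neg.2
  have hfin2 : IsFiniteMeasure ((volume.restrict (Set.Ioc (x - δ) (x + δ))).withDensity
    (fun t => ENNReal.ofReal (-f t))) := hfin2
  have hint : ∀ ν : Measure ℝ, IsFiniteMeasure ν → Integrable G ν := fun ν _ =>
    Integrable.of_bound hG.aestronglyMeasurable B (Eventually.of_forall hB)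
  have key := congrArg (fun ν => ∫ y, G y ∂ν) (hf.restrict_add hδ)
  have haem : AEMeasurable f (volume.restrict (Set.Ioc (x - δ) (x + δ))) := hi.1.aemeasurable
  have hneg : AEMeasurable (fun t => ENNReal.ofReal (-f t))
    (volume.restrict (Set.Ioc (x - δ) (x + δ))) := haem.neg.ennreal_ofReal
  rw [integral_add_measure (hint _ inferInstance) (hint _ inferInstance),
    integral_withDensity_eq_integral_toReal_smul₀ hneg
      (Eventually.of_forall fun _ => ENNReal.ofReal_lt_top),
    integral_withDensity_eq_integral_toReal_smul₀ haem.ennreal_ofReal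
      (Eventually.of_forall fun _ => ENNReal.ofReal_lt_top)] at key
  rw [eq_sub_of_add_eq key, ← integral_sub]
  · refine integral_congr_ae (Eventually.of_forall fun y => ?_)
    simp only [smul_eq_mul, ENNReal.toReal_ofReal']
    have : max (f y) 0 - max (-f y) 0 = f y := by
      rcases le_total (f y) 0 with h | h
      · rw [max_eq_right h, max_eq_left (by linarith)]; ring
      · rw [max_eq_left h, max_eq_right (by linarith)]; ring
    rw [← sub_mul, this, mul_comm]
  · have h1 : Integrable (fun y => max (f y) 0) (volume.restrict (Set.Ioc (x - δ) (x + δ))) :=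
      hi.pos_part
    simp only [ENNReal.toReal_ofReal', smul_eq_mul]
    exact h1.mul_bdd hG.aestronglyMeasurable (Eventually.of_forall hB)
  · have h1 : Integrable (fun y => max (-f y) 0) (volume.restrict (Set.Ioc (x - δ) (x + δ))) :=
      hi.neg_part
    simp only [ENNReal.toReal_ofReal', smul_eq_mul]
    exact h1.mul_bdd hG.aestronglyMeasurable (Eventually.of_forall hB)

/-- The indicator of the support is inserted while the measure is still `μ`, whose support has full
measure; after the change of variables it becomes the domain of integration. -/
lemma HasDensityOn.integral_eq (hδ : 0 < δ) (hf : HasDensityOn (cdf μ) f x δ) {h : ℝ}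
    (h0 : 0 < h) (hh : h < δ) {G : ℝ → ℝ} (hG : Measurable G) {B : ℝ} (hB : ∀ y, |G y| ≤ B)
    (hsupp : ∀ y, y ∉ Set.Icc (x - h) (x + h) → G y = 0) :
    ∫ y, G y ∂μ = h * ∫ u in rescaledSupport μ x h, G (x + h * u) * f (x + h * u) := by
  have hS : MeasurableSet μ.support := (Measure.isClosed_support (μ := μ)).measurableSet
  have hS' : MeasurableSet (rescaledSupport μ x h) :=
    hS.preimage (f := fun u : ℝ => x + h * u) (by fun_prop)
  have hI : ∀ y, y ∉ Set.Ioc (x - δ) (x + δ) → G y = 0 := fun y hy => hsupp y fun hy' =>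
    hy ⟨by linarith [hy'.1], by linarith [hy'.2]⟩
  set G' := μ.support.indicator G with hG'
  have hG'm : Measurable G' := hG.indicator hS
  have hG'B : ∀ y, |G' y| ≤ B := fun y => by
    by_cases hy : y ∈ μ.support
    · simpa [hG', hy] using hB y
    · simpa [hG', hy] using (abs_nonneg _).trans (hB y)
  have hG'I : ∀ y, y ∉ Set.Ioc (x - δ) (x + δ) → G' y = 0 := fun y hy => by
    by_cases hy' : y ∈ μ.support
    · simpa [hG', hy'] using hI y hy
    · simp [hG', hy']
  calc ∫ y, G y ∂μ = ∫ y, G' y ∂μ := by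
        refine integral_congr_ae ?_
        filter_upwards [Measure.support_mem_ae (μ := μ)] with y hy
        simp [hG', hy]
    _ = ∫ y in Set.Ioc (x - δ) (x + δ), G' y ∂μ :=
        (setIntegral_eq_integral_of_forall_compl_eq_zero hG'I).symm
    _ = ∫ y in Set.Ioc (x - δ) (x + δ), G' y * f y := hf.setIntegral_eq hδ hG'm hG'B
    _ = ∫ y, G' y * f y := setIntegral_eq_integral_of_forall_compl_eq_zero fun y hy => by
        rw [hG'I y hy, zero_mul]
    _ = h * ∫ u, G' (x + h * u) * f (x + h * u) := by
        rw [Measure.integral_comp_mul_left (fun y => G' (x + y) * f (x + y)) h,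
          integral_add_left_eq_self (fun y => G' y * f y) x, abs_of_pos (inv_pos.2 h0),
          smul_eq_mul, mul_inv_cancel_left₀ h0.ne']
    _ = h * ∫ u in rescaledSupport μ x h, G (x + h * u) * f (x + h * u) := by
        rw [← integral_indicator hS']
        congr 2
        ext u
        by_cases hu : x + h * u ∈ μ.support
        · have : u ∈ rescaledSupport μ x h := hu
          simp [hG', hu, this]
        · have : u ∉ rescaledSupport μ x h := hu
          simp [hG', hu, this]

end Density

/-! ### Kernel and basis -/

lemma IsKernel.measurable {K : ℝ → ℝ} (hK : IsKernel K) : Measurable K := by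
  classical
  have h := hK.continuousOn.measurable_piecewise (g := fun _ => (0 : ℝ))
    continuousOn_const measurableSet_Icc
  convert h using 1
  ext u
  by_cases hu : u ∈ Set.Icc (-1 : ℝ) 1
  · simp [Set.piecewise, hu]
  · rw [Set.piecewise_eq_of_notMem _ _ _ hu]; exact hK.eq_zero u hu

lemma IsKernel.exists_bound {K : ℝ → ℝ} (hK : IsKernel K) : ∃ B, 0 < B ∧ ∀ u, |K u| ≤ B := by
  obtain ⟨B, hB⟩ := (isCompact_Icc (a := (-1 : ℝ)) (b := 1)).exists_bound_of_continuousOn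
    hK.continuousOn
  refine ⟨max B 1, by positivity, fun u => ?_⟩
  by_cases hu : u ∈ Set.Icc (-1 : ℝ) 1
  · exact (hB u hu).trans (le_max_left _ _)
  · rw [hK.eq_zero u hu, abs_zero]; positivity

lemma IsBasis.exists_bound {d : ℕ} {R : ℝ → Fin d → ℝ} (hR : IsBasis R) (a b : ℝ) :
    ∃ B, 0 < B ∧ ∀ u ∈ Set.Icc a b, ∀ k, |R u k| ≤ B := by
  have h : Bornology.IsBounded (R '' Set.Icc a b) := by
    refine (isCompact_Icc (a := a) (b := b)).induction_on
      (p := fun s => Bornology.IsBounded (R '' s)) (by simp) ?_ ?_ ?_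
    · exact fun s t hst ht => ht.subset (Set.image_mono hst)
    · exact fun s t hs ht => by rw [Set.image_union]; exact hs.union ht
    · intro u _
      obtain ⟨s, hs, hb⟩ := hR.locallyBounded u
      exact ⟨s, mem_nhdsWithin_of_mem_nhds hs, hb⟩
  obtain ⟨B, hB⟩ := h.exists_norm_le
  refine ⟨max B 1, by positivity, fun u hu k => ?_⟩
  exact (norm_le_pi_norm (R u) k).trans ((hB _ ⟨u, hu, rfl⟩).trans (le_max_left _ _))

lemma indLe_eq_ite (a b : ℝ) : indLe a b = if a ≤ b then 1 else 0 := by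
  by_cases h : a ≤ b <;> simp [indLe, h]

lemma indLe_nonneg (a b : ℝ) : 0 ≤ indLe a b := by
  rw [indLe_eq_ite]; split_ifs <;> norm_num

lemma indLe_le_one (a b : ℝ) : indLe a b ≤ 1 := by
  rw [indLe_eq_ite]; split_ifs <;> norm_num

lemma abs_indLe_le (a b : ℝ) : |indLe a b| ≤ 1 := by
  rw [abs_of_nonneg (indLe_nonneg a b)]; exact indLe_le_one a b

lemma indLe_mul_indLe (t a b : ℝ) : indLe t a * indLe t b = indLe t (min a b) := by
  simp only [indLe_eq_ite, le_min_iff]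
  by_cases h1 : t ≤ a <;> by_cases h2 : t ≤ b <;> simp [h1, h2]

lemma measurable_indLe {α : Type*} [MeasurableSpace α] {f g : α → ℝ} (hf : Measurable f)
    (hg : Measurable g) : Measurable fun p => indLe (f p) (g p) := by
  simp_rw [indLe_eq_ite]
  exact Measurable.ite (measurableSet_le hf hg) measurable_const measurable_const

lemma integral_indLe (μ : Measure ℝ) [IsProbabilityMeasure μ] (y : ℝ) :
    ∫ t, indLe t y ∂μ = cdf μ y := by
  have : (fun t => indLe t y) = (Set.Iic y).indicator fun _ => (1 : ℝ) := rfl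
  rw [this, integral_indicator measurableSet_Iic, cdf_eq_real]
  simp

/-- The kernel-weighted basis `(1 / h) K((z - x) / h) R((z - x) / h)`. -/
def wbasis {d : ℕ} (K : ℝ → ℝ) (R : ℝ → Fin d → ℝ) (x h z : ℝ) (k : Fin d) : ℝ :=
  weight K x h z * R ((z - x) / h) k

/-- `t ↦ ∫ r(z) 𝟙(t ≤ z) μ(dz)`. -/
def upperInt (μ : Measure ℝ) (r : ℝ → ℝ) (t : ℝ) : ℝ := ∫ z, r z * indLe t z ∂μ

/-! ### Moments of upper integrals by Fubini's theorem -/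

section UpperInt

variable {μ : Measure ℝ} [IsProbabilityMeasure μ] {r q : ℝ → ℝ} {M N : ℝ}

lemma integrable_of_abs_le {α : Type*} [MeasurableSpace α] {ν : Measure α} [IsFiniteMeasure ν]
    {g : α → ℝ} (hg : Measurable g) {M : ℝ} (hM : ∀ y, |g y| ≤ M) : Integrable g ν :=
  Integrable.of_bound hg.aestronglyMeasurable M (Eventually.of_forall hM)

lemma measurable_upperInt (hr : Measurable r) : Measurable (upperInt μ r) := by
  have h : Measurable fun p : ℝ × ℝ => r p.2 * indLe p.1 p.2 :=
    (hr.comp measurable_snd).mul (measurable_indLe measurable_fst measurable_snd)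
  exact (h.stronglyMeasurable.integral_prod_right (ν := μ)).measurable

lemma abs_mul_indLe_le (a b c : ℝ) : |a * indLe b c| ≤ |a| := by
  rw [abs_mul]
  exact mul_le_of_le_one_right (abs_nonneg _) (abs_indLe_le b c)

lemma abs_upperInt_le {μ : Measure ℝ} {r : ℝ → ℝ} (hi : Integrable r μ) (t : ℝ) : |upperInt μ r t| ≤ ∫ z, |r z| ∂μ :=
  norm_integral_le_of_norm_le (f := fun z => r z * indLe t z) hi.abs
    (Eventually.of_forall fun _ => abs_mul_indLe_le _ _ _)

lemma integral_upperInt_mul (hr : Measurable r) (hM : ∀ z, |r z| ≤ M) (hq : Measurable q)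
    (hN : ∀ z, |q z| ≤ N) :
    ∫ t, upperInt μ r t * q t ∂μ = ∫ y, r y * ∫ t, indLe t y * q t ∂μ ∂μ := by
  have hm : Measurable fun p : ℝ × ℝ => r p.2 * (indLe p.1 p.2 * q p.1) :=
    (hr.comp measurable_snd).mul
      ((measurable_indLe measurable_fst measurable_snd).mul (hq.comp measurable_fst))
  have hb : ∀ p : ℝ × ℝ, |r p.2 * (indLe p.1 p.2 * q p.1)| ≤ M * N := fun p => by
    rw [abs_mul]
    refine mul_le_mul (hM _) ?_ (abs_nonneg _) ((abs_nonneg _).trans (hM p.2))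
    rw [mul_comm]; exact (abs_mul_indLe_le _ _ _).trans (hN _)
  have hsw := integral_integral_swap (μ := μ) (ν := μ)
    (f := fun t y => r y * (indLe t y * q t)) (integrable_of_abs_le hm hb)
  calc ∫ t, upperInt μ r t * q t ∂μ = ∫ t, ∫ y, r y * (indLe t y * q t) ∂μ ∂μ := by
        refine integral_congr_ae (Eventually.of_forall fun t => ?_)
        simp only [upperInt]
        rw [← integral_mul_const]
        refine integral_congr_ae (Eventually.of_forall fun y => ?_)
        simp only; ring
    _ = ∫ y, ∫ t, r y * (indLe t y * q t) ∂μ ∂μ := hsw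
    _ = ∫ y, r y * ∫ t, indLe t y * q t ∂μ ∂μ := by
        simp_rw [integral_const_mul]

lemma integral_upperInt (hr : Measurable r) (hM : ∀ z, |r z| ≤ M) :
    ∫ t, upperInt μ r t ∂μ = ∫ y, r y * cdf μ y ∂μ := by
  have h := integral_upperInt_mul (μ := μ) hr hM (q := fun _ => 1) measurable_const (N := 1)
    (by simp)
  simpa [integral_indLe] using h

/-- The minimum appears because $1(t\le y)1(t\le z)=1(t\le y\wedge z)$, whose integral in $t$ is
$F(y\wedge z)$. This is how the double integral in $\Sigma_h$ becomes a second moment. -/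
lemma integral_upperInt_mul_upperInt (hr : Measurable r) (hM : ∀ z, |r z| ≤ M)
    (hq : Measurable q) (hN : ∀ z, |q z| ≤ N) :
    ∫ t, upperInt μ r t * upperInt μ q t ∂μ =
      ∫ y, r y * ∫ z, q z * cdf μ (min y z) ∂μ ∂μ := by
  have hiq : Integrable q μ := integrable_of_abs_le hq hN
  rw [integral_upperInt_mul hr hM (measurable_upperInt hq) (abs_upperInt_le hiq)]
  congr 1
  ext y
  congr 1
  have h := integral_upperInt_mul (μ := μ) hq hN (q := fun t => indLe t y) (N := 1)
    (measurable_indLe measurable_id measurable_const) (fun t => abs_indLe_le _ _)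
  simp_rw [indLe_mul_indLe, integral_indLe, min_comm _ y] at h
  rw [← h]
  simp_rw [mul_comm]

end UpperInt

/-! ### Uniform moment bounds, and $\Gamma_h$, $\Sigma_h$ as moments -/

section Population

variable {d : ℕ} {K : ℝ → ℝ} {R : ℝ → Fin d → ℝ} {x h : ℝ}

lemma weight_eq_zero (hK : IsKernel K) (h0 : 0 < h) {y : ℝ}
    (hy : y ∉ Set.Icc (x - h) (x + h)) : weight K x h y = 0 := by
  rw [weight, hK.eq_zero, mul_zero]
  rw [Set.mem_Icc, div_le_one h0, le_div_iff₀ h0]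
  rintro ⟨h1, h2⟩
  exact hy ⟨by linarith, by linarith⟩

lemma measurable_weight (hK : IsKernel K) : Measurable (weight K x h) :=
  (hK.measurable.comp ((measurable_id.sub_const x).div_const h)).const_mul _

lemma measurable_basis (hR : IsBasis R) (k : Fin d) : Measurable fun y => R ((y - x) / h) k :=
  (measurable_pi_apply k).comp (hR.measurable.comp ((measurable_id.sub_const x).div_const h))

lemma measurable_wbasis (hK : IsKernel K) (hR : IsBasis R) (k : Fin d) :
    Measurable fun y => wbasis K R x h y k :=
  (measurable_weight hK).mul (measurable_basis hR k)

lemma weight_add_mul (h0 : 0 < h) (u : ℝ) : weight K x h (x + h * u) = h⁻¹ * K u := by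
  rw [weight]; congr 2
  · simp
  · field_simp; ring

lemma add_mul_sub_div (h0 : 0 < h) (u : ℝ) : (x + h * u - x) / h = u := by
  field_simp; ring

/-- Bounds that hold uniformly in the bandwidth. -/
structure UniformBounds (μ : Measure ℝ) (K : ℝ → ℝ) (R : ℝ → Fin d → ℝ) (x h B : ℝ) : Prop where
  abs_weight_le : ∀ z, |weight K x h z| ≤ B / h
  abs_wbasis_le : ∀ z k, |wbasis K R x h z k| ≤ B / h
  integral_abs_wbasis_le : ∀ k, ∫ z, |wbasis K R x h z k| ∂μ ≤ B
  integral_wbasis_sq_le : ∀ k, ∫ z, wbasis K R x h z k ^ 2 ∂μ ≤ B / h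
  abs_gram_le : ∀ z k l, |wbasis K R x h z k * R ((z - x) / h) l| ≤ B / h
  integral_abs_gram_le : ∀ k l, ∫ z, |wbasis K R x h z k * R ((z - x) / h) l| ∂μ ≤ B
  integral_gram_sq_le : ∀ k l, ∫ z, (wbasis K R x h z k * R ((z - x) / h) l) ^ 2 ∂μ ≤ B / h

/-- A function of height $b/h$ living on a set of mass at most $Ch$ has bounded first absolute
moment, while its second moment is of order $1/h$. -/
lemma integral_le_of_support {μ : Measure ℝ} [IsProbabilityMeasure μ] {x h C : ℝ} (h0 : 0 < h)
    (hC : μ.real (Set.Icc (x - h) (x + h)) ≤ C * h) {g : ℝ → ℝ} {b : ℝ}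
    (hb0 : 0 ≤ b) (hb : ∀ z, |g z| ≤ b / h)
    (hs : ∀ z, z ∉ Set.Icc (x - h) (x + h) → g z = 0) :
    ∫ z, |g z| ∂μ ≤ b * C ∧ ∫ z, g z ^ 2 ∂μ ≤ b ^ 2 * C / h := by
  have key : ∀ (G : ℝ → ℝ) (c : ℝ), 0 ≤ c → (∀ z, |G z| ≤ c) →
      (∀ z, z ∉ Set.Icc (x - h) (x + h) → G z = 0) → ∫ z, G z ∂μ ≤ c * (C * h) := by
    intro G c hc hG hGs
    rw [← setIntegral_eq_integral_of_forall_compl_eq_zero hGs]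
    refine (le_abs_self _).trans ?_
    refine (norm_setIntegral_le_of_norm_le_const (f := G) (measure_lt_top _ _) fun z _ => hG z).trans ?_
    exact mul_le_mul_of_nonneg_left hC hc
  constructor
  · refine (key _ (b / h) (by positivity) (fun z => by rw [abs_abs]; exact hb z)
      fun z hz => by rw [hs z hz, abs_zero]).trans (le_of_eq ?_)
    field_simp
  · refine (key _ ((b / h) ^ 2) (by positivity) (fun z => by
      rw [abs_pow]; exact pow_le_pow_left₀ (abs_nonneg _) (hb z) 2)
      fun z hz => by rw [hs z hz]; ring).trans (le_of_eq ?_)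
    field_simp

lemma exists_uniformBounds {μ : Measure ℝ} [IsProbabilityMeasure μ] {δ C : ℝ} (hC0 : 0 < C)
    (hC : ∀ h, 0 < h → h < δ → μ.real (Set.Icc (x - h) (x + h)) ≤ C * h)
    (hK : IsKernel K) (hR : IsBasis R) :
    ∃ B, 1 ≤ B ∧ ∀ h, 0 < h → h < δ → UniformBounds μ K R x h B := by
  obtain ⟨k, hk0, hk⟩ := hK.exists_bound
  obtain ⟨b, hb0, hb⟩ := hR.exists_bound (-1) 1
  -- The factor $(1+b)^2$ dominates $1$, $b$ and $b^2$, so one constant serves the weight, the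
  -- weighted basis and the Gram entries.
  set m := k * (1 + b) ^ 2 with hm
  have hm0 : 0 < m := by positivity
  set B := 1 + m + m * C + m ^ 2 * C with hBdef
  have hmB : m ≤ B := by
    have : 0 ≤ m * C + m ^ 2 * C := by positivity
    linarith
  have hB1 : m * C ≤ B := by
    have : 0 ≤ m ^ 2 * C := by positivity
    linarith
  have hB2 : m ^ 2 * C ≤ B := by
    have : 0 ≤ m * C := by positivity
    linarith
  refine ⟨B, by have : 0 ≤ m * C + m ^ 2 * C := by positivity
                linarith, fun h h0 hh => ?_⟩
  have hw : ∀ z, |weight K x h z| ≤ k / h := fun z => by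
    rw [weight, abs_mul, abs_of_pos (by positivity : (0 : ℝ) < 1 / h), div_mul_eq_mul_div, one_mul]
    exact div_le_div_of_nonneg_right (hk _) h0.le
  have hRb : ∀ z ∈ Set.Icc (x - h) (x + h), ∀ j, |R ((z - x) / h) j| ≤ b := fun z hz j =>
    hb _ (by
      rw [Set.mem_Icc, div_le_one h0, le_div_iff₀ h0]
      exact ⟨by linarith [hz.1], by linarith [hz.2]⟩) j
  have hs1 : ∀ j z, z ∉ Set.Icc (x - h) (x + h) → wbasis K R x h z j = 0 := fun j z hz => by
    rw [wbasis, weight_eq_zero hK h0 hz, zero_mul]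
  have hs2 : ∀ j l z, z ∉ Set.Icc (x - h) (x + h) →
      wbasis K R x h z j * R ((z - x) / h) l = 0 := fun j l z hz => by
    rw [hs1 j z hz, zero_mul]
  have h1 : ∀ z, |weight K x h z| ≤ m / h := fun z =>
    (hw z).trans (div_le_div_of_nonneg_right
      (le_mul_of_one_le_right hk0.le (by nlinarith)) h0.le)
  have h2 : ∀ j z, |wbasis K R x h z j| ≤ m / h := fun j z => by
    by_cases hz : z ∈ Set.Icc (x - h) (x + h)
    · rw [wbasis, abs_mul]
      calc _ ≤ k / h * b := mul_le_mul (hw z) (hRb z hz j) (abs_nonneg _) (by positivity)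
        _ = k * b / h := by ring
        _ ≤ m / h := div_le_div_of_nonneg_right (by rw [hm]; nlinarith) h0.le
    · rw [hs1 j z hz, abs_zero]; positivity
  have h3 : ∀ j l z, |wbasis K R x h z j * R ((z - x) / h) l| ≤ m / h := fun j l z => by
    by_cases hz : z ∈ Set.Icc (x - h) (x + h)
    · rw [wbasis, abs_mul, abs_mul]
      calc _ ≤ k / h * b * b := mul_le_mul (mul_le_mul (hw z) (hRb z hz j) (abs_nonneg _)
              (by positivity)) (hRb z hz l) (abs_nonneg _) (by positivity)
        _ = k * b ^ 2 / h := by ring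
        _ ≤ m / h := div_le_div_of_nonneg_right (by rw [hm]; nlinarith) h0.le
    · rw [hs2 j l z hz, abs_zero]; positivity
  have hmBh : m / h ≤ B / h := div_le_div_of_nonneg_right hmB h0.le
  have hB2h : m ^ 2 * C / h ≤ B / h := div_le_div_of_nonneg_right hB2 h0.le
  have i2 := fun j => integral_le_of_support h0 (hC h h0 hh) hm0.le
    (h2 j) (hs1 j)
  have i3 := fun j l => integral_le_of_support h0 (hC h h0 hh) hm0.le (h3 j l) (hs2 j l)
  exact
  { abs_weight_le := fun z => (h1 z).trans hmBh
    abs_wbasis_le := fun z j => (h2 j z).trans hmBh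
    integral_abs_wbasis_le := fun j => (i2 j).1.trans hB1
    integral_wbasis_sq_le := fun j => (i2 j).2.trans hB2h
    abs_gram_le := fun z j l => (h3 j l z).trans hmBh
    integral_abs_gram_le := fun j l => (i3 j l).1.trans hB1
    integral_gram_sq_le := fun j l => (i3 j l).2.trans hB2h }

variable {μ : Measure ℝ} [IsProbabilityMeasure μ] {f : ℝ → ℝ} {δ B : ℝ}

lemma Gam_eq (hδ : 0 < δ) (hf : HasDensityOn (cdf μ) f x δ) (hK : IsKernel K) (hR : IsBasis R)
    (h0 : 0 < h) (hh : h < δ) (hB : UniformBounds μ K R x h B) (k l : Fin d) :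
    Gam μ f K R x h k l = ∫ z, wbasis K R x h z k * R ((z - x) / h) l ∂μ := by
  rw [hf.integral_eq (G := fun z => wbasis K R x h z k * R ((z - x) / h) l) hδ h0 hh
    ((measurable_wbasis hK hR k).mul (measurable_basis hR l))
    (fun z => hB.abs_gram_le z k l)
    (fun z hz => by simp [wbasis, weight_eq_zero hK h0 hz]), ← integral_const_mul]
  simp only [Gam, of_apply, wbasis, weight_add_mul h0, add_mul_sub_div h0]
  congr 1
  ext u
  field_simp

/-- The bracket $F(y\wedge z)-F(y)F(z)$ is the covariance of $1(x_1\le y)$ and $1(x_1\le z)$;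
integrating it against $r_k(y)r_l(z)$ gives the covariance of the upper integrals. Two changes of
variables identify the integral over `u` and `v` with this one. -/
lemma Sig_eq (hδ : 0 < δ) (hf : HasDensityOn (cdf μ) f x δ) (hK : IsKernel K) (hR : IsBasis R)
    (h0 : 0 < h) (hh : h < δ) (hB : UniformBounds μ K R x h B) (k l : Fin d) :
    Sig μ f K R x h k l =
      ∫ t, upperInt μ (fun z => wbasis K R x h z k) t *
        upperInt μ (fun z => wbasis K R x h z l) t ∂μ -
      (∫ t, upperInt μ (fun z => wbasis K R x h z k) t ∂μ) *
        ∫ t, upperInt μ (fun z => wbasis K R x h z l) t ∂μ := by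
  have hm := fun j => measurable_wbasis (x := x) (h := h) hK hR j
  have hb := fun j z => hB.abs_wbasis_le z j
  have hF : Measurable (cdf μ) := (monotone_cdf μ).measurable
  have hF1 : ∀ y, |cdf μ y| ≤ 1 := fun y => by
    rw [abs_of_nonneg (cdf_nonneg μ y)]; exact cdf_le_one μ y
  have hBh : 0 ≤ B / h := (abs_nonneg _).trans (hB.abs_weight_le x)
  rw [integral_upperInt_mul_upperInt (hm k) (hb k) (hm l) (hb l), integral_upperInt (hm k) (hb k),
    integral_upperInt (hm l) (hb l)]
  have hcov : ∀ y z, |cdf μ (min y z) - cdf μ y * cdf μ z| ≤ 1 := fun y z => by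
    have h1 := cdf_nonneg μ (min y z)
    have h2 := cdf_le_one μ (min y z)
    have h3 : 0 ≤ cdf μ y * cdf μ z := mul_nonneg (cdf_nonneg μ y) (cdf_nonneg μ z)
    have h4 : cdf μ y * cdf μ z ≤ 1 := mul_le_one₀ (cdf_le_one μ y) (cdf_nonneg μ z)
      (cdf_le_one μ z)
    rw [abs_le]; constructor <;> linarith
  have hcovm : Measurable fun p : ℝ × ℝ =>
      wbasis K R x h p.2 l * (cdf μ (min p.1 p.2) - cdf μ p.1 * cdf μ p.2) :=
    ((hm l).comp measurable_snd).mul ((hF.comp (measurable_fst.min measurable_snd)).sub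
      ((hF.comp measurable_fst).mul (hF.comp measurable_snd)))
  have hcovb : ∀ y z, |wbasis K R x h z l * (cdf μ (min y z) - cdf μ y * cdf μ z)| ≤ B / h :=
    fun y z => by
      rw [abs_mul]
      exact (mul_le_of_le_one_right (abs_nonneg _) (hcov y z)).trans (hb l z)
  set I : ℝ → ℝ := fun y =>
    ∫ z, wbasis K R x h z l * (cdf μ (min y z) - cdf μ y * cdf μ z) ∂μ with hI
  have hIm : Measurable I := (hcovm.stronglyMeasurable.integral_prod_right (ν := μ)).measurable
  have hIb : ∀ y, |I y| ≤ B / h := fun y => by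
    have := norm_integral_le_of_norm_le_const (μ := μ)
      (f := fun z => wbasis K R x h z l * (cdf μ (min y z) - cdf μ y * cdf μ z))
      (Eventually.of_forall (hcovb y))
    simpa using this
  have hmain : Sig μ f K R x h k l = ∫ y, wbasis K R x h y k * I y ∂μ := by
    rw [hf.integral_eq (G := fun y => wbasis K R x h y k * I y) hδ h0 hh ((hm k).mul hIm)
      (B := B / h * (B / h))
      (fun y => by
        rw [abs_mul]; exact mul_le_mul (hb k y) (hIb y) (abs_nonneg _) hBh)
      (fun z hz => by simp [wbasis, weight_eq_zero hK h0 hz]), ← integral_const_mul]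
    simp only [Sig, of_apply]
    congr 1
    ext u
    rw [hI]
    simp only
    rw [hf.integral_eq (G := fun z => wbasis K R x h z l *
      (cdf μ (min (x + h * u) z) - cdf μ (x + h * u) * cdf μ z)) hδ h0 hh (hcovm.comp (measurable_const.prodMk measurable_id))
      (hcovb (x + h * u)) (fun z hz => by simp [wbasis, weight_eq_zero hK h0 hz]),
      ← integral_const_mul, ← integral_const_mul, ← integral_mul_const, ← integral_const_mul]
    congr 1
    ext v
    simp only [wbasis, weight_add_mul h0, add_mul_sub_div h0]
    have hmin : min (x + h * u) (x + h * v) = x + h * min u v := by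
      rw [min_add_add_left, mul_min_of_nonneg _ _ h0.le]
    rw [hmin]
    field_simp
  rw [hmain]
  have i1 : ∀ y, Integrable (fun z => wbasis K R x h z l * cdf μ (min y z)) μ := fun y =>
    integrable_of_abs_le ((hm l).mul (hF.comp (measurable_const.min measurable_id)))
      (M := B / h) fun z => by
        rw [abs_mul]
        exact (mul_le_of_le_one_right (abs_nonneg _) (hF1 _)).trans (hb l z)
  have i2 : ∀ j, Integrable (fun z => wbasis K R x h z j * cdf μ z) μ := fun j =>
    integrable_of_abs_le ((hm j).mul hF) (M := B / h) fun z => by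
      rw [abs_mul]
      exact (mul_le_of_le_one_right (abs_nonneg _) (hF1 _)).trans (hb j z)
  have hsplit : ∀ y, ∫ z, wbasis K R x h z l * cdf μ (min y z) ∂μ =
      I y + cdf μ y * ∫ z, wbasis K R x h z l * cdf μ z ∂μ := fun y => by
    rw [hI, ← integral_const_mul]
    simp only
    rw [← integral_add]
    · congr 1; ext z; ring
    · exact integrable_of_abs_le (hcovm.comp (measurable_const.prodMk measurable_id)) (hcovb y)
    · exact (i2 l).const_mul _
  simp_rw [hsplit, mul_add]
  rw [integral_add, ← integral_mul_const]
  · simp_rw [← mul_assoc]; ring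
  · exact integrable_of_abs_le ((hm k).mul hIm) (M := B / h * (B / h)) fun y => by
      rw [abs_mul]; exact mul_le_mul (hb k y) (hIb y) (abs_nonneg _) hBh
  · simp_rw [← mul_assoc]
    exact (i2 k).mul_const _

end Population

/-! ### Coercive matrices -/

section Coercive

variable {d : ℕ}

/-- The quadratic form of `A` is bounded below by `lam`. -/
def Coercive (A : Matrix (Fin d) (Fin d) ℝ) (lam : ℝ) : Prop :=
  ∀ w : Fin d → ℝ, lam * (w ⬝ᵥ w) ≤ w ⬝ᵥ (A *ᵥ w)

/-- The sum of the absolute values of the entries of a matrix. -/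
def entrySum (A : Matrix (Fin d) (Fin d) ℝ) : ℝ := ∑ k, ∑ l, |A k l|

lemma entrySum_nonneg (A : Matrix (Fin d) (Fin d) ℝ) : 0 ≤ entrySum A :=
  Finset.sum_nonneg fun _ _ => Finset.sum_nonneg fun _ _ => abs_nonneg _

lemma abs_dotProduct_le (a b : Fin d → ℝ) : |a ⬝ᵥ b| ≤ d * ‖a‖ * ‖b‖ := by
  calc |a ⬝ᵥ b| ≤ ∑ k, |a k * b k| := Finset.abs_sum_le_sum_abs _ _
    _ ≤ ∑ _k : Fin d, ‖a‖ * ‖b‖ := by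
        refine Finset.sum_le_sum fun k _ => ?_
        rw [abs_mul]
        exact mul_le_mul (norm_le_pi_norm a k) (norm_le_pi_norm b k) (abs_nonneg _) (norm_nonneg _)
    _ = d * ‖a‖ * ‖b‖ := by simp [mul_assoc]

lemma norm_sq_le_dotProduct (w : Fin d → ℝ) : ‖w‖ ^ 2 ≤ w ⬝ᵥ w := by
  have h0 : 0 ≤ w ⬝ᵥ w := Finset.sum_nonneg fun k _ => mul_self_nonneg _
  have h : ‖w‖ ≤ √(w ⬝ᵥ w) := by
    refine (pi_norm_le_iff_of_nonneg (Real.sqrt_nonneg _)).2 fun k => ?_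
    refine Real.le_sqrt_of_sq_le ?_
    rw [Real.norm_eq_abs, sq_abs, sq]
    exact Finset.single_le_sum (f := fun k => w k * w k) (fun k _ => mul_self_nonneg _)
      (Finset.mem_univ k)
  calc ‖w‖ ^ 2 ≤ √(w ⬝ᵥ w) ^ 2 := pow_le_pow_left₀ (norm_nonneg _) h 2
    _ = w ⬝ᵥ w := Real.sq_sqrt h0

lemma norm_mulVec_le (A : Matrix (Fin d) (Fin d) ℝ) (v : Fin d → ℝ) :
    ‖A *ᵥ v‖ ≤ entrySum A * ‖v‖ := by
  refine (pi_norm_le_iff_of_nonneg (mul_nonneg (entrySum_nonneg A) (norm_nonneg _))).2 fun k => ?_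
  calc ‖(A *ᵥ v) k‖ ≤ ∑ l, |A k l * v l| :=
        Finset.abs_sum_le_sum_abs (fun l => A k l * v l) Finset.univ
    _ ≤ ∑ l, |A k l| * ‖v‖ := by
        refine Finset.sum_le_sum fun l _ => ?_
        rw [abs_mul]
        exact mul_le_mul_of_nonneg_left (norm_le_pi_norm v l) (abs_nonneg _)
    _ = (∑ l, |A k l|) * ‖v‖ := by rw [Finset.sum_mul]
    _ ≤ entrySum A * ‖v‖ := by
        refine mul_le_mul_of_nonneg_right ?_ (norm_nonneg _)
        exact Finset.single_le_sum (f := fun k => ∑ l, |A k l|)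
          (fun k _ => Finset.sum_nonneg fun _ _ => abs_nonneg _) (Finset.mem_univ k)

lemma abs_quadratic_le (A : Matrix (Fin d) (Fin d) ℝ) (w : Fin d → ℝ) :
    |w ⬝ᵥ (A *ᵥ w)| ≤ entrySum A * (w ⬝ᵥ w) := by
  calc |w ⬝ᵥ (A *ᵥ w)| = |∑ k, ∑ l, w k * (A k l * w l)| := by
        simp only [dotProduct, mulVec, Finset.mul_sum]
    _ ≤ ∑ k, ∑ l, |w k * (A k l * w l)| :=
        (Finset.abs_sum_le_sum_abs _ _).trans
          (Finset.sum_le_sum fun k _ => Finset.abs_sum_le_sum_abs _ _)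
    _ ≤ ∑ k, ∑ l, |A k l| * ‖w‖ ^ 2 := by
        refine Finset.sum_le_sum fun k _ => Finset.sum_le_sum fun l _ => ?_
        rw [abs_mul, abs_mul]
        have h1 := mul_le_mul (norm_le_pi_norm w k) (norm_le_pi_norm w l) (norm_nonneg _)
          (norm_nonneg _)
        rw [Real.norm_eq_abs, Real.norm_eq_abs] at h1
        nlinarith [abs_nonneg (A k l)]
    _ = entrySum A * ‖w‖ ^ 2 := by simp only [entrySum, Finset.sum_mul]
    _ ≤ entrySum A * (w ⬝ᵥ w) :=
        mul_le_mul_of_nonneg_left (norm_sq_le_dotProduct w) (entrySum_nonneg A)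

open scoped Pointwise in
-- Subtracting `lam` shifts the spectrum into the nonnegative half-line; symmetry is what turns this
-- into positive semidefiniteness.
lemma coercive_of_spectrum {A : Matrix (Fin d) (Fin d) ℝ} (hA : Aᵀ = A) {lam : ℝ}
    (h : ∀ t ∈ spectrum ℝ A, lam ≤ t) : Coercive A lam := by
  set B := A - algebraMap ℝ (Matrix (Fin d) (Fin d) ℝ) lam with hB
  have hAh : A.IsHermitian := by rw [IsHermitian, conjTranspose_eq_transpose_of_trivial, hA]
  have hBh : B.IsHermitian := by
    refine hAh.sub ?_
    rw [IsHermitian, conjTranspose_eq_transpose_of_trivial, algebraMap_eq_diagonal,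
      diagonal_transpose]
  have hpos : B.PosSemidef := by
    rw [hBh.posSemidef_iff_eigenvalues_nonneg]
    intro i
    have h1 := hBh.eigenvalues_mem_spectrum_real i
    have h3 : spectrum ℝ B = spectrum ℝ A - {lam} := (spectrum.sub_singleton_eq A lam).symm
    rw [h3] at h1
    obtain ⟨t, ht, s, hs, hts⟩ := h1
    rw [Set.mem_singleton_iff] at hs
    have h2 := h t ht
    simp only [hs] at hts
    rw [Pi.zero_apply, ← hts]
    linarith
  intro w
  have h1 := hpos.dotProduct_mulVec_nonneg w
  rw [hB, sub_mulVec, dotProduct_sub, Algebra.algebraMap_eq_smul_one, smul_mulVec, one_mulVec,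
    dotProduct_smul] at h1
  simpa using h1

variable {A B : Matrix (Fin d) (Fin d) ℝ} {lam : ℝ}

/-- From $\lambda\|v\|^2\le v'Av\le d\,\|v\|\,\|Av\|$; the dimension enters because the norm is the
maximum norm. -/
lemma Coercive.norm_le (hA : Coercive A lam) (hlam : 0 < lam) (v : Fin d → ℝ) :
    ‖v‖ ≤ d / lam * ‖A *ᵥ v‖ := by
  rcases (norm_nonneg v).eq_or_lt with h0 | h0
  · rw [← h0]; positivity
  have h1 := mul_le_mul_of_nonneg_left (norm_sq_le_dotProduct v) hlam.le
  have h2 := (h1.trans (hA v)).trans ((le_abs_self _).trans (abs_dotProduct_le _ _))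
  rw [div_mul_eq_mul_div, le_div_iff₀ hlam]
  have h3 : ‖v‖ * (lam * ‖v‖) ≤ ‖v‖ * (d * ‖A *ᵥ v‖) := by linarith
  linarith [le_of_mul_le_mul_left h3 h0]

lemma Coercive.isUnit_det (hA : Coercive A lam) (hlam : 0 < lam) : IsUnit A.det := by
  rw [← isUnit_iff_isUnit_det, ← mulVec_injective_iff_isUnit]
  intro v w hvw
  have h := hA.norm_le hlam (v - w)
  rw [mulVec_sub, sub_eq_zero.2 hvw, norm_zero, mul_zero] at h
  exact sub_eq_zero.1 (norm_le_zero_iff.1 h)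

lemma Coercive.mulVec_inv (hA : Coercive A lam) (hlam : 0 < lam) (c : Fin d → ℝ) :
    A *ᵥ (A⁻¹ *ᵥ c) = c := by
  rw [mulVec_mulVec, mul_nonsing_inv _ (hA.isUnit_det hlam), one_mulVec]

/-- A perturbation of size $\lambda/2$ uses up at most half of the coercivity. This makes
$\hat\Gamma_h$ invertible, with controlled inverse, once it is close to $\Gamma_h$. -/
lemma Coercive.of_entrySum_sub_le (hA : Coercive A lam) (h : entrySum (B - A) ≤ lam / 2) :
    Coercive B (lam / 2) := by
  intro w
  have h0 : 0 ≤ w ⬝ᵥ w := Finset.sum_nonneg fun k _ => mul_self_nonneg _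
  have h1 := neg_le_of_abs_le (abs_quadratic_le (B - A) w)
  have h2 := mul_le_mul_of_nonneg_right h h0
  rw [sub_mulVec, dotProduct_sub] at h1
  linarith [hA w]

/-- Follows from $B(B^{-1}c-A^{-1}c)=-(B-A)A^{-1}c$ and the coercivity of $B$. -/
lemma Coercive.norm_inv_sub_le (hA : Coercive A lam) (hB : Coercive B (lam / 2)) (hlam : 0 < lam)
    (c : Fin d → ℝ) :
    ‖B⁻¹ *ᵥ c - A⁻¹ *ᵥ c‖ ≤ 2 * d / lam * entrySum (B - A) * ‖A⁻¹ *ᵥ c‖ := by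
  have h1 := hB.norm_le (half_pos hlam) (B⁻¹ *ᵥ c - A⁻¹ *ᵥ c)
  have h2 : B *ᵥ (B⁻¹ *ᵥ c - A⁻¹ *ᵥ c) = -((B - A) *ᵥ (A⁻¹ *ᵥ c)) := by
    rw [mulVec_sub, hB.mulVec_inv (half_pos hlam), sub_mulVec, hA.mulVec_inv hlam]
    abel
  rw [h2, norm_neg] at h1
  refine h1.trans ?_
  have h3 := mul_le_mul_of_nonneg_left (norm_mulVec_le (B - A) (A⁻¹ *ᵥ c))
    (by positivity : 0 ≤ d / (lam / 2))
  refine h3.trans (le_of_eq ?_)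
  field_simp

lemma sandwich_eq {G : Matrix (Fin d) (Fin d) ℝ} (hG : Gᵀ = G) (S : Matrix (Fin d) (Fin d) ℝ)
    (c : Fin d → ℝ) : sandwich G S c = (G⁻¹ *ᵥ c) ⬝ᵥ (S *ᵥ (G⁻¹ *ᵥ c)) := by
  have hi : (G⁻¹)ᵀ = G⁻¹ := by rw [transpose_nonsing_inv, hG]
  rw [sandwich, ← mulVec_mulVec, ← mulVec_mulVec, dotProduct_mulVec, ← mulVec_transpose, hi]

lemma sandwich_smul (G S : Matrix (Fin d) (Fin d) ℝ) (a : ℝ) (c : Fin d → ℝ) :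
    sandwich G S (a • c) = a ^ 2 * sandwich G S c := by
  simp only [sandwich, mulVec_smul, dotProduct_smul, smul_dotProduct, smul_eq_mul]
  ring

end Coercive

/-! ### Sample quantities -/

/-- The sample variance of `a 0, …, a (n - 1)`. -/
def sampleVar (n : ℕ) (a : ℕ → ℝ) : ℝ :=
  1 / (n : ℝ) * ∑ i ∈ Finset.range n, (a i - 1 / (n : ℝ) * ∑ j ∈ Finset.range n, a j) ^ 2

lemma sampleVar_nonneg (n : ℕ) (a : ℕ → ℝ) : 0 ≤ sampleVar n a :=
  mul_nonneg (by positivity) (Finset.sum_nonneg fun _ _ => sq_nonneg _)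

lemma sampleVar_eq {n : ℕ} (hn : 0 < n) (a : ℕ → ℝ) (m : ℝ) :
    sampleVar n a = 1 / (n : ℝ) * ∑ i ∈ Finset.range n, (a i - m) ^ 2 -
      (1 / (n : ℝ) * ∑ i ∈ Finset.range n, (a i - m)) ^ 2 := by
  have hn' : (n : ℝ) ≠ 0 := by positivity
  have h : ∀ i, (a i - 1 / (n : ℝ) * ∑ j ∈ Finset.range n, a j) ^ 2 =
      (a i - m) ^ 2 - 2 * (1 / (n : ℝ) * ∑ j ∈ Finset.range n, (a j - m)) * (a i - m) +
        (1 / (n : ℝ) * ∑ j ∈ Finset.range n, (a j - m)) ^ 2 := fun i => by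
    rw [Finset.sum_sub_distrib]
    simp only [Finset.sum_const, Finset.card_range, nsmul_eq_mul]
    field_simp
    ring
  rw [sampleVar]
  simp_rw [h]
  rw [Finset.sum_add_distrib, Finset.sum_sub_distrib, ← Finset.mul_sum]
  simp only [Finset.sum_const, Finset.card_range, nsmul_eq_mul]
  field_simp
  ring

/-- With $u$ the centered $b$ and $w$ the centered $a-b$, the difference is
$\overline{w^2}+2\,\overline{uw}$. Cauchy–Schwarz bounds the cross term, whose order $\sqrt e$ is
what determines the final rate. -/
lemma abs_sampleVar_sub_le {n : ℕ} (hn : 0 < n) (a b : ℕ → ℝ) {e : ℝ}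
    (he : 1 / (n : ℝ) * ∑ i ∈ Finset.range n, (a i - b i) ^ 2 ≤ e) :
    |sampleVar n a - sampleVar n b| ≤ e + 2 * (√(sampleVar n b) * √e) := by
  have hn' : (0 : ℝ) < n := by positivity
  set A := 1 / (n : ℝ) * ∑ j ∈ Finset.range n, a j with hA
  set D := 1 / (n : ℝ) * ∑ j ∈ Finset.range n, b j with hD
  set u : ℕ → ℝ := fun i => b i - D with hu
  set w : ℕ → ℝ := fun i => (a i - b i) - (A - D) with hw
  have hw1 : 1 / (n : ℝ) * ∑ i ∈ Finset.range n, w i ^ 2 ≤ e := by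
    have h1 := sampleVar_eq hn (fun i => a i - b i) 0
    -- The mean of $w^2$ is a sample variance, hence no larger than the raw second moment of $a-b$.
    have h2 : sampleVar n (fun i => a i - b i) =
        1 / (n : ℝ) * ∑ i ∈ Finset.range n, w i ^ 2 := by
      rw [sampleVar, Finset.sum_sub_distrib, mul_sub]
    rw [← h2, h1]
    simp only [sub_zero]
    linarith [sq_nonneg (1 / (n : ℝ) * ∑ i ∈ Finset.range n, (a i - b i))]
  have hexp : sampleVar n a - sampleVar n b = 1 / (n : ℝ) * ∑ i ∈ Finset.range n, w i ^ 2 +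
      2 * (1 / (n : ℝ) * ∑ i ∈ Finset.range n, u i * w i) := by
    rw [sampleVar, sampleVar, ← hA, ← hD]
    rw [mul_left_comm 2, ← mul_add, ← mul_sub, Finset.mul_sum _ _ (2 : ℝ), ← Finset.sum_sub_distrib, ← Finset.sum_add_distrib]
    congr 1
    refine Finset.sum_congr rfl fun i _ => ?_
    simp only [hu, hw]
    ring
  have hcs : |1 / (n : ℝ) * ∑ i ∈ Finset.range n, u i * w i| ≤ √(sampleVar n b) * √e := by
    rw [← Real.sqrt_mul (sampleVar_nonneg n b), ← Real.sqrt_sq_eq_abs]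
    refine Real.sqrt_le_sqrt ?_
    have h1 := Finset.sum_mul_sq_le_sq_mul_sq (Finset.range n) u w
    calc (1 / (n : ℝ) * ∑ i ∈ Finset.range n, u i * w i) ^ 2
        = (1 / (n : ℝ)) ^ 2 * (∑ i ∈ Finset.range n, u i * w i) ^ 2 := by ring
      _ ≤ (1 / (n : ℝ)) ^ 2 *
          ((∑ i ∈ Finset.range n, u i ^ 2) * ∑ i ∈ Finset.range n, w i ^ 2) :=
          mul_le_mul_of_nonneg_left h1 (by positivity)
      _ = (1 / (n : ℝ) * ∑ i ∈ Finset.range n, u i ^ 2) *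
          (1 / (n : ℝ) * ∑ i ∈ Finset.range n, w i ^ 2) := by ring
      _ ≤ sampleVar n b * e := mul_le_mul_of_nonneg_left hw1 (sampleVar_nonneg n b)
  have hw0 : 0 ≤ 1 / (n : ℝ) * ∑ i ∈ Finset.range n, w i ^ 2 :=
    mul_nonneg (by positivity) (Finset.sum_nonneg fun _ _ => sq_nonneg _)
  rw [hexp]
  refine (abs_add_le _ _).trans ?_
  rw [abs_of_nonneg hw0, abs_mul, abs_two]
  linarith

/-- `n⁻¹ ∑_j r(z_j) 𝟙(z_i ≤ z_j)`. -/
def upperHat (n : ℕ) (z : ℕ → ℝ) (r : ℝ → ℝ) (i : ℕ) : ℝ :=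
  1 / (n : ℝ) * ∑ j ∈ Finset.range n, r (z j) * indLe (z i) (z j)

section Sample

variable {d : ℕ} {K : ℝ → ℝ} {R : ℝ → Fin d → ℝ} {υ : ℝ → Fin d → ℝ} {x h : ℝ}

lemma IsScaling.mul_eq (hυ : IsScaling R υ) (h0 : 0 < h) (u : ℝ) (k : Fin d) :
    υ h k * R u k = R (u / h) k := by
  rw [← (hυ h h0).2 u, mulVec_diagonal]

lemma IsScaling.pos (hυ : IsScaling R υ) (h0 : 0 < h) (k : Fin d) : 0 < υ h k :=
  posDef_diagonal_iff.1 (hυ h h0).1 k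

lemma GamHat_apply (hυ : IsScaling R υ) (h0 : 0 < h) (n : ℕ) (z : ℕ → ℝ) (k l : Fin d) :
    GamHat K R υ x h n z k l =
      1 / (n : ℝ) * ∑ i ∈ Finset.range n, wbasis K R x h (z i) k * R ((z i - x) / h) l := by
  simp only [GamHat, Matrix.smul_apply, Matrix.sum_apply, smul_eq_mul, mul_diagonal, diagonal_mul,
    vecMulVec_apply, wbasis]
  congr 1
  refine Finset.sum_congr rfl fun i _ => ?_
  rw [← hυ.mul_eq h0 _ k, ← hυ.mul_eq h0 _ l]
  ring

lemma GamHat_transpose (hυ : IsScaling R υ) (h0 : 0 < h) (n : ℕ) (z : ℕ → ℝ) :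
    (GamHat K R υ x h n z)ᵀ = GamHat K R υ x h n z := by
  ext k l
  rw [transpose_apply, GamHat_apply hυ h0, GamHat_apply hυ h0]
  simp only [wbasis]
  congr 1
  refine Finset.sum_congr rfl fun i _ => ?_
  ring

/-- Averaging $n^{-1}\sum_jr(z_j)1(z_i\le z_j)$ over $i$ gives $n^{-1}\sum_jr(z_j)\hat F(z_j)$, so
subtracting $\hat F$ is exactly centering at the sample mean. -/
lemma influenceHat_apply (hυ : IsScaling R υ) (h0 : 0 < h) (n : ℕ) (z : ℕ → ℝ) (i : ℕ)
    (k : Fin d) :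
    influenceHat K R υ x h n z i k = upperHat n z (fun y => wbasis K R x h y k) i -
      1 / (n : ℝ) * ∑ j ∈ Finset.range n, upperHat n z (fun y => wbasis K R x h y k) j := by
  simp only [influenceHat, Pi.smul_apply, Finset.sum_apply, smul_eq_mul, mulVec_diagonal,
    hυ.mul_eq h0, upperHat, ecdf, wbasis]
  rw [← mul_sub]
  congr 1
  rw [← Finset.mul_sum, Finset.sum_comm, Finset.mul_sum, ← Finset.sum_sub_distrib]
  refine Finset.sum_congr rfl fun j _ => ?_
  rw [← Finset.mul_sum]
  ring

lemma quadratic_SigHat (hυ : IsScaling R υ) (h0 : 0 < h) (n : ℕ) (z : ℕ → ℝ) (w : Fin d → ℝ) :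
    w ⬝ᵥ (SigHat K R υ x h n z *ᵥ w) =
      sampleVar n fun i => ∑ k, w k * upperHat n z (fun y => wbasis K R x h y k) i := by
  have h1 : w ⬝ᵥ (SigHat K R υ x h n z *ᵥ w) =
      1 / (n : ℝ) * ∑ i ∈ Finset.range n, (∑ k, w k * influenceHat K R υ x h n z i k) ^ 2 := by
    rw [SigHat, smul_mulVec, dotProduct_smul, smul_eq_mul, sum_mulVec, dotProduct_sum]
    congr 1
    refine Finset.sum_congr rfl fun i _ => ?_
    rw [vecMulVec_mulVec, dotProduct_smul]
    simp only [MulOpposite.smul_eq_mul_unop, MulOpposite.unop_op]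
    rw [dotProduct_comm _ w, sq]
    rfl
  rw [h1, sampleVar]
  congr 1
  refine Finset.sum_congr rfl fun i _ => ?_
  congr 1
  rw [Finset.sum_comm, Finset.mul_sum, ← Finset.sum_sub_distrib]
  refine Finset.sum_congr rfl fun k _ => ?_
  rw [influenceHat_apply hυ h0, mul_sub, ← Finset.mul_sum]
  ring

lemma eq_zero_of_quadratic_nonneg {p q : ℝ} (h : ∀ t : ℝ, 0 ≤ t ^ 2 * q - 2 * t * p) : p = 0 := by
  have hq : 0 ≤ q := by linarith [h 1, h (-1)]
  -- The natural choice would be $p/q$; the added one keeps the denominator positive when $q=0$.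
  have h1 := h (p / (q + 1))
  have h2 : (p / (q + 1)) ^ 2 * q - 2 * (p / (q + 1)) * p =
      -(p ^ 2 * (q + 2) / (q + 1) ^ 2) := by field_simp; ring
  rw [h2] at h1
  have h3 : p ^ 2 * (q + 2) / (q + 1) ^ 2 ≤ 0 := by linarith
  by_contra hp
  have : 0 < p ^ 2 * (q + 2) / (q + 1) ^ 2 := by positivity
  linarith

/-- The criterion is quadratic along each coordinate direction, so the first order condition can be
read off without differentiating. -/
lemma normal_equation {n : ℕ} {z : ℕ → ℝ} {ϑ : Fin d → ℝ}
    (hmin : IsMinOn (objective K R x h n z) Set.univ ϑ) (k : Fin d) :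
    ∑ i ∈ Finset.range n,
      (ecdf n z (z i) - R (z i - x) ⬝ᵥ ϑ) * R (z i - x) k * weight K x h (z i) = 0 := by
  refine eq_zero_of_quadratic_nonneg
    (q := ∑ i ∈ Finset.range n, R (z i - x) k ^ 2 * weight K x h (z i)) fun t => ?_
  have h1 : objective K R x h n z ϑ ≤ objective K R x h n z (ϑ + t • Pi.single k 1) :=
    hmin (Set.mem_univ _)
  simp only [objective] at h1
  rw [← sub_nonneg, ← Finset.sum_sub_distrib] at h1
  refine h1.trans (le_of_eq ?_)
  rw [Finset.mul_sum, Finset.mul_sum, ← Finset.sum_sub_distrib]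
  refine Finset.sum_congr rfl fun i _ => ?_
  rw [dotProduct_add, dotProduct_smul, dotProduct_single]
  simp only [smul_eq_mul, mul_one]
  ring

/-- The score `n⁻¹ ∑_j r(z_j) (F̂(z_j) - R(z_j - x)' θ)` of the local regression at `θ`. -/
def score (K : ℝ → ℝ) (R : ℝ → Fin d → ℝ) (x h : ℝ) (n : ℕ) (z : ℕ → ℝ) (θ : Fin d → ℝ)
    (k : Fin d) : ℝ :=
  1 / (n : ℝ) * ∑ j ∈ Finset.range n,
    wbasis K R x h (z j) k * (ecdf n z (z j) - R (z j - x) ⬝ᵥ θ)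

/-- In the rescaled coordinates $(\vartheta_k-\theta_k)/\upsilon_k$ the regression function is
$R((y-\mathsf x)/h)'$ times the coefficient vector, so the normal equations involve $\hat\Gamma_h$
directly. Invertibility is not needed at this stage. -/
lemma GamHat_mulVec_eq_score (hυ : IsScaling R υ) (h0 : 0 < h) {n : ℕ} {z : ℕ → ℝ}
    {ϑ : Fin d → ℝ} (hmin : IsMinOn (objective K R x h n z) Set.univ ϑ) (θ : Fin d → ℝ) :
    (GamHat K R υ x h n z *ᵥ fun k => (ϑ k - θ k) / υ h k) = score K R x h n z θ := by
  ext k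
  have h1 := normal_equation hmin k
  have hdot : ∀ y, ∑ l, R ((y - x) / h) l * ((ϑ l - θ l) / υ h l) =
      R (y - x) ⬝ᵥ ϑ - R (y - x) ⬝ᵥ θ := fun y => by
    rw [← dotProduct_sub, dotProduct]
    refine Finset.sum_congr rfl fun l _ => ?_
    rw [← hυ.mul_eq h0, Pi.sub_apply]
    have := (hυ.pos h0 l).ne'
    field_simp
  have h2 : (GamHat K R υ x h n z *ᵥ fun k => (ϑ k - θ k) / υ h k) k =
      1 / (n : ℝ) * ∑ i ∈ Finset.range n, wbasis K R x h (z i) k *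
        (R (z i - x) ⬝ᵥ ϑ - R (z i - x) ⬝ᵥ θ) := by
    simp only [mulVec, dotProduct, GamHat_apply hυ h0]
    simp only [mul_assoc, Finset.sum_mul]
    rw [← Finset.mul_sum, Finset.sum_comm]
    congr 1
    refine Finset.sum_congr rfl fun i _ => ?_
    rw [← Finset.mul_sum, hdot]
    rfl
  rw [h2, score]
  congr 1
  rw [← sub_eq_zero, ← Finset.sum_sub_distrib]
  have h3 := congrArg (fun t => -(υ h k * t)) h1
  simp only [mul_zero, neg_zero, Finset.mul_sum, ← Finset.sum_neg_distrib] at h3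
  rw [← h3]
  refine Finset.sum_congr rfl fun i _ => ?_
  rw [wbasis, ← hυ.mul_eq h0]
  ring

lemma dotProduct_sub_eq (hυ : IsScaling R υ) (h0 : 0 < h) {n : ℕ} {z : ℕ → ℝ}
    {ϑ : Fin d → ℝ} (hmin : IsMinOn (objective K R x h n z) Set.univ ϑ) (θ c : Fin d → ℝ)
    (hdet : IsUnit (GamHat K R υ x h n z).det) :
    c ⬝ᵥ (ϑ - θ) =
      ((GamHat K R υ x h n z)⁻¹ *ᵥ (diagonal (υ h) *ᵥ c)) ⬝ᵥ score K R x h n z θ := by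
  have hi : ((GamHat K R υ x h n z)⁻¹)ᵀ = (GamHat K R υ x h n z)⁻¹ := by
    rw [transpose_nonsing_inv, GamHat_transpose hυ h0]
  have h1 : (GamHat K R υ x h n z)⁻¹ *ᵥ score K R x h n z θ =
      fun k => (ϑ k - θ k) / υ h k := by
    rw [← GamHat_mulVec_eq_score hυ h0 hmin, mulVec_mulVec, nonsing_inv_mul _ hdet, one_mulVec]
  rw [← hi, mulVec_transpose, ← dotProduct_mulVec, h1, dotProduct, dotProduct]
  refine Finset.sum_congr rfl fun k _ => ?_
  rw [mulVec_diagonal, Pi.sub_apply]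
  have := (hυ.pos h0 k).ne'
  field_simp

end Sample

/-! ### Second moments of sample averages and of degenerate double sums -/

lemma integral_sub_integral_sq {μ : Measure ℝ} [IsProbabilityMeasure μ] {g : ℝ → ℝ} (hg : Measurable g)
    {M : ℝ} (hM : ∀ y, |g y| ≤ M) :
    ∫ y, (g y - ∫ z, g z ∂μ) ^ 2 ∂μ = ∫ y, g y ^ 2 ∂μ - (∫ y, g y ∂μ) ^ 2 := by
  have hi := integrable_of_abs_le (ν := μ) hg hM
  have hi2 : Integrable (fun y => g y ^ 2) μ :=
    integrable_of_abs_le (hg.pow_const 2) (M := M ^ 2) fun y => by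
      rw [abs_pow]; exact pow_le_pow_left₀ (abs_nonneg _) (hM y) 2
  set m := ∫ y, g y ∂μ with hm
  have : ∀ y, (g y - m) ^ 2 = g y ^ 2 - 2 * m * g y + m ^ 2 := fun y => by ring
  simp_rw [this]
  have hi3 : Integrable (fun y => g y ^ 2 - 2 * m * g y) μ := hi2.sub (hi.const_mul _)
  rw [integral_add hi3 (integrable_const _), integral_sub hi2 (hi.const_mul _),
    integral_const_mul, ← hm]
  simp; ring

section Moments

variable {Ω : Type*} [MeasurableSpace Ω] {P : Measure Ω}

lemma integral_sum_sq {ι : Type*} (s : Finset ι) {Y : ι → Ω → ℝ}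
    (hint : ∀ a ∈ s, ∀ b ∈ s, Integrable (fun ω => Y a ω * Y b ω) P)
    (horth : ∀ a ∈ s, ∀ b ∈ s, a ≠ b → ∫ ω, Y a ω * Y b ω ∂P = 0) :
    ∫ ω, (∑ a ∈ s, Y a ω) ^ 2 ∂P = ∑ a ∈ s, ∫ ω, Y a ω ^ 2 ∂P := by
  classical
  simp_rw [sq, Finset.sum_mul_sum]
  rw [integral_finsetSum _ fun a ha => integrable_finsetSum _ fun b hb => hint a ha b hb]
  refine Finset.sum_congr rfl fun a ha => ?_
  rw [integral_finsetSum _ fun b hb => hint a ha b hb, Finset.sum_eq_single a]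
  · intro b hb hab
    exact horth a ha b hb hab.symm
  · exact fun h => absurd ha h

variable {μ : Measure ℝ} {X : ℕ → Ω → ℝ}

/-- The indices `i`, `k`, `l` may coincide; only `j` has to be separate. This covers every
coincidence pattern in the double sums below. -/
lemma indepFun_triple (hX : ∀ i, Measurable (X i)) (hindep : iIndepFun X P) {i j k l : ℕ}
    (hi : j ≠ i) (hk : j ≠ k) (hl : j ≠ l) :
    IndepFun (fun ω => (X i ω, X k ω, X l ω)) (X j) P := by
  have h := hindep.indepFun_finset {i, k, l} {j}
    (by simp [hi, hk, hl]) hX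
  have h1 : Measurable fun p : (({i, k, l} : Finset ℕ) → ℝ) =>
      (p ⟨i, by simp⟩, p ⟨k, by simp⟩, p ⟨l, by simp⟩) := by fun_prop
  have h2 : Measurable fun p : (({j} : Finset ℕ) → ℝ) => p ⟨j, by simp⟩ := by fun_prop
  exact h.comp h1 h2

variable [IsProbabilityMeasure P]

lemma integral_comp_eq_zero_of_indepFun {S : Type*} [MeasurableSpace S] {Z : Ω → S} {W : Ω → ℝ}
    (hZ : Measurable Z) (hW : Measurable W) (hind : IndepFun Z W P) (hlaw : P.map W = μ)
    {Φ : S → ℝ → ℝ} (hΦ : Measurable (Function.uncurry Φ)) (h0 : ∀ s, ∫ z, Φ s z ∂μ = 0) :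
    ∫ ω, Φ (Z ω) (W ω) ∂P = 0 := by
  -- Without integrability the Bochner integral is zero by convention, so no integrability
  -- hypothesis is needed.
  by_cases hint : Integrable (fun ω => Φ (Z ω) (W ω)) P
  swap
  · exact integral_undef hint
  have hm : Measurable fun ω => (Z ω, W ω) := hZ.prodMk hW
  have hmap := (indepFun_iff_map_prod_eq_prod_map_map hZ.aemeasurable hW.aemeasurable).1 hind
  have := Measure.isProbabilityMeasure_map (μ := P) hZ.aemeasurable
  have := Measure.isProbabilityMeasure_map (μ := P) hW.aemeasurable
  have h1 : ∫ ω, Φ (Z ω) (W ω) ∂P =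
      ∫ p, Function.uncurry Φ p ∂((P.map Z).prod (P.map W)) := by
    rw [← hmap, integral_map hm.aemeasurable hΦ.aestronglyMeasurable]
    rfl
  have h2 : Integrable (Function.uncurry Φ) ((P.map Z).prod (P.map W)) := by
    rw [← hmap, integrable_map_measure hΦ.aestronglyMeasurable hm.aemeasurable]
    exact hint
  rw [h1, integral_prod _ h2, hlaw]
  simp [Function.uncurry, h0]

variable (hX : ∀ i, Measurable (X i)) (hindep : iIndepFun X P) (hlaw : ∀ i, P.map (X i) = μ)

include hX hindep hlaw

/-- An observation that enters only once can be integrated out first, and that inner integral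
vanishes. -/
lemma integral_mul_eq_zero {A B : ℝ → ℝ → ℝ} (hA : Measurable (Function.uncurry A))
    (hB : Measurable (Function.uncurry B)) (h0 : ∀ y, ∫ z, A y z ∂μ = 0) {i j k l : ℕ}
    (hi : j ≠ i) (hk : j ≠ k) (hl : j ≠ l) :
    ∫ ω, A (X i ω) (X j ω) * B (X k ω) (X l ω) ∂P = 0 := by
  refine integral_comp_eq_zero_of_indepFun
    (Φ := fun (s : ℝ × ℝ × ℝ) z => A s.1 z * B s.2.1 s.2.2)
    ((hX i).prodMk ((hX k).prodMk (hX l))) (hX j) (indepFun_triple hX hindep hi hk hl) (hlaw j)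
    ?_ ?_
  · exact (hA.comp ((measurable_fst.comp measurable_fst).prodMk measurable_snd)).mul
      (hB.comp ((measurable_fst.comp (measurable_snd.comp measurable_fst)).prodMk
        (measurable_snd.comp (measurable_snd.comp measurable_fst))))
  · intro s
    rw [integral_mul_const, h0, zero_mul]

omit [IsProbabilityMeasure P] hindep in
lemma integral_comp_sample {g : ℝ → ℝ} (hg : Measurable g) (i : ℕ) :
    ∫ ω, g (X i ω) ∂P = ∫ y, g y ∂μ := by
  rw [← hlaw i, integral_map (hX i).aemeasurable hg.aestronglyMeasurable]

lemma integral_comp_pair_le [IsProbabilityMeasure μ] {G : ℝ → ℝ → ℝ}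
    (hG : Measurable (Function.uncurry G)) {M : ℝ} (hM : ∀ y z, |G y z| ≤ M) {V : ℝ}
    (hV : ∀ y, ∫ z, G y z ∂μ ≤ V) {i j : ℕ} (hij : i ≠ j) :
    ∫ ω, G (X i ω) (X j ω) ∂P ≤ V := by
  have hm : Measurable fun ω => (X i ω, X j ω) := (hX i).prodMk (hX j)
  have hmap := (indepFun_iff_map_prod_eq_prod_map_map (hX i).aemeasurable
    (hX j).aemeasurable).1 (hindep.indepFun hij)
  have h1 : ∫ ω, G (X i ω) (X j ω) ∂P = ∫ p, Function.uncurry G p ∂(μ.prod μ) := by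
    rw [← hlaw i]
    nth_rewrite 2 [hlaw i]
    rw [← hlaw j, ← hmap, integral_map hm.aemeasurable hG.aestronglyMeasurable]
    rfl
  rw [h1, integral_prod _ (integrable_of_abs_le hG fun p => hM p.1 p.2)]
  have h2 : ∀ y, |∫ z, G y z ∂μ| ≤ M := fun y => by
    have := norm_integral_le_of_norm_le_const (μ := μ) (f := fun z => G y z)
      (Eventually.of_forall (hM y))
    simpa using this
  calc ∫ y, ∫ z, Function.uncurry G (y, z) ∂μ ∂μ ≤ ∫ _y, V ∂μ := by
        refine integral_mono ?_ (integrable_const _) hV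
        exact integrable_of_abs_le (hG.stronglyMeasurable.integral_prod_right (ν := μ)).measurable
          h2
    _ = V := by simp

lemma integral_sum_sq_of_centered {g : ℝ → ℝ} (hg : Measurable g) {M : ℝ} (hM : ∀ y, |g y| ≤ M)
    (h0 : ∫ y, g y ∂μ = 0) (n : ℕ) :
    ∫ ω, (∑ i ∈ Finset.range n, g (X i ω)) ^ 2 ∂P = n * ∫ y, g y ^ 2 ∂μ := by
  have hm : ∀ i, Measurable fun ω => g (X i ω) := fun i => hg.comp (hX i)
  have hM0 : 0 ≤ M := (abs_nonneg _).trans (hM 0)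
  rw [integral_sum_sq]
  · simp_rw [integral_comp_sample hX hlaw (hg.pow_const 2)]
    simp
  · intro i _ j _
    exact integrable_of_abs_le ((hm i).mul (hm j)) (M := M * M) fun ω => by
      rw [abs_mul]; exact mul_le_mul (hM _) (hM _) (abs_nonneg _) hM0
  · intro i _ j _ hij
    exact integral_mul_eq_zero hX hindep hlaw (A := fun _ z => g z) (B := fun _ z => g z)
      (i := j) (j := i) (k := j) (l := j) (hg.comp measurable_snd) (hg.comp measurable_snd)
      (fun _ => h0) hij hij hij

lemma integral_mean_sub_sq_le [IsProbabilityMeasure μ] {g : ℝ → ℝ} (hg : Measurable g) {M : ℝ}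
    (hM : ∀ y, |g y| ≤ M) {n : ℕ} (hn : 0 < n) :
    ∫ ω, (1 / (n : ℝ) * ∑ i ∈ Finset.range n, g (X i ω) - ∫ y, g y ∂μ) ^ 2 ∂P ≤
      (∫ y, g y ^ 2 ∂μ) / n := by
  have hn' : (0 : ℝ) < n := by positivity
  set m := ∫ y, g y ∂μ with hm
  have hi := integrable_of_abs_le (ν := μ) hg hM
  have h1 := integral_sum_sq_of_centered hX hindep hlaw (g := fun y => g y - m)
    (hg.sub_const m) (M := M + |m|)
    (fun y => (abs_sub _ _).trans (add_le_add_left (hM y) _))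
    (by rw [integral_sub hi (integrable_const _)]; simp [hm]) n
  have h2 : ∫ y, (g y - m) ^ 2 ∂μ = ∫ y, g y ^ 2 ∂μ - m ^ 2 := integral_sub_integral_sq hg hM
  have h3 : ∀ ω, (1 / (n : ℝ) * ∑ i ∈ Finset.range n, g (X i ω) - m) ^ 2 =
      (1 / (n : ℝ)) ^ 2 * (∑ i ∈ Finset.range n, (g (X i ω) - m)) ^ 2 := fun ω => by
    rw [Finset.sum_sub_distrib]
    simp only [Finset.sum_const, Finset.card_range, nsmul_eq_mul]
    field_simp
  simp_rw [h3]
  rw [integral_const_mul, h1, h2]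
  have h4 : (1 / (n : ℝ)) ^ 2 * (n * (∫ y, g y ^ 2 ∂μ - m ^ 2)) =
      (∫ y, g y ^ 2 ∂μ - m ^ 2) / n := by field_simp
  rw [h4]
  exact div_le_div_of_nonneg_right (by linarith [sq_nonneg m]) hn'.le

/-- Chebyshev's inequality for functions that vary with `n`; boundedness serves only integrability,
the rate comes from the second moment. -/
lemma isBigOP_mean_sub [IsProbabilityMeasure μ] {g : ℕ → ℝ → ℝ} (hg : ∀ n, Measurable (g n))
    (hM : ∀ᶠ n in atTop, ∃ M, ∀ y, |g n y| ≤ M) {a : ℕ → ℝ} (ha : ∀ᶠ n in atTop, 0 < a n)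
    (C : ℝ) (hC : ∀ᶠ n : ℕ in atTop, ∫ y, g n y ^ 2 ∂μ ≤ C * a n ^ 2 * n) :
    IsBigOP P (fun n ω => 1 / (n : ℝ) * ∑ i ∈ Finset.range n, g n (X i ω) - ∫ y, g n y ∂μ) a := by
  refine isBigOP_of_integral_sq C ha ?_ ?_
  · filter_upwards [hM] with n ⟨M, hM⟩
    have hmeas : Measurable fun ω =>
        1 / (n : ℝ) * ∑ i ∈ Finset.range n, g n (X i ω) - ∫ y, g n y ∂μ :=
      ((Finset.measurable_fun_sum _ fun i _ => (hg n).comp (hX i)).const_mul _).sub_const _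
    refine integrable_of_abs_le (hmeas.pow_const 2)
      (M := (1 / (n : ℝ) * (n * M) + |∫ y, g n y ∂μ|) ^ 2) fun ω => ?_
    rw [abs_pow]
    refine pow_le_pow_left₀ (abs_nonneg _) ((abs_sub _ _).trans (add_le_add_left ?_ _)) 2
    rw [abs_mul, abs_of_nonneg (by positivity : (0 : ℝ) ≤ 1 / n)]
    refine mul_le_mul_of_nonneg_left ?_ (by positivity)
    refine (Finset.abs_sum_le_sum_abs _ _).trans ?_
    refine (Finset.sum_le_sum fun i _ => hM (X i ω)).trans ?_
    simp
  · filter_upwards [hM, hC, eventually_gt_atTop 0] with n ⟨M, hM⟩ h1 hn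
    refine (integral_mean_sub_sq_le hX hindep hlaw (hg n) hM hn).trans ?_
    rw [div_le_iff₀ (by positivity)]
    exact h1

/-- For two distinct summands, at least one has second index different from `i` and can be
integrated out, so cross terms vanish. The single summand with `j = i` is not centered and accounts
for $M^2/n^2$. -/
lemma integral_mean_kernel_sq_le [IsProbabilityMeasure μ] {G : ℝ → ℝ → ℝ}
    (hG : Measurable (Function.uncurry G)) {M : ℝ} (hM : ∀ y z, |G y z| ≤ M)
    (h0 : ∀ y, ∫ z, G y z ∂μ = 0) {V : ℝ} (hV : ∀ y, ∫ z, G y z ^ 2 ∂μ ≤ V) {n i : ℕ}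
    (hi : i < n) :
    ∫ ω, (1 / (n : ℝ) * ∑ j ∈ Finset.range n, G (X i ω) (X j ω)) ^ 2 ∂P ≤
      V / n + M ^ 2 / n ^ 2 := by
  have hn' : (0 : ℝ) < n := by exact_mod_cast (Nat.zero_le i).trans_lt hi
  have hM0 : 0 ≤ M := (abs_nonneg _).trans (hM 0 0)
  have hV0 : 0 ≤ V := (integral_nonneg fun _ => sq_nonneg _).trans (hV 0)
  have hm : ∀ j, Measurable fun ω => G (X i ω) (X j ω) := fun j =>
    hG.comp ((hX i).prodMk (hX j))
  have h1 : ∫ ω, (∑ j ∈ Finset.range n, G (X i ω) (X j ω)) ^ 2 ∂P =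
      ∑ j ∈ Finset.range n, ∫ ω, G (X i ω) (X j ω) ^ 2 ∂P := by
    refine integral_sum_sq _ ?_ ?_
    · intro j _ k _
      exact integrable_of_abs_le ((hm j).mul (hm k)) (M := M * M) fun ω => by
        rw [abs_mul]; exact mul_le_mul (hM _ _) (hM _ _) (abs_nonneg _) hM0
    · intro j _ k _ hjk
      by_cases hji : j = i
      · have hki : k ≠ i := fun h => hjk (hji.trans h.symm)
        simp_rw [mul_comm (G (X i _) (X j _))]
        exact integral_mul_eq_zero hX hindep hlaw hG hG h0 hki hki hjk.symm
      · exact integral_mul_eq_zero hX hindep hlaw hG hG h0 hji hji hjk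
  have h2 : ∑ j ∈ Finset.range n, ∫ ω, G (X i ω) (X j ω) ^ 2 ∂P ≤ n * V + M ^ 2 := by
    have hb : ∀ j ∈ Finset.range n, ∫ ω, G (X i ω) (X j ω) ^ 2 ∂P ≤
        V + if j = i then M ^ 2 else 0 := by
      intro j _
      by_cases hji : j = i
      · simp only [hji, if_true]
        have : ∫ ω, G (X i ω) (X i ω) ^ 2 ∂P ≤ ∫ _ω, M ^ 2 ∂P := by
          refine integral_mono_of_nonneg (Eventually.of_forall fun _ => sq_nonneg _)
            (integrable_const _) (Eventually.of_forall fun ω => ?_)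
          exact sq_le_sq' (neg_le_of_abs_le (hM _ _)) (le_of_abs_le (hM _ _))
        simp only [integral_const, probReal_univ, one_smul] at this
        linarith
      · simp only [hji, if_false, add_zero]
        exact integral_comp_pair_le hX hindep hlaw (G := fun y z => G y z ^ 2) (hG.pow_const 2)
          (M := M ^ 2) (fun y z => by
            rw [abs_pow]; exact pow_le_pow_left₀ (abs_nonneg _) (hM _ _) 2) hV (Ne.symm hji)
    refine (Finset.sum_le_sum hb).trans ?_
    rw [Finset.sum_add_distrib, Finset.sum_ite_eq' (Finset.range n)]
    simp [hi]
  simp_rw [mul_pow]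
  rw [integral_const_mul, h1]
  calc (1 / (n : ℝ)) ^ 2 * ∑ j ∈ Finset.range n, ∫ ω, G (X i ω) (X j ω) ^ 2 ∂P
      ≤ (1 / (n : ℝ)) ^ 2 * (n * V + M ^ 2) := mul_le_mul_of_nonneg_left h2 (by positivity)
    _ = V / n + M ^ 2 / n ^ 2 := by field_simp

/-- Degeneracy in both arguments makes distinct pairs orthogonal, so the second moment is of order
$n^2$ rather than $n^3$. -/
lemma integral_triangular_sq_le [IsProbabilityMeasure μ] {H : ℝ → ℝ → ℝ}
    (hH : Measurable (Function.uncurry H)) {M : ℝ} (hM : ∀ y z, |H y z| ≤ M)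
    (h1 : ∀ y, ∫ z, H y z ∂μ = 0) (h2 : ∀ z, ∫ y, H y z ∂μ = 0) {V : ℝ}
    (hV : ∀ i j, i ≠ j → ∫ ω, H (X i ω) (X j ω) ^ 2 ∂P ≤ V) (n : ℕ) :
    ∫ ω, (∑ i ∈ Finset.range n, ∑ j ∈ Finset.range i, H (X i ω) (X j ω)) ^ 2 ∂P ≤
      n ^ 2 * V := by
  have hM0 : 0 ≤ M := (abs_nonneg _).trans (hM 0 0)
  have hV0 : 0 ≤ V := (integral_nonneg fun _ => sq_nonneg _).trans (hV 0 1 zero_ne_one)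
  have hm : ∀ i j, Measurable fun ω => H (X i ω) (X j ω) := fun i j =>
    hH.comp ((hX i).prodMk (hX j))
  have hH' : Measurable (Function.uncurry fun y z => H z y) := hH.comp measurable_swap
  simp_rw [Finset.sum_sigma']
  rw [integral_sum_sq]
  · calc ∑ a ∈ (Finset.range n).sigma fun i => Finset.range i,
          ∫ ω, H (X a.1 ω) (X a.2 ω) ^ 2 ∂P
        ≤ ∑ _a ∈ (Finset.range n).sigma fun i => Finset.range i, V := by
          refine Finset.sum_le_sum fun a ha => hV _ _ ?_
          simp only [Finset.mem_sigma, Finset.mem_range] at ha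
          exact ha.2.ne'
      _ ≤ n ^ 2 * V := by
          rw [Finset.sum_const, nsmul_eq_mul, Finset.card_sigma]
          refine mul_le_mul_of_nonneg_right ?_ hV0
          have : ∑ i ∈ Finset.range n, (Finset.range i).card ≤ n * n := by
            refine (Finset.sum_le_card_nsmul _ _ n fun i hi => ?_).trans (by simp)
            simpa using (Finset.mem_range.1 hi).le
          calc ((∑ i ∈ Finset.range n, (Finset.range i).card : ℕ) : ℝ) ≤ ((n * n : ℕ) : ℝ) := by
                exact_mod_cast this
            _ = n ^ 2 := by push_cast; ring
  · intro a _ b _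
    exact integrable_of_abs_le ((hm _ _).mul (hm _ _)) (M := M * M) fun ω => by
      rw [abs_mul]; exact mul_le_mul (hM _ _) (hM _ _) (abs_nonneg _) hM0
  · rintro ⟨i, j⟩ ha ⟨k, l⟩ hb hab
    simp only [Finset.mem_sigma, Finset.mem_range] at ha hb
    -- With $j<i$ and $l<k$, two distinct pairs always leave one index unmatched: if $j$ occurs in
    -- the second pair, then $i$ does not.
    by_cases hj : j ≠ k ∧ j ≠ l
    · exact integral_mul_eq_zero hX hindep hlaw hH hH h1 ha.2.ne hj.1 hj.2
    · have hi : i ≠ k ∧ i ≠ l := by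
        by_contra hc
        have : i = k ∧ j = l := by omega
        exact hab (by rw [this.1, this.2])
      exact integral_mul_eq_zero hX hindep hlaw (A := fun y z => H z y) hH' hH h2 ha.2.ne' hi.1
        hi.2

omit hX hindep hlaw in
lemma sum_range_sum_range_eq (a : ℕ → ℕ → ℝ) (n : ℕ) :
    ∑ i ∈ Finset.range n, ∑ j ∈ Finset.range n, a i j =
      ∑ i ∈ Finset.range n, ∑ j ∈ Finset.range i, a i j +
      ∑ i ∈ Finset.range n, ∑ j ∈ Finset.range i, a j i + ∑ i ∈ Finset.range n, a i i := by
  induction n with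
  | zero => simp
  | succ n ih =>
    simp only [Finset.sum_range_succ, Finset.sum_add_distrib]
    rw [ih]
    ring

end Moments

/-! ### Stochastic orders of the sample quantities -/

section Design

variable {d : ℕ}

/-- `Γ_h` as an expectation. -/
def popGam (μ : Measure ℝ) (K : ℝ → ℝ) (R : ℝ → Fin d → ℝ) (x h : ℝ) :
    Matrix (Fin d) (Fin d) ℝ :=
  of fun k l => ∫ z, wbasis K R x h z k * R ((z - x) / h) l ∂μ

/-- The population influence function before centering. -/
def infl (μ : Measure ℝ) (K : ℝ → ℝ) (R : ℝ → Fin d → ℝ) (x h : ℝ) (k : Fin d) : ℝ → ℝ :=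
  upperInt μ fun z => wbasis K R x h z k

/-- `Σ_h` as a covariance matrix. -/
def popSig (μ : Measure ℝ) (K : ℝ → ℝ) (R : ℝ → Fin d → ℝ) (x h : ℝ) :
    Matrix (Fin d) (Fin d) ℝ :=
  of fun k l => ∫ t, infl μ K R x h k t * infl μ K R x h l t ∂μ -
    (∫ t, infl μ K R x h k t ∂μ) * ∫ t, infl μ K R x h l t ∂μ

lemma popGam_transpose (μ : Measure ℝ) (K : ℝ → ℝ) (R : ℝ → Fin d → ℝ) (x h : ℝ) :
    (popGam μ K R x h)ᵀ = popGam μ K R x h := by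
  ext k l
  simp only [transpose_apply, popGam, of_apply, wbasis]
  congr 1
  ext z
  ring

lemma popSig_transpose (μ : Measure ℝ) (K : ℝ → ℝ) (R : ℝ → Fin d → ℝ) (x h : ℝ) :
    (popSig μ K R x h)ᵀ = popSig μ K R x h := by
  ext k l
  simp only [transpose_apply, popSig, of_apply]
  simp_rw [mul_comm]

/-- The standing assumptions on the population and on the bandwidths. -/
structure Design (μ : Measure ℝ) (K : ℝ → ℝ) (R : ℝ → Fin d → ℝ) (x : ℝ) (h : ℕ → ℝ)
    (B lam : ℝ) : Prop where
  kernel : IsKernel K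
  basis : IsBasis R
  pos : ∀ n, 0 < h n
  tendsto_zero : Tendsto h atTop (𝓝 0)
  tendsto_atTop : Tendsto (fun n : ℕ => (n : ℝ) * h n ^ 2) atTop atTop
  one_le : 1 ≤ B
  lam_pos : 0 < lam
  bounds : ∀ᶠ n in atTop, UniformBounds μ K R x (h n) B
  coercive_gam : ∀ᶠ n in atTop, Coercive (popGam μ K R x (h n)) lam
  coercive_sig : ∀ᶠ n in atTop, Coercive (popSig μ K R x (h n)) (lam * h n)

/-- `X` is a random sample from `μ`. -/
structure IsSample {Ω : Type*} [MeasurableSpace Ω] (P : Measure Ω) (μ : Measure ℝ)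
    (X : ℕ → Ω → ℝ) : Prop where
  meas : ∀ i, Measurable (X i)
  indep : iIndepFun X P
  law : ∀ i, P.map (X i) = μ

variable {μ : Measure ℝ} {K : ℝ → ℝ} {R : ℝ → Fin d → ℝ} {x : ℝ} {h : ℕ → ℝ} {B lam : ℝ}

lemma Design.eventually_le_one (D : Design μ K R x h B lam) : ∀ᶠ n in atTop, h n ≤ 1 :=
  D.tendsto_zero.eventually (ge_mem_nhds one_pos)

/-- `1 / √(n h)`. -/
def rate (h : ℕ → ℝ) (n : ℕ) : ℝ := √(1 / ((n : ℝ) * h n))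

/-- `1 / √(n h²)`. -/
def slowRate (h : ℕ → ℝ) (n : ℕ) : ℝ := √(1 / ((n : ℝ) * h n ^ 2))

lemma Design.rate_pos (D : Design μ K R x h B lam) : ∀ᶠ n in atTop, 0 < rate h n := by
  filter_upwards [eventually_gt_atTop 0] with n hn
  have := D.pos n
  exact Real.sqrt_pos.2 (by positivity)

lemma rate_nonneg (h : ℕ → ℝ) (n : ℕ) : 0 ≤ rate h n := Real.sqrt_nonneg _

lemma slowRate_nonneg (h : ℕ → ℝ) (n : ℕ) : 0 ≤ slowRate h n := Real.sqrt_nonneg _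

lemma Design.rate_sq (D : Design μ K R x h B lam) (n : ℕ) :
    rate h n ^ 2 = 1 / ((n : ℝ) * h n) := by
  have := D.pos n
  exact Real.sq_sqrt (by positivity)

lemma slowRate_sq (h : ℕ → ℝ) (n : ℕ) : slowRate h n ^ 2 = 1 / ((n : ℝ) * h n ^ 2) :=
  Real.sq_sqrt (by positivity)

lemma Design.rate_eq (D : Design μ K R x h B lam) (n : ℕ) :
    rate h n = slowRate h n * √(h n) := by
  have := D.pos n
  rw [rate, slowRate, ← Real.sqrt_mul (by positivity)]
  congr 1
  rcases n.eq_zero_or_pos with hn | hn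
  · simp [hn]
  · field_simp

lemma Design.rate_le (D : Design μ K R x h B lam) : ∀ᶠ n in atTop, rate h n ≤ slowRate h n := by
  filter_upwards [D.eventually_le_one] with n hn
  rw [D.rate_eq n]
  exact mul_le_of_le_one_right (slowRate_nonneg h n) (Real.sqrt_le_one.2 hn)

lemma Design.tendsto_slowRate (D : Design μ K R x h B lam) :
    Tendsto (slowRate h) atTop (𝓝 0) := by
  have h1 : Tendsto (fun n : ℕ => 1 / ((n : ℝ) * h n ^ 2)) atTop (𝓝 0) := by
    simp_rw [one_div]
    exact D.tendsto_atTop.inv_tendsto_atTop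
  have h2 := h1.sqrt
  rw [Real.sqrt_zero] at h2
  exact h2

lemma Design.tendsto_rate (D : Design μ K R x h B lam) : Tendsto (rate h) atTop (𝓝 0) :=
  squeeze_zero' (Eventually.of_forall (rate_nonneg h)) D.rate_le D.tendsto_slowRate

lemma Design.rate_le_one (D : Design μ K R x h B lam) : ∀ᶠ n in atTop, rate h n ≤ 1 :=
  D.tendsto_rate.eventually (ge_mem_nhds one_pos)

lemma UniformBounds.integrable_wbasis [IsFiniteMeasure μ] {h : ℝ}
    (hB : UniformBounds μ K R x h B) (hK : IsKernel K) (hR : IsBasis R) (k : Fin d) :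
    Integrable (fun z => wbasis K R x h z k) μ :=
  integrable_of_abs_le (measurable_wbasis hK hR k) (hB.abs_wbasis_le · k)

lemma UniformBounds.abs_infl_le [IsFiniteMeasure μ] {h : ℝ} (hB : UniformBounds μ K R x h B)
    (hK : IsKernel K) (hR : IsBasis R) (k : Fin d) (t : ℝ) : |infl μ K R x h k t| ≤ B :=
  (abs_upperInt_le (hB.integrable_wbasis hK hR k) t).trans (hB.integral_abs_wbasis_le k)

lemma measurable_infl [IsProbabilityMeasure μ] (hK : IsKernel K) (hR : IsBasis R) (h : ℝ)
    (k : Fin d) : Measurable (infl μ K R x h k) :=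
  measurable_upperInt (measurable_wbasis hK hR k)

lemma abs_integral_le_of_abs_le [IsProbabilityMeasure μ] {g : ℝ → ℝ} {M : ℝ}
    (hM : ∀ y, |g y| ≤ M) : |∫ y, g y ∂μ| ≤ M := by
  have := norm_integral_le_of_norm_le_const (μ := μ) (f := g) (Eventually.of_forall hM)
  simpa using this

variable {Ω : Type*} [MeasurableSpace Ω] {P : Measure Ω} [IsProbabilityMeasure P]
  [IsProbabilityMeasure μ] {X : ℕ → Ω → ℝ} {υ : ℝ → Fin d → ℝ}

lemma Design.isBigOP_gamHat (D : Design μ K R x h B lam) (S : IsSample P μ X)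
    (hυ : IsScaling R υ) :
    IsBigOP P (fun n ω => entrySum (GamHat K R υ x (h n) n (fun i => X i ω) -
      popGam μ K R x (h n))) (rate h) := by
  refine IsBigOP.finset_sum _ fun k => IsBigOP.finset_sum _ fun l => IsBigOP.abs ?_
  simp only [Matrix.sub_apply, GamHat_apply hυ (D.pos _), popGam, of_apply]
  refine isBigOP_mean_sub S.meas S.indep S.law
    (g := fun n z => wbasis K R x (h n) z k * R ((z - x) / h n) l)
    (fun n => (measurable_wbasis D.kernel D.basis k).mul (measurable_basis D.basis l)) ?_
    D.rate_pos B ?_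
  · filter_upwards [D.bounds] with n hn
    exact ⟨_, fun y => hn.abs_gram_le y k l⟩
  · filter_upwards [D.bounds, eventually_gt_atTop 0] with n hn h0
    refine (hn.integral_gram_sq_le k l).trans (le_of_eq ?_)
    rw [D.rate_sq]
    have := D.pos n
    field_simp

/-- For fixed $y$ the kernel $r(z)1(y\le z)-\varphi(y)$ is centered in $z$ with variance at most
$B/h$, so each $\hat\varphi(x_i)$ has mean square error of order $1/(nh)$, and so does their
average. -/
lemma Design.isBigOP_upperHat_sub (D : Design μ K R x h B lam) (S : IsSample P μ X)
    (k : Fin d) :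
    IsBigOP P (fun n ω => 1 / (n : ℝ) * ∑ i ∈ Finset.range n,
      (upperHat n (fun j => X j ω) (fun y => wbasis K R x (h n) y k) i -
        infl μ K R x (h n) k (X i ω)) ^ 2) (fun n => rate h n ^ 2) := by
  have hB0 : 0 < B := one_pos.trans_le D.one_le
  have hmr := fun n => measurable_wbasis (x := x) (h := h n) D.kernel D.basis k
  have hG : ∀ n, Measurable (Function.uncurry fun y z =>
      wbasis K R x (h n) z k * indLe y z - infl μ K R x (h n) k y) := fun n =>
    (((hmr n).comp measurable_snd).mul (measurable_indLe measurable_fst measurable_snd)).sub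
      ((measurable_infl D.kernel D.basis (h n) k).comp measurable_fst)
  have hrw : ∀ n ω i, i ∈ Finset.range n →
      upperHat n (fun j => X j ω) (fun y => wbasis K R x (h n) y k) i -
        infl μ K R x (h n) k (X i ω) = 1 / (n : ℝ) * ∑ j ∈ Finset.range n,
        (wbasis K R x (h n) (X j ω) k * indLe (X i ω) (X j ω) -
          infl μ K R x (h n) k (X i ω)) := fun n ω i hi => by
    have : (0 : ℝ) < n := by exact_mod_cast (Nat.zero_le i).trans_lt (Finset.mem_range.1 hi)
    rw [Finset.sum_sub_distrib, upperHat]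
    simp only [Finset.sum_const, Finset.card_range, nsmul_eq_mul]
    field_simp
  have hbd : ∀ n, UniformBounds μ K R x (h n) B → h n ≤ 1 → ∀ y z,
      |wbasis K R x (h n) z k * indLe y z - infl μ K R x (h n) k y| ≤ 2 * B / h n := by
    intro n hn h1 y z
    have hp := D.pos n
    refine (abs_sub _ _).trans ?_
    have e1 := (abs_mul_indLe_le (wbasis K R x (h n) z k) y z).trans (hn.abs_wbasis_le z k)
    have e2 := hn.abs_infl_le D.kernel D.basis k y
    have e3 : B ≤ B / h n := by rw [le_div_iff₀ hp]; nlinarith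
    calc _ ≤ B / h n + B / h n := add_le_add e1 (e2.trans e3)
      _ = 2 * B / h n := by ring
  have hint : ∀ n, UniformBounds μ K R x (h n) B → h n ≤ 1 → ∀ i ∈ Finset.range n,
      Integrable (fun ω => (upperHat n (fun j => X j ω) (fun y => wbasis K R x (h n) y k) i -
        infl μ K R x (h n) k (X i ω)) ^ 2) P := by
    intro n hn h1 i hi
    have hn0 : (0 : ℝ) < n := by exact_mod_cast (Nat.zero_le i).trans_lt (Finset.mem_range.1 hi)
    simp_rw [hrw n _ i hi]
    refine integrable_of_abs_le (M := (2 * B / h n) ^ 2) (((Finset.measurable_fun_sum _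
      fun j _ => (hG n).comp ((S.meas i).prodMk (S.meas j))).const_mul _).pow_const 2) fun ω => ?_
    rw [abs_pow]
    refine pow_le_pow_left₀ (abs_nonneg _) ?_ 2
    rw [abs_mul, abs_of_pos (by positivity : (0 : ℝ) < 1 / n)]
    have := (Finset.abs_sum_le_sum_abs (fun j => wbasis K R x (h n) (X j ω) k *
      indLe (X i ω) (X j ω) - infl μ K R x (h n) k (X i ω)) (Finset.range n)).trans
      (Finset.sum_le_sum fun j _ => hbd n hn h1 (X i ω) (X j ω))
    calc _ ≤ 1 / (n : ℝ) * (n * (2 * B / h n)) := by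
          refine mul_le_mul_of_nonneg_left (this.trans ?_) (by positivity)
          simp
      _ = 2 * B / h n := by field_simp
  -- The variance part gives $B\,\mathrm{rate}^2$ and the summand $j=i$ gives
  -- $4B^2\,\mathrm{rate}^4$; with $B\ge1$ and rate at most one the total is at most
  -- $5B^2\,\mathrm{rate}^2$.
  refine isBigOP_of_integral_abs (5 * B ^ 2) (D.rate_pos.mono fun n hn => pow_pos hn 2) ?_ ?_
  · filter_upwards [D.bounds, D.eventually_le_one] with n hn h1
    exact (integrable_finsetSum _ (hint n hn h1)).const_mul _
  · filter_upwards [D.bounds, D.eventually_le_one, D.rate_le_one, eventually_gt_atTop 0] with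
      n hn h1 hr h0
    have hn0 : (0 : ℝ) < n := by exact_mod_cast h0
    have hp := D.pos n
    have habs : ∀ ω, |1 / (n : ℝ) * ∑ i ∈ Finset.range n,
        (upperHat n (fun j => X j ω) (fun y => wbasis K R x (h n) y k) i -
          infl μ K R x (h n) k (X i ω)) ^ 2| = 1 / (n : ℝ) * ∑ i ∈ Finset.range n,
        (upperHat n (fun j => X j ω) (fun y => wbasis K R x (h n) y k) i -
          infl μ K R x (h n) k (X i ω)) ^ 2 := fun ω =>
      abs_of_nonneg (mul_nonneg (by positivity) (Finset.sum_nonneg fun _ _ => sq_nonneg _))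
    simp_rw [habs]
    rw [integral_const_mul, integral_finsetSum _ (hint n hn h1)]
    have hri := hn.integrable_wbasis D.kernel D.basis k
    have hrIi : ∀ y, Integrable (fun z => wbasis K R x (h n) z k * indLe y z) μ := fun y =>
      integrable_of_abs_le ((hmr n).mul (measurable_indLe measurable_const measurable_id))
        fun z => (abs_mul_indLe_le (wbasis K R x (h n) z k) y z).trans (hn.abs_wbasis_le z k)
    have hone : ∀ i ∈ Finset.range n,
        ∫ ω, (upperHat n (fun j => X j ω) (fun y => wbasis K R x (h n) y k) i -
        infl μ K R x (h n) k (X i ω)) ^ 2 ∂P ≤ 5 * B ^ 2 * rate h n ^ 2 := by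
      intro i hi
      simp_rw [hrw n _ i hi]
      refine (integral_mean_kernel_sq_le S.meas S.indep S.law (hG n) (hbd n hn h1) ?_
        (V := B / h n) ?_ (Finset.mem_range.1 hi)).trans ?_
      · intro y
        rw [integral_sub (hrIi y) (integrable_const _)]
        simp [infl, upperInt]
      · intro y
        rw [show infl μ K R x (h n) k y = ∫ z, wbasis K R x (h n) z k * indLe y z ∂μ from rfl,
          integral_sub_integral_sq (g := fun z => wbasis K R x (h n) z k * indLe y z)
            ((hmr n).mul (measurable_indLe measurable_const measurable_id))
            fun z => (abs_mul_indLe_le (wbasis K R x (h n) z k) y z).trans (hn.abs_wbasis_le z k)]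
        have e1 : ∫ z, (wbasis K R x (h n) z k * indLe y z) ^ 2 ∂μ ≤
            ∫ z, wbasis K R x (h n) z k ^ 2 ∂μ := by
          refine integral_mono_of_nonneg (Eventually.of_forall fun _ => sq_nonneg _) ?_
            (Eventually.of_forall fun z => ?_)
          · exact integrable_of_abs_le ((hmr n).pow_const 2) (M := (B / h n) ^ 2) fun z => by
              rw [abs_pow]; exact pow_le_pow_left₀ (abs_nonneg _) (hn.abs_wbasis_le z k) 2
          · exact sq_le_sq.2 (abs_mul_indLe_le _ _ _)
        have e2 := hn.integral_wbasis_sq_le k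
        linarith [sq_nonneg (∫ z, wbasis K R x (h n) z k * indLe y z ∂μ)]
      · have e1 : B / h n / n = B * rate h n ^ 2 := by rw [D.rate_sq]; field_simp
        have e2 : (2 * B / h n) ^ 2 / (n : ℝ) ^ 2 = 4 * B ^ 2 * (rate h n ^ 2) ^ 2 := by
          rw [D.rate_sq]; field_simp; ring
        have e3 : (rate h n ^ 2) ^ 2 ≤ rate h n ^ 2 := by
          have : rate h n ^ 2 ≤ 1 := pow_le_one₀ (rate_nonneg h n) hr
          nlinarith [sq_nonneg (rate h n)]
        rw [e1, e2]
        have e4 : B ≤ B ^ 2 := by nlinarith [D.one_le]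
        have e5 := mul_le_mul_of_nonneg_right e4 (sq_nonneg (rate h n))
        have e6 := mul_le_mul_of_nonneg_left e3 (by positivity : 0 ≤ 4 * B ^ 2)
        linarith
    calc 1 / (n : ℝ) * ∑ i ∈ Finset.range n, _
        ≤ 1 / (n : ℝ) * ∑ _i ∈ Finset.range n, 5 * B ^ 2 * rate h n ^ 2 :=
          mul_le_mul_of_nonneg_left (Finset.sum_le_sum hone) (by positivity)
      _ = 5 * B ^ 2 * rate h n ^ 2 := by simp; field_simp

omit [IsProbabilityMeasure μ] in
lemma Design.isBigOP_mean_abs_wbasis (D : Design μ K R x h B lam) (S : IsSample P μ X)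
    (k : Fin d) :
    IsBigOP P (fun n ω => 1 / (n : ℝ) * ∑ j ∈ Finset.range n, |wbasis K R x (h n) (X j ω) k|)
      (fun _ => 1) := by
  have hm := fun n => (measurable_wbasis (x := x) (h := h n) D.kernel D.basis k)
  have hint : ∀ n, UniformBounds μ K R x (h n) B → ∀ j ∈ Finset.range n,
      Integrable (fun ω => |wbasis K R x (h n) (X j ω) k|) P := fun n hn j _ =>
    integrable_of_abs_le ((hm n).comp (S.meas j)).abs fun ω => by
      rw [abs_abs]; exact hn.abs_wbasis_le (X j ω) k
  refine isBigOP_of_integral_abs B (Eventually.of_forall fun _ => one_pos) ?_ ?_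
  · filter_upwards [D.bounds] with n hn
    exact (integrable_finsetSum _ (hint n hn)).const_mul _
  · filter_upwards [D.bounds, eventually_gt_atTop 0] with n hn h0
    have hn0 : (0 : ℝ) < n := by exact_mod_cast h0
    have habs : ∀ ω, |1 / (n : ℝ) * (∑ j ∈ Finset.range n, |wbasis K R x (h n) (X j ω) k|)| =
        1 / (n : ℝ) * ∑ j ∈ Finset.range n, |wbasis K R x (h n) (X j ω) k| := fun ω =>
      abs_of_nonneg (mul_nonneg (by positivity) (Finset.sum_nonneg fun _ _ => abs_nonneg _))
    simp_rw [habs]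
    rw [integral_const_mul, integral_finsetSum _ (hint n hn)]
    have : ∀ j, ∫ ω, |wbasis K R x (h n) (X j ω) k| ∂P ≤ B := fun j => by
      rw [integral_comp_sample S.meas S.law (g := fun y => |wbasis K R x (h n) y k|) (hm n).abs]
      exact hn.integral_abs_wbasis_le k
    calc 1 / (n : ℝ) * ∑ j ∈ Finset.range n, ∫ ω, |wbasis K R x (h n) (X j ω) k| ∂P
        ≤ 1 / (n : ℝ) * ∑ _j ∈ Finset.range n, B :=
          mul_le_mul_of_nonneg_left (Finset.sum_le_sum fun j _ => this j) (by positivity)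
      _ = B * 1 := by simp; field_simp

end Design

/-! ### The score and its projection -/

section Score

variable {d : ℕ} {μ : Measure ℝ} {K : ℝ → ℝ} {R : ℝ → Fin d → ℝ} {x : ℝ} {h : ℕ → ℝ} {B lam : ℝ}
  [IsProbabilityMeasure μ]

/-- The completely degenerate kernel of the Hoeffding decomposition of the score. -/
def degKernel (μ : Measure ℝ) (K : ℝ → ℝ) (R : ℝ → Fin d → ℝ) (x h : ℝ) (k : Fin d)
    (y z : ℝ) : ℝ :=
  wbasis K R x h z k * (indLe y z - cdf μ z) - (infl μ K R x h k y - ∫ t, infl μ K R x h k t ∂μ)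

lemma measurable_cdf (μ : Measure ℝ) : Measurable (cdf μ) := (monotone_cdf μ).measurable

lemma abs_indLe_sub_cdf_le (μ : Measure ℝ) (y z : ℝ) : |indLe y z - cdf μ z| ≤ 1 := by
  have h1 := indLe_nonneg y z
  have h2 := indLe_le_one y z
  have h3 := cdf_nonneg μ z
  have h4 := cdf_le_one μ z
  rw [abs_le]; constructor <;> linarith

lemma measurable_degKernel (hK : IsKernel K) (hR : IsBasis R) (h : ℝ) (k : Fin d) :
    Measurable (Function.uncurry (degKernel μ K R x h k)) :=
  (((measurable_wbasis hK hR k).comp measurable_snd).mul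
    ((measurable_indLe measurable_fst measurable_snd).sub
      ((measurable_cdf μ).comp measurable_snd))).sub
    (((measurable_infl hK hR h k).comp measurable_fst).sub_const _)

lemma UniformBounds.abs_degKernel_le {h : ℝ} (hB : UniformBounds μ K R x h B) (hK : IsKernel K)
    (hR : IsBasis R) (k : Fin d) (y z : ℝ) :
    |degKernel μ K R x h k y z| ≤ |wbasis K R x h z k| + 2 * B := by
  have h1 := hB.abs_infl_le hK hR k
  have h2 := abs_integral_le_of_abs_le (μ := μ) h1
  have h3 : |wbasis K R x h z k * (indLe y z - cdf μ z)| ≤ |wbasis K R x h z k| := by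
    rw [abs_mul]
    exact mul_le_of_le_one_right (abs_nonneg _) (abs_indLe_sub_cdf_le μ y z)
  have h4 := (abs_sub (infl μ K R x h k y) (∫ t, infl μ K R x h k t ∂μ)).trans
    (add_le_add (h1 y) h2)
  exact (abs_sub _ _).trans (by linarith)

lemma UniformBounds.integral_degKernel_right {h : ℝ} (hB : UniformBounds μ K R x h B)
    (hK : IsKernel K) (hR : IsBasis R) (k : Fin d) (y : ℝ) :
    ∫ z, degKernel μ K R x h k y z ∂μ = 0 := by
  have hm := measurable_wbasis (x := x) (h := h) hK hR k
  have i1 : Integrable (fun z => wbasis K R x h z k * indLe y z) μ :=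
    integrable_of_abs_le (hm.mul (measurable_indLe measurable_const measurable_id))
      fun z => (abs_mul_indLe_le (wbasis K R x h z k) y z).trans (hB.abs_wbasis_le z k)
  have i2 : Integrable (fun z => wbasis K R x h z k * cdf μ z) μ :=
    integrable_of_abs_le (hm.mul (measurable_cdf μ)) (M := B / h) fun z => by
      rw [abs_mul, abs_of_nonneg (cdf_nonneg μ z)]
      exact (mul_le_of_le_one_right (abs_nonneg _) (cdf_le_one μ z)).trans (hB.abs_wbasis_le z k)
  simp only [degKernel, mul_sub]
  have i3 : Integrable (fun z => wbasis K R x h z k * indLe y z -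
      wbasis K R x h z k * cdf μ z) μ := i1.sub i2
  rw [integral_sub i3 (integrable_const _), integral_sub i1 i2]
  have h1 : ∫ t, infl μ K R x h k t ∂μ = ∫ z, wbasis K R x h z k * cdf μ z ∂μ :=
    integral_upperInt hm (hB.abs_wbasis_le · k)
  have h2 : infl μ K R x h k y = ∫ z, wbasis K R x h z k * indLe y z ∂μ := rfl
  rw [integral_const, probReal_univ, one_smul, h1, h2]
  ring

lemma UniformBounds.integral_degKernel_left {h : ℝ} (hB : UniformBounds μ K R x h B)
    (hK : IsKernel K) (hR : IsBasis R) (k : Fin d) (z : ℝ) :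
    ∫ y, degKernel μ K R x h k y z ∂μ = 0 := by
  have i1 : Integrable (infl μ K R x h k) μ :=
    integrable_of_abs_le (measurable_infl hK hR h k) (hB.abs_infl_le hK hR k)
  have i2 : Integrable (fun y => indLe y z) μ :=
    integrable_of_abs_le (measurable_indLe measurable_id measurable_const)
      fun y => abs_indLe_le y z
  have i3 : Integrable (fun y => wbasis K R x h z k * (indLe y z - cdf μ z)) μ :=
    (i2.sub (integrable_const _)).const_mul _
  have i4 : Integrable (fun y => infl μ K R x h k y - ∫ t, infl μ K R x h k t ∂μ) μ :=
    i1.sub (integrable_const _)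
  simp only [degKernel]
  rw [integral_sub i3 i4, integral_const_mul, integral_sub i2 (integrable_const _),
    integral_sub i1 (integrable_const _), integral_indLe]
  simp

variable {Ω : Type*} [MeasurableSpace Ω] {P : Measure Ω} [IsProbabilityMeasure P]
  {X : ℕ → Ω → ℝ}

/-- The two choices of `H` handle the pairs below and above the diagonal, which are treated
separately so that each unordered pair occurs once. -/
lemma Design.isBigOP_degKernel_triangular (D : Design μ K R x h B lam) (S : IsSample P μ X)
    (k : Fin d) {H : ℕ → ℝ → ℝ → ℝ}
    (hH : H = (fun n => degKernel μ K R x (h n) k) ∨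
      H = fun n y z => degKernel μ K R x (h n) k z y) :
    IsBigOP P (fun n ω => (1 / (n : ℝ)) ^ 2 * ∑ i ∈ Finset.range n, ∑ j ∈ Finset.range i,
      H n (X i ω) (X j ω)) (fun n => rate h n / √n) := by
  have hB0 : 0 < B := one_pos.trans_le D.one_le
  have hmk := fun n => measurable_degKernel (μ := μ) (x := x) D.kernel D.basis (h n) k
  have hm : ∀ n, Measurable (Function.uncurry (H n)) := fun n => by
    rcases hH with rfl | rfl
    · exact hmk n
    · exact (hmk n).comp measurable_swap
  have hbk : ∀ n, UniformBounds μ K R x (h n) B → ∀ y z,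
      |degKernel μ K R x (h n) k y z| ≤ B / h n + 2 * B := fun n hn y z =>
    (hn.abs_degKernel_le D.kernel D.basis k y z).trans
      (add_le_add_left (hn.abs_wbasis_le z k) _)
  have hb : ∀ n, UniformBounds μ K R x (h n) B → ∀ y z, |H n y z| ≤ B / h n + 2 * B := by
    rcases hH with rfl | rfl
    · exact hbk
    · exact fun n hn y z => hbk n hn z y
  -- From $(|r|+2B)^2\le2r^2+8B^2$ and $\int r^2\,d\mu\le B/h\le B^2/h$, using $h\le1$. The
  -- normalization leaves $10B^2/(n^2h)$.
  refine isBigOP_of_integral_sq (10 * B ^ 2) ?_ ?_ ?_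
  · filter_upwards [D.rate_pos, eventually_gt_atTop 0] with n h1 h2
    have : (0 : ℝ) < n := by exact_mod_cast h2
    positivity
  · filter_upwards [D.bounds] with n hn
    refine integrable_of_abs_le (M := ((1 / (n : ℝ)) ^ 2 *
      ∑ i ∈ Finset.range n, ∑ j ∈ Finset.range i, (B / h n + 2 * B)) ^ 2)
      (((Finset.measurable_fun_sum _ fun i _ => Finset.measurable_fun_sum _ fun j _ =>
        (hm n).comp ((S.meas i).prodMk (S.meas j))).const_mul _).pow_const 2) fun ω => ?_
    rw [abs_pow]
    refine pow_le_pow_left₀ (abs_nonneg _) ?_ 2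
    rw [abs_mul, abs_of_nonneg (by positivity : (0 : ℝ) ≤ (1 / (n : ℝ)) ^ 2)]
    refine mul_le_mul_of_nonneg_left ?_ (by positivity)
    refine (Finset.abs_sum_le_sum_abs _ _).trans (Finset.sum_le_sum fun i _ => ?_)
    exact (Finset.abs_sum_le_sum_abs _ _).trans (Finset.sum_le_sum fun j _ => hb n hn _ _)
  · filter_upwards [D.bounds, D.eventually_le_one, eventually_gt_atTop 0] with n hn h1 h0
    have hn0 : (0 : ℝ) < n := by exact_mod_cast h0
    have hp := D.pos n
    have hVk : ∀ i j, i ≠ j →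
        ∫ ω, degKernel μ K R x (h n) k (X i ω) (X j ω) ^ 2 ∂P ≤ 10 * B ^ 2 / h n := by
      intro i j hij
      refine integral_comp_pair_le S.meas S.indep S.law
        (G := fun y z => degKernel μ K R x (h n) k y z ^ 2) ((hmk n).pow_const 2)
        (M := (B / h n + 2 * B) ^ 2) (fun y z => by
          rw [abs_pow]; exact pow_le_pow_left₀ (abs_nonneg _) (hbk n hn y z) 2) ?_ hij
      intro y
      have i1 : Integrable (fun z => wbasis K R x (h n) z k ^ 2) μ :=
        integrable_of_abs_le ((measurable_wbasis D.kernel D.basis k).pow_const 2)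
          (M := (B / h n) ^ 2) fun z => by
            rw [abs_pow]; exact pow_le_pow_left₀ (abs_nonneg _) (hn.abs_wbasis_le z k) 2
      calc ∫ z, degKernel μ K R x (h n) k y z ^ 2 ∂μ
          ≤ ∫ z, (2 * wbasis K R x (h n) z k ^ 2 + 8 * B ^ 2) ∂μ := by
            refine integral_mono_of_nonneg (Eventually.of_forall fun _ => sq_nonneg _)
              ((i1.const_mul _).add (integrable_const _)) (Eventually.of_forall fun z => ?_)
            have e1 := hn.abs_degKernel_le D.kernel D.basis k y z
            have e2 := pow_le_pow_left₀ (abs_nonneg _) e1 2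
            rw [sq_abs] at e2
            refine e2.trans ?_
            simp only
            rw [← sq_abs (wbasis K R x (h n) z k)]
            nlinarith [sq_nonneg (|wbasis K R x (h n) z k| - 2 * B)]
        _ = 2 * ∫ z, wbasis K R x (h n) z k ^ 2 ∂μ + 8 * B ^ 2 := by
            rw [integral_add (i1.const_mul _) (integrable_const _), integral_const_mul]
            simp
        _ ≤ 2 * (B / h n) + 8 * B ^ 2 := by linarith [hn.integral_wbasis_sq_le k]
        _ ≤ 10 * B ^ 2 / h n := by
            rw [le_div_iff₀ hp, add_mul, mul_assoc, div_mul_cancel₀ _ hp.ne']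
            have e1 : B ≤ B ^ 2 := by nlinarith [D.one_le]
            have e2 : 8 * B ^ 2 * h n ≤ 8 * B ^ 2 := mul_le_of_le_one_right (by positivity) h1
            linarith
    have hV : ∀ i j, i ≠ j → ∫ ω, H n (X i ω) (X j ω) ^ 2 ∂P ≤ 10 * B ^ 2 / h n := by
      rcases hH with rfl | rfl
      · exact hVk
      · exact fun i j hij => hVk j i hij.symm
    have hz1 : ∀ y, ∫ z, H n y z ∂μ = 0 := by
      rcases hH with rfl | rfl
      · exact hn.integral_degKernel_right D.kernel D.basis k
      · exact hn.integral_degKernel_left D.kernel D.basis k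
    have hz2 : ∀ z, ∫ y, H n y z ∂μ = 0 := by
      rcases hH with rfl | rfl
      · exact hn.integral_degKernel_left D.kernel D.basis k
      · exact hn.integral_degKernel_right D.kernel D.basis k
    have key := integral_triangular_sq_le S.meas S.indep S.law (hm n) (hb n hn) hz1 hz2 hV n
    simp_rw [mul_pow]
    rw [integral_const_mul]
    refine (mul_le_mul_of_nonneg_left key (by positivity)).trans (le_of_eq ?_)
    rw [div_pow (rate h n), D.rate_sq, Real.sq_sqrt hn0.le]
    field_simp

/-- Only $n$ summands of bounded mean absolute value appear under the factor $n^{-2}$, so the order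
is $1/n$, which is below $1/(n\sqrt h)$ for $h\le1$. -/
lemma Design.isBigOP_degKernel_diagonal (D : Design μ K R x h B lam) (S : IsSample P μ X)
    (k : Fin d) :
    IsBigOP P (fun n ω => (1 / (n : ℝ)) ^ 2 * ∑ i ∈ Finset.range n,
      degKernel μ K R x (h n) k (X i ω) (X i ω)) (fun n => rate h n / √n) := by
  have hB0 : 0 < B := one_pos.trans_le D.one_le
  have h1 : IsBigOP P (fun n ω => (1 / (n : ℝ)) * ((1 / (n : ℝ)) * ∑ j ∈ Finset.range n,
      |wbasis K R x (h n) (X j ω) k| + 2 * B)) (fun n => 1 / (n : ℝ) * 1) :=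
    (isBigOP_of_eventually_le 1 (by simp)).mul ((D.isBigOP_mean_abs_wbasis S k).add
      (isBigOP_of_eventually_le (2 * B) (by simp [abs_of_pos hB0])))
  refine (h1.mono_left (HighProb.of_eventually ?_)).const_scale (C := 1) ?_
  · filter_upwards [D.bounds, eventually_gt_atTop 0] with n hn h0 ω
    have hn0 : (0 : ℝ) < n := by exact_mod_cast h0
    refine le_trans ?_ (le_abs_self _)
    rw [abs_mul, abs_of_nonneg (by positivity : (0 : ℝ) ≤ (1 / (n : ℝ)) ^ 2), sq, mul_assoc]
    refine mul_le_mul_of_nonneg_left ?_ (by positivity)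
    have e1 := (Finset.abs_sum_le_sum_abs (fun i => degKernel μ K R x (h n) k (X i ω) (X i ω))
      (Finset.range n)).trans (Finset.sum_le_sum fun i _ =>
        hn.abs_degKernel_le D.kernel D.basis k (X i ω) (X i ω))
    rw [Finset.sum_add_distrib] at e1
    simp only [Finset.sum_const, Finset.card_range, nsmul_eq_mul] at e1
    refine (mul_le_mul_of_nonneg_left e1 (by positivity)).trans (le_of_eq ?_)
    field_simp
  · filter_upwards [D.eventually_le_one, eventually_gt_atTop 0] with n hn h0
    have hn0 : (0 : ℝ) < n := by exact_mod_cast h0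
    have hp := D.pos n
    rw [mul_one, one_mul, abs_of_nonneg (by positivity),
      abs_of_nonneg (div_nonneg (rate_nonneg h n) (Real.sqrt_nonneg _)), rate,
      ← Real.sqrt_div (by positivity)]
    refine Real.le_sqrt_of_sq_le ?_
    rw [div_pow, one_pow, div_div]
    refine one_div_le_one_div_of_le (by positivity) ?_
    nlinarith

/-- The average of the centered population influence functions. -/
def meanInfl (μ : Measure ℝ) (K : ℝ → ℝ) (R : ℝ → Fin d → ℝ) (x h : ℝ) (n : ℕ) (z : ℕ → ℝ)
    (k : Fin d) : ℝ :=
  1 / (n : ℝ) * ∑ i ∈ Finset.range n, infl μ K R x h k (z i) - ∫ t, infl μ K R x h k t ∂μ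

lemma Design.isBigOP_meanInfl (D : Design μ K R x h B lam) (S : IsSample P μ X) (k : Fin d) :
    IsBigOP P (fun n ω => meanInfl μ K R x (h n) n (fun i => X i ω) k)
      (fun n => 1 / √(n : ℝ)) := by
  refine isBigOP_mean_sub S.meas S.indep S.law (g := fun n => infl μ K R x (h n) k)
    (fun n => measurable_infl D.kernel D.basis (h n) k) ?_ ?_ (B ^ 2) ?_
  · filter_upwards [D.bounds] with n hn
    exact ⟨B, hn.abs_infl_le D.kernel D.basis k⟩
  · filter_upwards [eventually_gt_atTop 0] with n h0
    have hn0 : (0 : ℝ) < n := by exact_mod_cast h0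
    positivity
  · filter_upwards [D.bounds, eventually_gt_atTop 0] with n hn h0
    have hn0 : (0 : ℝ) < n := by exact_mod_cast h0
    have e1 : B ^ 2 * (1 / √(n : ℝ)) ^ 2 * n = B ^ 2 := by
      rw [div_pow, Real.sq_sqrt hn0.le]; field_simp
    rw [e1]
    refine (le_abs_self _).trans (abs_integral_le_of_abs_le fun y => ?_)
    rw [abs_pow]
    exact pow_le_pow_left₀ (abs_nonneg _) (hn.abs_infl_le D.kernel D.basis k y) 2

omit [IsProbabilityMeasure μ] in
lemma abs_sub_le_rho (hR : IsBasis R) (θ : Fin d → ℝ) {b y : ℝ} (hy : y ∈ Set.Icc (x - b) (x + b)) :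
    |cdf μ y - R (y - x) ⬝ᵥ θ| ≤ rho (cdf μ) R θ x b := by
  have hy' : |y - x| ≤ b := abs_le.2 ⟨by linarith [hy.1], by linarith [hy.2]⟩
  -- The real supremum of an unbounded set is zero by convention, so boundedness must be supplied;
  -- it comes from the local boundedness of `R`.
  refine le_csSup ?_ ⟨y, hy', rfl⟩
  obtain ⟨C, hC0, hC⟩ := hR.exists_bound (-b) b
  refine ⟨1 + ∑ k, C * |θ k|, ?_⟩
  rintro _ ⟨t, ht, rfl⟩
  refine (abs_sub _ _).trans (add_le_add ?_ ?_)
  · rw [abs_of_nonneg (cdf_nonneg μ t)]; exact cdf_le_one μ t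
  · refine (Finset.abs_sum_le_sum_abs _ _).trans (Finset.sum_le_sum fun k _ => ?_)
    rw [abs_mul]
    exact mul_le_mul_of_nonneg_right (hC _ (abs_le.1 ht) k) (abs_nonneg _)

omit [IsProbabilityMeasure μ] in
lemma rho_nonneg (θ : Fin d → ℝ) (b : ℝ) : 0 ≤ rho (cdf μ) R θ x b := by
  refine Real.sSup_nonneg ?_
  rintro _ ⟨y, _, rfl⟩
  exact abs_nonneg _

omit [IsProbabilityMeasure μ] in
-- Hoeffding decomposition: split $\hat F-R'\theta$ into $(\hat F-F)+(F-R'\theta)$. The first part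
-- is a double sum whose projection is the mean influence function, leaving the degenerate kernel;
-- the second is the approximation bias.
lemma score_sub_meanInfl_eq {b : ℝ} {n : ℕ} (hn : 0 < n) (z : ℕ → ℝ) (θ : Fin d → ℝ) (k : Fin d) :
    score K R x b n z θ k - meanInfl μ K R x b n z k =
      (1 / (n : ℝ)) ^ 2 * ∑ i ∈ Finset.range n, ∑ j ∈ Finset.range n,
        degKernel μ K R x b k (z i) (z j) +
      1 / (n : ℝ) * ∑ j ∈ Finset.range n,
        wbasis K R x b (z j) k * (cdf μ (z j) - R (z j - x) ⬝ᵥ θ) := by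
  have hn0 : (n : ℝ) ≠ 0 := by positivity
  have h1 : ∑ i ∈ Finset.range n, ∑ j ∈ Finset.range n, degKernel μ K R x b k (z i) (z j) =
      n * ∑ j ∈ Finset.range n, wbasis K R x b (z j) k * (ecdf n z (z j) - cdf μ (z j)) -
      n * (∑ i ∈ Finset.range n, infl μ K R x b k (z i) - n * ∫ t, infl μ K R x b k t ∂μ) := by
    simp only [degKernel, Finset.sum_sub_distrib, Finset.sum_const, Finset.card_range,
      nsmul_eq_mul]
    rw [← Finset.mul_sum, Finset.sum_comm]
    have e2 : ∀ j, ∑ i ∈ Finset.range n, wbasis K R x b (z j) k * (indLe (z i) (z j) - cdf μ (z j))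
        = n * (wbasis K R x b (z j) k * (ecdf n z (z j) - cdf μ (z j))) := fun j => by
      rw [← Finset.mul_sum, Finset.sum_sub_distrib, ecdf]
      simp only [Finset.sum_const, Finset.card_range, nsmul_eq_mul]
      field_simp
    simp_rw [e2]
    rw [← Finset.mul_sum]
    ring
  rw [h1, score, meanInfl]
  have h2 : ∀ j, wbasis K R x b (z j) k * (ecdf n z (z j) - R (z j - x) ⬝ᵥ θ) =
      wbasis K R x b (z j) k * (ecdf n z (z j) - cdf μ (z j)) +
      wbasis K R x b (z j) k * (cdf μ (z j) - R (z j - x) ⬝ᵥ θ) := fun j => by ring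
  simp_rw [h2]
  rw [Finset.sum_add_distrib]
  field_simp
  ring

lemma Design.isBigOP_score_sub (D : Design μ K R x h B lam) (S : IsSample P μ X)
    (θ : Fin d → ℝ) (k : Fin d) :
    IsBigOP P (fun n ω => score K R x (h n) n (fun i => X i ω) θ k -
      meanInfl μ K R x (h n) n (fun i => X i ω) k)
      (fun n => rate h n / √n + rho (cdf μ) R θ x (h n)) := by
  have hr0 : ∀ n : ℕ, 0 ≤ rate h n / √n := fun n =>
    div_nonneg (rate_nonneg h n) (Real.sqrt_nonneg _)
  have hrho : ∀ n, 0 ≤ rho (cdf μ) R θ x (h n) := fun n => rho_nonneg θ (h n)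
  have h1 := ((D.isBigOP_degKernel_triangular S k (Or.inl rfl)).add
    (D.isBigOP_degKernel_triangular S k (Or.inr rfl))).add (D.isBigOP_degKernel_diagonal S k)
  have h2 : IsBigOP P (fun n ω => rho (cdf μ) R θ x (h n) * (1 / (n : ℝ) *
      ∑ j ∈ Finset.range n, |wbasis K R x (h n) (X j ω) k|))
      (fun n => rho (cdf μ) R θ x (h n) * 1) :=
    (isBigOP_of_eventually_le 1 (by simp)).mul (D.isBigOP_mean_abs_wbasis S k)
  have h3 : IsBigOP P (fun n ω => 1 / (n : ℝ) * ∑ j ∈ Finset.range n,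
      wbasis K R x (h n) (X j ω) k * (cdf μ (X j ω) - R (X j ω - x) ⬝ᵥ θ))
      (fun n => rho (cdf μ) R θ x (h n) * 1) := by
    refine h2.mono_left (HighProb.of_eventually (Eventually.of_forall fun n ω => ?_))
    refine le_trans ?_ (le_abs_self _)
    rw [abs_mul, abs_of_nonneg (by positivity : (0 : ℝ) ≤ 1 / (n : ℝ)), mul_left_comm,
      Finset.mul_sum]
    refine mul_le_mul_of_nonneg_left ?_ (by positivity)
    refine (Finset.abs_sum_le_sum_abs _ _).trans (Finset.sum_le_sum fun j _ => ?_)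
    rw [abs_mul, mul_comm]
    -- Inside the window the bias is at most $\varrho(h)$; outside it the weight vanishes.
    by_cases hj : X j ω ∈ Set.Icc (x - h n) (x + h n)
    · exact mul_le_mul_of_nonneg_right (abs_sub_le_rho D.basis θ hj) (abs_nonneg _)
    · simp [wbasis, weight_eq_zero D.kernel (D.pos n) hj]
  have h4 := (h1.const_scale (C := 1) (a := fun n => rate h n / √n + rho (cdf μ) R θ x (h n))
    (Eventually.of_forall fun n => by
      rw [one_mul, abs_of_nonneg (hr0 n), abs_of_nonneg (add_nonneg (hr0 n) (hrho n))]
      exact le_add_of_nonneg_right (hrho n))).add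
    (h3.const_scale (C := 1) (a := fun n => rate h n / √n + rho (cdf μ) R θ x (h n))
    (Eventually.of_forall fun n => by
      rw [one_mul, mul_one, abs_of_nonneg (hrho n), abs_of_nonneg (add_nonneg (hr0 n) (hrho n))]
      exact le_add_of_nonneg_left (hr0 n)))
  refine h4.mono_left (HighProb.of_eventually ?_)
  filter_upwards [eventually_gt_atTop 0] with n hn ω
  rw [score_sub_meanInfl_eq hn, sum_range_sum_range_eq, mul_add, mul_add]

end Score

/-! ### Consistency of the standard errors -/

section Direction

variable {d : ℕ} {μ : Measure ℝ} {K : ℝ → ℝ} {R : ℝ → Fin d → ℝ} {x : ℝ} {h : ℕ → ℝ} {B lam : ℝ}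

/-- The vector `Γ_h⁻¹ c`. -/
def popDir (μ : Measure ℝ) (K : ℝ → ℝ) (R : ℝ → Fin d → ℝ) (x h : ℝ) (c : Fin d → ℝ) :
    Fin d → ℝ :=
  (popGam μ K R x h)⁻¹ *ᵥ c

/-- The linear combination of the influence functions with coefficients `v`. -/
def proj (μ : Measure ℝ) (K : ℝ → ℝ) (R : ℝ → Fin d → ℝ) (x h : ℝ) (v : Fin d → ℝ) (y : ℝ) : ℝ :=
  ∑ k, v k * infl μ K R x h k y

/-- The variance `c' Γ_h⁻¹ Σ_h Γ_h⁻¹ c`. -/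
def popVar (μ : Measure ℝ) (K : ℝ → ℝ) (R : ℝ → Fin d → ℝ) (x h : ℝ) (c : Fin d → ℝ) : ℝ :=
  sandwich (popGam μ K R x h) (popSig μ K R x h) c

/-- The standardized influence function in the direction `Γ_h⁻¹ c`. -/
def stdInfl (μ : Measure ℝ) (K : ℝ → ℝ) (R : ℝ → Fin d → ℝ) (x h : ℝ) (c : Fin d → ℝ)
    (y : ℝ) : ℝ :=
  (proj μ K R x h (popDir μ K R x h c) y - ∫ t, proj μ K R x h (popDir μ K R x h c) t ∂μ) /
    √(popVar μ K R x h c)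

lemma popVar_eq (h : ℝ) (c : Fin d → ℝ) : popVar μ K R x h c =
    popDir μ K R x h c ⬝ᵥ (popSig μ K R x h *ᵥ popDir μ K R x h c) :=
  sandwich_eq (popGam_transpose μ K R x h) _ c

variable [IsProbabilityMeasure μ]

lemma measurable_proj (hK : IsKernel K) (hR : IsBasis R) (h : ℝ) (v : Fin d → ℝ) :
    Measurable (proj μ K R x h v) :=
  Finset.measurable_fun_sum _ fun k _ => (measurable_infl hK hR h k).const_mul _

lemma measurable_stdInfl (hK : IsKernel K) (hR : IsBasis R) (h : ℝ) (c : Fin d → ℝ) :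
    Measurable (stdInfl μ K R x h c) :=
  ((measurable_proj hK hR h _).sub_const _).div_const _

lemma UniformBounds.abs_proj_le {h : ℝ} (hB : UniformBounds μ K R x h B) (hK : IsKernel K)
    (hR : IsBasis R) (v : Fin d → ℝ) (y : ℝ) : |proj μ K R x h v y| ≤ d * ‖v‖ * B := by
  refine (Finset.abs_sum_le_sum_abs _ _).trans ?_
  calc ∑ k, |v k * infl μ K R x h k y| ≤ ∑ _k : Fin d, ‖v‖ * B := by
        refine Finset.sum_le_sum fun k _ => ?_
        rw [abs_mul]
        exact mul_le_mul (norm_le_pi_norm v k) (hB.abs_infl_le hK hR k y) (abs_nonneg _)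
          (norm_nonneg _)
    _ = d * ‖v‖ * B := by simp [mul_assoc]

lemma UniformBounds.quadratic_popSig {h : ℝ} (hB : UniformBounds μ K R x h B) (hK : IsKernel K)
    (hR : IsBasis R) (v : Fin d → ℝ) :
    v ⬝ᵥ (popSig μ K R x h *ᵥ v) =
      ∫ y, (proj μ K R x h v y - ∫ t, proj μ K R x h v t ∂μ) ^ 2 ∂μ := by
  rw [integral_sub_integral_sq (measurable_proj hK hR h v) (hB.abs_proj_le hK hR v)]
  have i1 : ∀ k, Integrable (infl μ K R x h k) μ := fun k =>
    integrable_of_abs_le (measurable_infl hK hR h k) (hB.abs_infl_le hK hR k)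
  have i2 : ∀ k l, Integrable (fun y => infl μ K R x h k y * infl μ K R x h l y) μ := fun k l =>
    integrable_of_abs_le ((measurable_infl hK hR h k).mul (measurable_infl hK hR h l))
      (M := B * B) fun y => by
        rw [abs_mul]
        exact mul_le_mul (hB.abs_infl_le hK hR k y) (hB.abs_infl_le hK hR l y) (abs_nonneg _)
          ((abs_nonneg _).trans (hB.abs_infl_le hK hR k y))
  have e1 : ∫ t, proj μ K R x h v t ∂μ = ∑ k, v k * ∫ t, infl μ K R x h k t ∂μ := by
    simp only [proj]
    rw [integral_finsetSum _ fun k _ => (i1 k).const_mul _]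
    simp_rw [integral_const_mul]
  have e2 : ∫ t, proj μ K R x h v t ^ 2 ∂μ =
      ∑ k, ∑ l, v k * v l * ∫ t, infl μ K R x h k t * infl μ K R x h l t ∂μ := by
    have : ∀ t, proj μ K R x h v t ^ 2 =
        ∑ k, ∑ l, v k * v l * (infl μ K R x h k t * infl μ K R x h l t) := fun t => by
      rw [proj, sq, Finset.sum_mul_sum]
      refine Finset.sum_congr rfl fun k _ => Finset.sum_congr rfl fun l _ => ?_
      ring
    simp_rw [this]
    rw [integral_finsetSum _ fun k _ => integrable_finsetSum _ fun l _ => (i2 k l).const_mul _]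
    refine Finset.sum_congr rfl fun k _ => ?_
    rw [integral_finsetSum _ fun l _ => (i2 k l).const_mul _]
    simp_rw [integral_const_mul]
  rw [e1, e2, sq, Finset.sum_mul_sum, ← Finset.sum_sub_distrib]
  simp only [dotProduct, mulVec, popSig, of_apply, Finset.mul_sum]
  refine Finset.sum_congr rfl fun k _ => ?_
  rw [← Finset.sum_sub_distrib]
  refine Finset.sum_congr rfl fun l _ => ?_
  ring

omit [IsProbabilityMeasure μ] in
lemma UniformBounds.entrySum_popGam_le {h : ℝ} (hB : UniformBounds μ K R x h B) :
    entrySum (popGam μ K R x h) ≤ d * d * B := by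
  calc entrySum (popGam μ K R x h) ≤ ∑ _k : Fin d, ∑ _l : Fin d, B := by
        refine Finset.sum_le_sum fun k _ => Finset.sum_le_sum fun l _ => ?_
        exact (abs_integral_le_integral_abs).trans (hB.integral_abs_gram_le k l)
    _ = d * d * B := by simp [mul_assoc]

variable {c : ℕ → Fin d → ℝ}

omit [IsProbabilityMeasure μ] in
lemma Design.norm_popDir_le (D : Design μ K R x h B lam) (hc : ∀ n, ‖c n‖ = 1) :
    ∀ᶠ n in atTop, ‖popDir μ K R x (h n) (c n)‖ ≤ d / lam := by
  filter_upwards [D.coercive_gam] with n hn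
  have := hn.norm_le D.lam_pos (popDir μ K R x (h n) (c n))
  rwa [popDir, hn.mulVec_inv D.lam_pos, hc, mul_one] at this

omit [IsProbabilityMeasure μ] in
-- Since $1=\|c\|=\|\Gamma_hv\|\le d^2B\|v\|$ for $v=\Gamma_h^{-1}c$, the direction cannot be short,
-- and coercivity of $\Sigma_h$ at scale $h$ gives a variance of order at least $h$.
lemma Design.exists_le_popVar (D : Design μ K R x h B lam) (hc : ∀ n, ‖c n‖ = 1) :
    ∃ κ, 0 < κ ∧ ∀ᶠ n in atTop, κ * h n ≤ popVar μ K R x (h n) (c n) := by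
  have hB0 : 0 < B := one_pos.trans_le D.one_le
  have hd : 0 < (d : ℝ) := by
    -- A vector of norm one excludes dimension zero.
    rcases d.eq_zero_or_pos with rfl | hd
    · have h1 := hc 0
      rw [Subsingleton.elim (c 0) 0, norm_zero] at h1
      exact absurd h1 zero_ne_one
    · exact_mod_cast hd
  have hl := D.lam_pos
  refine ⟨lam * (1 / (d * d * B)) ^ 2, by positivity, ?_⟩
  filter_upwards [D.coercive_gam, D.coercive_sig, D.bounds] with n h1 h2 h3
  have hp := D.pos n
  set v := popDir μ K R x (h n) (c n) with hv
  have e1 : 1 ≤ d * d * B * ‖v‖ := by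
    have e := norm_mulVec_le (popGam μ K R x (h n)) v
    rw [hv, popDir, h1.mulVec_inv D.lam_pos, hc] at e
    exact e.trans (mul_le_mul_of_nonneg_right h3.entrySum_popGam_le (norm_nonneg _))
  have e2 : 1 / (d * d * B) ≤ ‖v‖ := by
    rw [div_le_iff₀ (by positivity)]; linarith
  rw [popVar_eq]
  refine le_trans ?_ (h2 v)
  have e3 : (1 / (d * d * B)) ^ 2 ≤ v ⬝ᵥ v :=
    (pow_le_pow_left₀ (by positivity) e2 2).trans (norm_sq_le_dotProduct v)
  calc lam * (1 / (d * d * B)) ^ 2 * h n = lam * h n * (1 / (d * d * B)) ^ 2 := by ring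
    _ ≤ lam * h n * (v ⬝ᵥ v) := mul_le_mul_of_nonneg_left e3 (by positivity)

/-- The numerator is bounded uniformly in the bandwidth, while the standard deviation is at least
$\sqrt{\kappa h}$. -/
lemma Design.stdInfl_bounds (D : Design μ K R x h B lam) (hc : ∀ n, ‖c n‖ = 1) :
    (∃ C, 0 ≤ C ∧ ∀ᶠ n in atTop, ∀ y, |stdInfl μ K R x (h n) (c n) y| ≤ C / √(h n)) ∧
    (∀ᶠ n in atTop, ∫ y, stdInfl μ K R x (h n) (c n) y ∂μ = 0) ∧
    ∀ᶠ n in atTop, ∫ y, stdInfl μ K R x (h n) (c n) y ^ 2 ∂μ = 1 := by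
  have hB0 : 0 < B := one_pos.trans_le D.one_le
  have hl := D.lam_pos
  obtain ⟨κ, hκ, hvar⟩ := D.exists_le_popVar hc
  refine ⟨⟨2 * (d * (d / lam) * B) / √κ, by positivity, ?_⟩, ?_, ?_⟩
  · filter_upwards [hvar, D.bounds, D.norm_popDir_le hc] with n h1 h2 h3 y
    have hp := D.pos n
    have e1 : ∀ t, |proj μ K R x (h n) (popDir μ K R x (h n) (c n)) t| ≤ d * (d / lam) * B :=
      fun t => (h2.abs_proj_le D.kernel D.basis _ t).trans (by gcongr)
    have e2 := abs_integral_le_of_abs_le (μ := μ) e1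
    have e3 := (abs_sub (proj μ K R x (h n) (popDir μ K R x (h n) (c n)) y)
      (∫ t, proj μ K R x (h n) (popDir μ K R x (h n) (c n)) t ∂μ)).trans (add_le_add (e1 y) e2)
    rw [stdInfl, abs_div, abs_of_nonneg (Real.sqrt_nonneg _), div_div, ← Real.sqrt_mul hκ.le]
    exact div_le_div₀ (by positivity) (by linarith) (Real.sqrt_pos.2 (by positivity))
      (Real.sqrt_le_sqrt h1)
  · filter_upwards [D.bounds] with n h2
    simp only [stdInfl]
    rw [integral_div, integral_sub (integrable_of_abs_le (measurable_proj D.kernel D.basis _ _)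
      (h2.abs_proj_le D.kernel D.basis _)) (integrable_const _)]
    simp
  · filter_upwards [D.bounds, hvar] with n h2 h1
    have hp := D.pos n
    have hpos : 0 < popVar μ K R x (h n) (c n) := lt_of_lt_of_le (by positivity) h1
    simp only [stdInfl, div_pow]
    rw [integral_div, ← h2.quadratic_popSig D.kernel D.basis, ← popVar_eq, Real.sq_sqrt hpos.le,
      div_self hpos.ne']

variable {Ω : Type*} [MeasurableSpace Ω] {P : Measure Ω} [IsProbabilityMeasure P]
  {X : ℕ → Ω → ℝ} {υ : ℝ → Fin d → ℝ}

lemma Design.isBigOP_mean_stdInfl (D : Design μ K R x h B lam) (S : IsSample P μ X)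
    (hc : ∀ n, ‖c n‖ = 1) :
    IsBigOP P (fun n ω => 1 / (n : ℝ) * ∑ i ∈ Finset.range n, stdInfl μ K R x (h n) (c n) (X i ω))
      (fun n => 1 / √(n : ℝ)) := by
  obtain ⟨⟨C, hC0, hC⟩, h0, h1⟩ := D.stdInfl_bounds hc
  have key := isBigOP_mean_sub S.meas S.indep S.law
    (fun n => measurable_stdInfl D.kernel D.basis (h n) (c n)) (hC.mono fun n hn => ⟨_, hn⟩)
    (a := fun n => 1 / √(n : ℝ)) ?_ 1 ?_
  · refine key.mono_left (HighProb.of_eventually ?_)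
    filter_upwards [h0] with n hn ω
    rw [hn, sub_zero]
  · filter_upwards [eventually_gt_atTop 0] with n hn
    have hn0 : (0 : ℝ) < n := by exact_mod_cast hn
    positivity
  · filter_upwards [h1, eventually_gt_atTop 0] with n hn h2
    have hn0 : (0 : ℝ) < n := by exact_mod_cast h2
    rw [hn, div_pow, Real.sq_sqrt hn0.le]
    field_simp
    exact le_rfl

/-- For the standardized $\psi$ one has $\int\psi^4\le(C^2/h)\int\psi^2=C^2/h$, so the mean of
$\psi^2$ deviates from one by $O_P(1/\sqrt{nh})$; the squared mean of $\psi$ is only $O_P(1/n)$. -/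
lemma Design.isBigOP_sampleVar_proj (D : Design μ K R x h B lam) (S : IsSample P μ X)
    (hc : ∀ n, ‖c n‖ = 1) :
    IsBigOP P (fun n ω => sampleVar n (fun i =>
      proj μ K R x (h n) (popDir μ K R x (h n) (c n)) (X i ω)) / popVar μ K R x (h n) (c n) - 1)
      (rate h) := by
  obtain ⟨κ, hκ, hvar⟩ := D.exists_le_popVar hc
  obtain ⟨⟨C, hC0, hC⟩, h0, h1⟩ := D.stdInfl_bounds hc
  have hm := fun n => measurable_stdInfl (μ := μ) (x := x) D.kernel D.basis (h n) (c n)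
  have k1 := isBigOP_mean_sub S.meas S.indep S.law
    (g := fun n y => stdInfl μ K R x (h n) (c n) y ^ 2) (fun n => (hm n).pow_const 2)
    (hC.mono fun n hn => ⟨(C / √(h n)) ^ 2, fun y => by
      rw [abs_pow]; exact pow_le_pow_left₀ (abs_nonneg _) (hn y) 2⟩)
    (a := rate h) D.rate_pos (C ^ 2) ?_
  · have k2 := (D.isBigOP_mean_stdInfl S hc).mul (D.isBigOP_mean_stdInfl S hc)
    have k3 := k2.const_scale (a := rate h) (C := 1) ?_
    · refine (k1.abs.add k3.abs).mono_left (HighProb.of_eventually ?_)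
      filter_upwards [h1, hvar, eventually_gt_atTop 0] with n e1 e2 hn ω
      have hp := D.pos n
      have hpos : 0 < popVar μ K R x (h n) (c n) := lt_of_lt_of_le (by positivity) e2
      have hs := Real.sq_sqrt hpos.le
      have hs0 := Real.sqrt_pos.2 hpos
      rw [sampleVar_eq hn _ (∫ t, proj μ K R x (h n) (popDir μ K R x (h n) (c n)) t ∂μ), e1]
      have e3 : (1 / (n : ℝ) * ∑ i ∈ Finset.range n,
          (proj μ K R x (h n) (popDir μ K R x (h n) (c n)) (X i ω) -
            ∫ t, proj μ K R x (h n) (popDir μ K R x (h n) (c n)) t ∂μ) ^ 2 -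
          (1 / (n : ℝ) * ∑ i ∈ Finset.range n,
          (proj μ K R x (h n) (popDir μ K R x (h n) (c n)) (X i ω) -
            ∫ t, proj μ K R x (h n) (popDir μ K R x (h n) (c n)) t ∂μ)) ^ 2) /
            popVar μ K R x (h n) (c n) =
          1 / (n : ℝ) * ∑ i ∈ Finset.range n, stdInfl μ K R x (h n) (c n) (X i ω) ^ 2 -
          (1 / (n : ℝ) * ∑ i ∈ Finset.range n, stdInfl μ K R x (h n) (c n) (X i ω)) ^ 2 := by
        simp only [stdInfl, div_pow, ← Finset.sum_div]
        rw [hs]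
        simp only [mul_pow, div_pow, hs]
        ring
      rw [e3]
      refine le_trans ?_ (le_abs_self _)
      rw [sub_right_comm, ← sq]
      exact abs_sub _ _
    · filter_upwards [D.eventually_le_one, eventually_gt_atTop 0] with n hn hn'
      have hn0 : (0 : ℝ) < n := by exact_mod_cast hn'
      have hp := D.pos n
      have h1n : (1 : ℝ) ≤ n := by exact_mod_cast hn'
      rw [one_mul, abs_of_nonneg (rate_nonneg h n), abs_of_nonneg (by positivity),
        div_mul_div_comm, one_mul, Real.mul_self_sqrt hn0.le, rate]
      refine Real.le_sqrt_of_sq_le ?_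
      rw [div_pow, one_pow]
      refine one_div_le_one_div_of_le (by positivity) ?_
      nlinarith
  · filter_upwards [hC, h1, eventually_gt_atTop 0] with n e1 e2 hn
    have hn0 : (0 : ℝ) < n := by exact_mod_cast hn
    have hp := D.pos n
    have e3 : C ^ 2 * rate h n ^ 2 * n = (C / √(h n)) ^ 2 := by
      rw [D.rate_sq, div_pow, Real.sq_sqrt hp.le]; field_simp
    rw [e3]
    have i2 : Integrable (fun y => stdInfl μ K R x (h n) (c n) y ^ 2) μ :=
      integrable_of_abs_le ((hm n).pow_const 2) (M := (C / √(h n)) ^ 2) fun y => by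
        rw [abs_pow]; exact pow_le_pow_left₀ (abs_nonneg _) (e1 y) 2
    calc ∫ y, (stdInfl μ K R x (h n) (c n) y ^ 2) ^ 2 ∂μ
        ≤ ∫ y, (C / √(h n)) ^ 2 * stdInfl μ K R x (h n) (c n) y ^ 2 ∂μ := by
          refine integral_mono_of_nonneg (Eventually.of_forall fun _ => sq_nonneg _)
            (i2.const_mul _) (Eventually.of_forall fun y => ?_)
          simp only
          rw [sq (stdInfl μ K R x (h n) (c n) y ^ 2)]
          refine mul_le_mul_of_nonneg_right ?_ (sq_nonneg _)
          rw [← sq_abs]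
          exact pow_le_pow_left₀ (abs_nonneg _) (e1 y) 2
      _ = (C / √(h n)) ^ 2 := by rw [integral_const_mul, e2, mul_one]

/-- The vector `Γ̂_h⁻¹ c`. -/
def hatDir (K : ℝ → ℝ) (R : ℝ → Fin d → ℝ) (υ : ℝ → Fin d → ℝ) (x h : ℝ) (n : ℕ) (z : ℕ → ℝ)
    (c : Fin d → ℝ) : Fin d → ℝ :=
  (GamHat K R υ x h n z)⁻¹ *ᵥ c

/-- The estimate of `c' Γ_h⁻¹ Σ_h Γ_h⁻¹ c`. -/
def hatVar (K : ℝ → ℝ) (R : ℝ → Fin d → ℝ) (υ : ℝ → Fin d → ℝ) (x h : ℝ) (n : ℕ) (z : ℕ → ℝ)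
    (c : Fin d → ℝ) : ℝ :=
  sandwich (GamHat K R υ x h n z) (SigHat K R υ x h n z) c

lemma hatVar_eq (hυ : IsScaling R υ) {b : ℝ} (h0 : 0 < b) (n : ℕ) (z : ℕ → ℝ) (c : Fin d → ℝ) :
    hatVar K R υ x b n z c = sampleVar n fun i =>
      ∑ k, hatDir K R υ x b n z c k * upperHat n z (fun y => wbasis K R x b y k) i := by
  rw [hatVar, sandwich_eq (GamHat_transpose hυ h0 n z), quadratic_SigHat hυ h0]
  rfl

omit [IsProbabilityMeasure μ] [IsProbabilityMeasure P] in
lemma Design.highProb_coercive (D : Design μ K R x h B lam)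
    (hΓ : IsBigOP P (fun n ω => entrySum (GamHat K R υ x (h n) n (fun i => X i ω) -
      popGam μ K R x (h n))) (rate h)) :
    HighProb P fun n ω => Coercive (GamHat K R υ x (h n) n fun i => X i ω) (lam / 2) := by
  have h1 := hΓ.highProb_lt D.tendsto_rate (half_pos D.lam_pos)
  refine h1.mono ?_
  filter_upwards [D.coercive_gam] with n hn ω hω
  exact hn.of_entrySum_sub_le ((le_abs_self _).trans hω.le)

omit [IsProbabilityMeasure μ] [MeasurableSpace Ω] in
lemma Design.norm_hatDir_sub_le (D : Design μ K R x h B lam) (hc : ∀ n, ‖c n‖ = 1) :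
    ∀ᶠ n in atTop, ∀ ω, Coercive (GamHat K R υ x (h n) n fun i => X i ω) (lam / 2) →
      ‖hatDir K R υ x (h n) n (fun i => X i ω) (c n) - popDir μ K R x (h n) (c n)‖ ≤
        2 * d / lam * (d / lam) * entrySum (GamHat K R υ x (h n) n (fun i => X i ω) -
          popGam μ K R x (h n)) := by
  filter_upwards [D.coercive_gam, D.norm_popDir_le hc] with n h1 h2 ω h3
  have hl := D.lam_pos
  have := entrySum_nonneg (GamHat K R υ x (h n) n (fun i => X i ω) - popGam μ K R x (h n))
  refine (h1.norm_inv_sub_le h3 D.lam_pos (c n)).trans ?_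
  calc _ ≤ 2 * d / lam * entrySum (GamHat K R υ x (h n) n (fun i => X i ω) -
          popGam μ K R x (h n)) * (d / lam) :=
        mul_le_mul_of_nonneg_left h2 (by positivity)
    _ = _ := by ring

/-- Uses $w'\hat\varphi-v'\varphi=(w-v)'\hat\varphi+v'(\hat\varphi-\varphi)$, which separates the
error in the direction from the error in the influence function. -/
lemma mean_sq_sub_le {n : ℕ} (z : ℕ → ℝ) (r φ : Fin d → ℝ → ℝ) (v w : Fin d → ℝ) :
    1 / (n : ℝ) * ∑ i ∈ Finset.range n,
      (∑ k, w k * upperHat n z (r k) i - ∑ k, v k * φ k (z i)) ^ 2 ≤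
    2 * (‖w - v‖ * ∑ k, 1 / (n : ℝ) * ∑ j ∈ Finset.range n, |r k (z j)|) ^ 2 +
      2 * ‖v‖ ^ 2 * (d * ∑ k, 1 / (n : ℝ) * ∑ i ∈ Finset.range n,
        (upperHat n z (r k) i - φ k (z i)) ^ 2) := by
  rcases n.eq_zero_or_pos with rfl | hn
  · simp
  have hn0 : (0 : ℝ) < n := by exact_mod_cast hn
  set M := ∑ k, 1 / (n : ℝ) * ∑ j ∈ Finset.range n, |r k (z j)| with hM
  have hu : ∀ i k, |upperHat n z (r k) i| ≤ 1 / (n : ℝ) * ∑ j ∈ Finset.range n, |r k (z j)| := by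
    intro i k
    rw [upperHat, abs_mul, abs_of_pos (by positivity : (0 : ℝ) < 1 / n)]
    refine mul_le_mul_of_nonneg_left ?_ (by positivity)
    exact (Finset.abs_sum_le_sum_abs _ _).trans (Finset.sum_le_sum fun j _ =>
      abs_mul_indLe_le _ _ _)
  have hpt : ∀ i, (∑ k, w k * upperHat n z (r k) i - ∑ k, v k * φ k (z i)) ^ 2 ≤
      2 * (‖w - v‖ * M) ^ 2 +
        2 * ‖v‖ ^ 2 * (d * ∑ k, (upperHat n z (r k) i - φ k (z i)) ^ 2) := by
    intro i
    have e1 : ∑ k, w k * upperHat n z (r k) i - ∑ k, v k * φ k (z i) =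
        ∑ k, (w - v) k * upperHat n z (r k) i +
          ∑ k, v k * (upperHat n z (r k) i - φ k (z i)) := by
      rw [← Finset.sum_sub_distrib, ← Finset.sum_add_distrib]
      refine Finset.sum_congr rfl fun k _ => ?_
      rw [Pi.sub_apply]; ring
    have e2 : |∑ k, (w - v) k * upperHat n z (r k) i| ≤ ‖w - v‖ * M := by
      rw [hM, Finset.mul_sum]
      refine (Finset.abs_sum_le_sum_abs _ _).trans (Finset.sum_le_sum fun k _ => ?_)
      rw [abs_mul]
      exact mul_le_mul (norm_le_pi_norm (w - v) k) (hu i k) (abs_nonneg _) (norm_nonneg _)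
    have e3 : (∑ k, v k * (upperHat n z (r k) i - φ k (z i))) ^ 2 ≤
        ‖v‖ ^ 2 * (d * ∑ k, (upperHat n z (r k) i - φ k (z i)) ^ 2) := by
      have f1 := Finset.sum_mul_sq_le_sq_mul_sq Finset.univ v
        (fun k => upperHat n z (r k) i - φ k (z i))
      have f2 : ∑ k, v k ^ 2 ≤ ‖v‖ ^ 2 * d := by
        calc ∑ k, v k ^ 2 ≤ ∑ _k : Fin d, ‖v‖ ^ 2 := by
              refine Finset.sum_le_sum fun k _ => ?_
              rw [← sq_abs]
              exact pow_le_pow_left₀ (abs_nonneg _) (norm_le_pi_norm v k) 2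
          _ = ‖v‖ ^ 2 * d := by simp [mul_comm]
      refine f1.trans ?_
      rw [← mul_assoc]
      exact mul_le_mul_of_nonneg_right f2 (Finset.sum_nonneg fun _ _ => sq_nonneg _)
    have e4 := pow_le_pow_left₀ (abs_nonneg _) e2 2
    rw [sq_abs] at e4
    rw [e1]
    nlinarith [sq_nonneg (∑ k, (w - v) k * upperHat n z (r k) i -
      ∑ k, v k * (upperHat n z (r k) i - φ k (z i)))]
  refine (mul_le_mul_of_nonneg_left (Finset.sum_le_sum fun i _ => hpt i)
    (by positivity)).trans (le_of_eq ?_)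
  rw [Finset.sum_add_distrib, ← Finset.mul_sum, ← Finset.mul_sum, ← Finset.mul_sum,
    Finset.sum_comm, ← Finset.mul_sum]
  simp only [Finset.sum_const, Finset.card_range, nsmul_eq_mul]
  field_simp

lemma mean_sq_sub_le_of_norm_le {n : ℕ} (z : ℕ → ℝ) (r φ : Fin d → ℝ → ℝ) {v w : Fin d → ℝ}
    {a b : ℝ} (ha : ‖w - v‖ ≤ a) (hb : ‖v‖ ≤ b) :
    1 / (n : ℝ) * ∑ i ∈ Finset.range n,
      (∑ k, w k * upperHat n z (r k) i - ∑ k, v k * φ k (z i)) ^ 2 ≤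
    2 * (a * ∑ k, 1 / (n : ℝ) * ∑ j ∈ Finset.range n, |r k (z j)|) ^ 2 +
      2 * b ^ 2 * (d * ∑ k, 1 / (n : ℝ) * ∑ i ∈ Finset.range n,
        (upperHat n z (r k) i - φ k (z i)) ^ 2) := by
  have hM0 : 0 ≤ ∑ k, 1 / (n : ℝ) * ∑ j ∈ Finset.range n, |r k (z j)| :=
    Finset.sum_nonneg fun _ _ => mul_nonneg (by positivity)
      (Finset.sum_nonneg fun _ _ => abs_nonneg _)
  have hQ0 : 0 ≤ ∑ k, 1 / (n : ℝ) * ∑ i ∈ Finset.range n,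
      (upperHat n z (r k) i - φ k (z i)) ^ 2 :=
    Finset.sum_nonneg fun _ _ => mul_nonneg (by positivity)
      (Finset.sum_nonneg fun _ _ => sq_nonneg _)
  refine (mean_sq_sub_le z r φ v w).trans ?_
  gcongr

lemma sqrt_one_add_abs_le (t : ℝ) : √(1 + t) ≤ 1 + |t| := by
  rw [Real.sqrt_le_left (by positivity)]
  nlinarith [abs_nonneg t, le_abs_self t]

/-- Purely deterministic: $\sqrt{b/V}\le1+|b/V-1|$ controls the cross term once the difference has
been divided by $V$. -/
lemma abs_div_sub_one_le {A b E V w : ℝ} (hb : 0 ≤ b) (hE : 0 ≤ E) (hw : 0 < w) (hwV : w ≤ V)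
    (hd : |A - b| ≤ E + 2 * (√b * √E)) :
    |A / V - 1| ≤ |b / V - 1| + 1 / w * E + 2 * ((1 + |b / V - 1|) * √(1 / w * E)) := by
  have hV : 0 < V := hw.trans_le hwV
  have hEW : E / V ≤ 1 / w * E := by
    rw [div_eq_mul_one_div, mul_comm]
    exact mul_le_mul_of_nonneg_right (one_div_le_one_div_of_le hw hwV) hE
  have hsq : √b * √E / V ≤ (1 + |b / V - 1|) * √(1 / w * E) := by
    have f1 : √b * √E / V = √(b / V) * √(E / V) := by
      rw [Real.sqrt_div hb, Real.sqrt_div hE, div_mul_div_comm, Real.mul_self_sqrt hV.le]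
    have f2 : √(b / V) ≤ 1 + |b / V - 1| := by
      have := sqrt_one_add_abs_le (b / V - 1)
      rwa [add_sub_cancel] at this
    rw [f1]
    exact mul_le_mul f2 (Real.sqrt_le_sqrt hEW) (Real.sqrt_nonneg _) (by positivity)
  have f3 : A / V - 1 = (b / V - 1) + (A - b) / V := by field_simp; ring
  have f4 : |(A - b) / V| ≤ 1 / w * E + 2 * ((1 + |b / V - 1|) * √(1 / w * E)) := by
    rw [abs_div, abs_of_pos hV]
    calc _ ≤ (E + 2 * (√b * √E)) / V := div_le_div_of_nonneg_right hd hV.le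
      _ = E / V + 2 * (√b * √E / V) := by ring
      _ ≤ _ := add_le_add hEW (mul_le_mul_of_nonneg_left hsq two_pos.le)
  rw [f3]
  refine (abs_add_le _ _).trans ?_
  linarith

theorem Design.isBigOP_hatVar_of_norm (D : Design μ K R x h B lam) (S : IsSample P μ X)
    (hυ : IsScaling R υ) (hc : ∀ n, ‖c n‖ = 1) :
    IsBigOP P (fun n ω => hatVar K R υ x (h n) n (fun i => X i ω) (c n) /
      popVar μ K R x (h n) (c n) - 1) (slowRate h) := by
  obtain ⟨κ, hκ, hvar⟩ := D.exists_le_popVar hc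
  have hl := D.lam_pos
  have hΓ := D.isBigOP_gamHat S hυ
  have hT := D.isBigOP_sampleVar_proj S hc
  set C := 2 * d / lam * (d / lam) with hC
  set η : ℕ → Ω → ℝ := fun n ω => entrySum (GamHat K R υ x (h n) n (fun i => X i ω) -
    popGam μ K R x (h n)) with hη
  set M : ℕ → Ω → ℝ := fun n ω => ∑ k, 1 / (n : ℝ) * ∑ j ∈ Finset.range n,
    |wbasis K R x (h n) (X j ω) k| with hM
  set Q : ℕ → Ω → ℝ := fun n ω => ∑ k, 1 / (n : ℝ) * ∑ i ∈ Finset.range n,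
      (upperHat n (fun j => X j ω) (fun y => wbasis K R x (h n) y k) i -
        infl μ K R x (h n) k (X i ω)) ^ 2 with hQ
  set T : ℕ → Ω → ℝ := fun n ω => sampleVar n (fun i =>
      proj μ K R x (h n) (popDir μ K R x (h n) (c n)) (X i ω)) / popVar μ K R x (h n) (c n) - 1
    with hTdef
  have hMO : IsBigOP P M fun _ => 1 := IsBigOP.finset_sum _ fun k => D.isBigOP_mean_abs_wbasis S k
  have hQO : IsBigOP P Q fun n => rate h n ^ 2 :=
    IsBigOP.finset_sum _ fun k => D.isBigOP_upperHat_sub S k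
  have hconst : ∀ a : ℝ, IsBigOP P (fun _ _ => a) fun _ => 1 := fun a =>
    isBigOP_of_eventually_le |a| (by simp)
  set E : ℕ → Ω → ℝ := fun n ω => 2 * C ^ 2 * ((η n ω * M n ω) * (η n ω * M n ω)) +
    2 * (d / lam) ^ 2 * d * Q n ω with hE
  have hEO : IsBigOP P E fun n => rate h n ^ 2 := by
    refine IsBigOP.add ?_ ?_
    · exact ((hconst _).mul ((hΓ.mul hMO).mul (hΓ.mul hMO))).const_scale (C := 1)
        (Eventually.of_forall fun n => le_of_eq (by ring_nf))
    · exact ((hconst _).mul hQO).const_scale (C := 1)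
        (Eventually.of_forall fun n => le_of_eq (by ring_nf))
  -- Dividing the mean square error, of order $1/(nh)$, by the lower bound $\kappa h$ of the
  -- variance produces $1/(nh^2)$; the square root of this is the rate of the theorem.
  set W : ℕ → Ω → ℝ := fun n ω => 1 / (κ * h n) * E n ω with hW
  have hWO : IsBigOP P W fun n => slowRate h n ^ 2 := by
    have h1 : IsBigOP P W fun n => 1 / (κ * h n) * rate h n ^ 2 :=
      (isBigOP_of_eventually_le 1 (by simp)).mul hEO
    refine h1.const_scale (C := 1 / κ) (Eventually.of_forall fun n => le_of_eq ?_)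
    have hp := D.pos n
    rw [D.rate_sq, slowRate_sq, abs_of_nonneg (by positivity), abs_of_nonneg (by positivity)]
    rcases n.eq_zero_or_pos with hn | hn
    · simp [hn]
    · field_simp
  have hWs := hWO.sqrt
  have hslow1 : ∀ᶠ n in atTop, slowRate h n ≤ 1 :=
    D.tendsto_slowRate.eventually (ge_mem_nhds one_pos)
  have hTO : IsBigOP P T (slowRate h) := hT.const_scale (C := 1) (by
    filter_upwards [D.rate_le] with n hn
    rwa [one_mul, abs_of_nonneg (rate_nonneg h n), abs_of_nonneg (slowRate_nonneg h n)])
  have hT1 : IsBigOP P T fun _ => 1 := hTO.const_scale (C := 1) (by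
    filter_upwards [hslow1] with n hn
    rwa [one_mul, abs_one, abs_of_nonneg (slowRate_nonneg h n)])
  have hfinal : IsBigOP P (fun n ω => |T n ω| + W n ω + 2 * ((1 + |T n ω|) * √(W n ω)))
      (slowRate h) := by
    refine (hTO.abs.add (hWO.const_scale (C := 1) ?_)).add ?_
    · filter_upwards [hslow1] with n hn
      have := slowRate_nonneg h n
      rw [one_mul, abs_of_nonneg (sq_nonneg _), abs_of_nonneg this]
      nlinarith
    · exact ((hconst 2).mul (((hconst 1).add hT1.abs).mul hWs)).const_scale (C := 1)
        (Eventually.of_forall fun n => le_of_eq (by ring_nf))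
  refine hfinal.mono_left ((D.highProb_coercive hΓ).mono ?_)
  filter_upwards [hvar, D.norm_hatDir_sub_le (X := X) (υ := υ) hc, D.norm_popDir_le hc,
    eventually_gt_atTop 0] with n e1 e2 e3 hn ω hω
  have hp := D.pos n
  have hEb := mean_sq_sub_le_of_norm_le (n := n) (fun i => X i ω)
    (fun k y => wbasis K R x (h n) y k) (fun k => infl μ K R x (h n) k) (e2 ω hω) e3
  have hE0 : 0 ≤ 1 / (n : ℝ) * ∑ i ∈ Finset.range n,
      (∑ k, hatDir K R υ x (h n) n (fun i => X i ω) (c n) k *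
        upperHat n (fun i => X i ω) (fun y => wbasis K R x (h n) y k) i -
        ∑ k, popDir μ K R x (h n) (c n) k * infl μ K R x (h n) k (X i ω)) ^ 2 :=
    mul_nonneg (by positivity) (Finset.sum_nonneg fun _ _ => sq_nonneg _)
  have hdiff := abs_sampleVar_sub_le hn _ _ hEb
  rw [← hatVar_eq hυ hp] at hdiff
  have key := abs_div_sub_one_le (sampleVar_nonneg _ _) (hE0.trans hEb) (by positivity) e1 hdiff
  refine le_trans ?_ (le_abs_self _)
  have hEe : E n ω = 2 * (C * η n ω * M n ω) ^ 2 + 2 * (d / lam) ^ 2 * (d * Q n ω) := by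
    simp only [hE]; ring
  change _ ≤ |T n ω| + 1 / (κ * h n) * E n ω +
    2 * ((1 + |T n ω|) * √(1 / (κ * h n) * E n ω))
  rw [hEe]
  exact key

end Direction

/-! ### Measurability of the sample quantities -/

section Measurability

variable {Ω : Type*} [MeasurableSpace Ω] {d : ℕ}

lemma measurable_det {A : Ω → Matrix (Fin d) (Fin d) ℝ}
    (hA : ∀ k l, Measurable fun ω => A ω k l) : Measurable fun ω => (A ω).det := by
  simp only [det_apply]
  exact Finset.measurable_fun_sum _ fun σ _ =>
    (Finset.measurable_fun_prod _ fun i _ => hA (σ i) i).const_smul (Equiv.Perm.sign σ)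

/-- The adjugate formula makes each entry a quotient of determinants, valid for singular matrices as
well because both the matrix inverse and division by zero return zero. -/
lemma measurable_inv_apply {A : Ω → Matrix (Fin d) (Fin d) ℝ}
    (hA : ∀ k l, Measurable fun ω => A ω k l) (k l : Fin d) :
    Measurable fun ω => (A ω)⁻¹ k l := by
  simp only [inv_def, Ring.inverse_eq_inv', Matrix.smul_apply, smul_eq_mul, adjugate_apply]
  refine (measurable_det hA).inv.mul (measurable_det fun i j => ?_)
  simp only [updateRow_apply]
  split_ifs
  · exact measurable_const
  · exact hA i j

lemma measurable_sandwich {G S : Ω → Matrix (Fin d) (Fin d) ℝ}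
    (hG : ∀ k l, Measurable fun ω => G ω k l) (hS : ∀ k l, Measurable fun ω => S ω k l)
    (c : Fin d → ℝ) : Measurable fun ω => sandwich (G ω) (S ω) c := by
  have hi := measurable_inv_apply hG
  simp only [sandwich, dotProduct, mulVec, Matrix.mul_apply]
  refine Finset.measurable_fun_sum _ fun i _ => measurable_const.mul
    (Finset.measurable_fun_sum _ fun j _ => Measurable.mul_const ?_ _)
  exact Finset.measurable_fun_sum _ fun k _ =>
    (Finset.measurable_fun_sum _ fun l _ => (hi _ _).mul (hS _ _)).mul (hi _ _)

variable {K : ℝ → ℝ} {R : ℝ → Fin d → ℝ} {X : ℕ → Ω → ℝ}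

lemma measurable_gamHat_apply (hK : IsKernel K) (hR : IsBasis R) (hX : ∀ i, Measurable (X i))
    (υ : ℝ → Fin d → ℝ) (x h : ℝ) (n : ℕ) (k l : Fin d) :
    Measurable fun ω => GamHat K R υ x h n (fun i => X i ω) k l := by
  simp only [GamHat, Matrix.smul_apply, Matrix.sum_apply, smul_eq_mul, mul_diagonal,
    diagonal_mul, vecMulVec_apply]
  have hb : ∀ i k, Measurable fun ω => R (X i ω - x) k := fun i k =>
    (measurable_pi_apply k).comp (hR.measurable.comp ((hX i).sub_const x))
  exact (Finset.measurable_fun_sum _ fun i _ => ((measurable_weight hK).comp (hX i)).mul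
    ((((hb i k).mul (hb i l)).const_mul _).mul_const _)).const_mul _

lemma measurable_influenceHat_apply (hK : IsKernel K) (hR : IsBasis R)
    (hX : ∀ i, Measurable (X i)) (υ : ℝ → Fin d → ℝ) (x h : ℝ) (n i : ℕ) (k : Fin d) :
    Measurable fun ω => influenceHat K R υ x h n (fun i => X i ω) i k := by
  simp only [influenceHat, Pi.smul_apply, Finset.sum_apply, smul_eq_mul, mulVec_diagonal, ecdf]
  have hb : ∀ i k, Measurable fun ω => R (X i ω - x) k := fun i k =>
    (measurable_pi_apply k).comp (hR.measurable.comp ((hX i).sub_const x))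
  exact (Finset.measurable_fun_sum _ fun j _ => (((measurable_indLe (hX i) (hX j)).sub
    ((Finset.measurable_fun_sum _ fun m _ => measurable_indLe (hX m) (hX j)).const_mul _)).mul
    ((measurable_weight hK).comp (hX j))).mul ((hb j k).const_mul _)).const_mul _

lemma measurable_sigHat_apply (hK : IsKernel K) (hR : IsBasis R) (hX : ∀ i, Measurable (X i))
    (υ : ℝ → Fin d → ℝ) (x h : ℝ) (n : ℕ) (k l : Fin d) :
    Measurable fun ω => SigHat K R υ x h n (fun i => X i ω) k l := by
  simp only [SigHat, Matrix.smul_apply, Matrix.sum_apply, smul_eq_mul, vecMulVec_apply]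
  exact (Finset.measurable_fun_sum _ fun i _ =>
    (measurable_influenceHat_apply hK hR hX υ x h n i k).mul
      (measurable_influenceHat_apply hK hR hX υ x h n i l)).const_mul _

lemma measurable_stdErr (hK : IsKernel K) (hR : IsBasis R) (hX : ∀ i, Measurable (X i))
    (υ : ℝ → Fin d → ℝ) (x h : ℝ) (n : ℕ) (c : Fin d → ℝ) :
    Measurable fun ω => stdErr K R υ x h n (fun i => X i ω) c :=
  ((measurable_sandwich (measurable_gamHat_apply hK hR hX υ x h n)
    (measurable_sigHat_apply hK hR hX υ x h n) _).div_const _).sqrt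

end Measurability

/-! ### Asymptotic normality -/

lemma abs_dotProduct_le_norm_mul_sum {d : ℕ} (v w : Fin d → ℝ) :
    |v ⬝ᵥ w| ≤ ‖v‖ * ∑ k, |w k| := by
  rw [Finset.mul_sum]
  refine (Finset.abs_sum_le_sum_abs _ _).trans (Finset.sum_le_sum fun k _ => ?_)
  rw [abs_mul]
  exact mul_le_mul_of_nonneg_right (norm_le_pi_norm v k) (abs_nonneg _)

lemma abs_dotProduct_sub_dotProduct_le {d : ℕ} {v w s m : Fin d → ℝ} {a b : ℝ}
    (ha : ‖w - v‖ ≤ a) (hb : ‖v‖ ≤ b) :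
    |w ⬝ᵥ s - v ⬝ᵥ m| ≤ a * (∑ k, |m k| + ∑ k, |s k - m k|) + b * ∑ k, |s k - m k| := by
  have e1 : w ⬝ᵥ s - v ⬝ᵥ m = (w - v) ⬝ᵥ s + v ⬝ᵥ (s - m) := by
    rw [sub_dotProduct, dotProduct_sub]; ring
  have e2 : ∑ k, |s k| ≤ ∑ k, |m k| + ∑ k, |s k - m k| := by
    rw [← Finset.sum_add_distrib]
    refine Finset.sum_le_sum fun k _ => ?_
    have := abs_add_le (m k) (s k - m k)
    rwa [add_sub_cancel] at this
  rw [e1]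
  refine (abs_add_le _ _).trans (add_le_add ?_ ?_)
  · exact (abs_dotProduct_le_norm_mul_sum _ _).trans (mul_le_mul ha e2
      (Finset.sum_nonneg fun _ _ => abs_nonneg _) ((norm_nonneg _).trans ha))
  · exact (abs_dotProduct_le_norm_mul_sum _ _).trans (mul_le_mul_of_nonneg_right hb
      (Finset.sum_nonneg fun _ _ => abs_nonneg _))

lemma abs_inv_sqrt_sub_one_le {t : ℝ} (ht : |t| ≤ 1 / 2) : |(√(1 + t))⁻¹ - 1| ≤ 2 * |t| := by
  have h1 := neg_abs_le t
  -- With $s=\sqrt{1+t}\ge1/2$, the identity $t=(s-1)(s+1)$ gives $|s^{-1}-1|\le2|s-1|\le2|t|$.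
  have h2 : (1 : ℝ) / 2 ≤ √(1 + t) := Real.le_sqrt_of_sq_le (by nlinarith)
  have h3 := Real.sq_sqrt (show 0 ≤ 1 + t by linarith)
  set s := √(1 + t)
  have hs : 0 < s := by linarith
  have h4 : t = (s - 1) * (1 + s) := by linear_combination -h3
  have h5 : s⁻¹ - 1 = -(s - 1) / s := by field_simp; ring
  rw [h5, abs_div, abs_neg, abs_of_pos hs, div_le_iff₀ hs, h4, abs_mul,
    abs_of_pos (by linarith : 0 < 1 + s)]
  nlinarith [abs_nonneg (s - 1)]

lemma abs_div_sqrt_sub_le {r V W N z : ℝ} (hV : 0 < V) (hW : |W / V - 1| ≤ 1 / 2)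
    (hz : |r / √V - N| ≤ z) : |r / √W - N| ≤ 2 * |W / V - 1| * (|N| + z) + z := by
  have h1 : r / √W = r / √V * (√(1 + (W / V - 1)))⁻¹ := by
    rw [add_sub_cancel, Real.sqrt_div' _ hV.le, inv_div, div_mul_div_comm, mul_comm (√V),
      mul_div_mul_right _ _ (Real.sqrt_pos.2 hV).ne']
  have h2 := abs_inv_sqrt_sub_one_le hW
  have h3 : r / √W - N = ((√(1 + (W / V - 1)))⁻¹ - 1) * (N + (r / √V - N)) + (r / √V - N) := by
    rw [h1]; ring
  rw [h3]
  refine (abs_add_le _ _).trans (add_le_add ?_ hz)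
  rw [abs_mul]
  exact mul_le_mul h2 ((abs_add_le _ _).trans (add_le_add le_rfl hz)) (abs_nonneg _)
    (by positivity)

section Normality

variable {d : ℕ} {μ : Measure ℝ} [IsProbabilityMeasure μ] {K : ℝ → ℝ} {R : ℝ → Fin d → ℝ} {x : ℝ}
  {h : ℕ → ℝ} {B lam : ℝ} {Ω : Type*} [MeasurableSpace Ω] {P : Measure Ω} [IsProbabilityMeasure P]
  {X : ℕ → Ω → ℝ} {υ : ℝ → Fin d → ℝ} {c : ℕ → Fin d → ℝ}

/-- The normalized sum of the standardized influence functions. -/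
def normSum (μ : Measure ℝ) (K : ℝ → ℝ) (R : ℝ → Fin d → ℝ) (x h : ℝ) (c : Fin d → ℝ) (n : ℕ)
    (z : ℕ → ℝ) : ℝ :=
  (√n)⁻¹ * ∑ i ∈ Finset.range n, stdInfl μ K R x h c (z i)

/-- The bound on the summands divided by $\sqrt n$ is $C/\sqrt{nh}$, which tends to zero. -/
lemma Design.tendstoInDistribution_normSum (D : Design μ K R x h B lam) (S : IsSample P μ X)
    (hc : ∀ n, ‖c n‖ = 1) :
    TendstoInDistribution (fun n ω => normSum μ K R x (h n) (c n) n fun i => X i ω) atTop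
      (id : ℝ → ℝ) (fun _ => P) (gaussianReal 0 1) := by
  obtain ⟨⟨C, hC0, hC⟩, h0, h1⟩ := D.stdInfl_bounds hc
  refine tendstoInDistribution_triangular S.meas S.indep S.law
    (fun n => measurable_stdInfl D.kernel D.basis (h n) (c n)) hC h0 h1 ?_
  have hlim := D.tendsto_rate.const_mul C
  rw [mul_zero] at hlim
  refine hlim.congr fun n => ?_
  rw [rate, Real.sqrt_div zero_le_one, Real.sqrt_one, Real.sqrt_mul (Nat.cast_nonneg n), div_div,
    mul_one_div, mul_comm (√(n : ℝ))]

lemma Design.isBigOP_normSum (D : Design μ K R x h B lam) (S : IsSample P μ X)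
    (hc : ∀ n, ‖c n‖ = 1) :
    IsBigOP P (fun n ω => normSum μ K R x (h n) (c n) n fun i => X i ω) fun _ => 1 := by
  have h1 : IsBigOP P (fun n ω => √(n : ℝ) * (1 / (n : ℝ) *
      ∑ i ∈ Finset.range n, stdInfl μ K R x (h n) (c n) (X i ω)))
      fun n => √(n : ℝ) * (1 / √(n : ℝ)) :=
    (isBigOP_of_eventually_le 1 (by simp)).mul (D.isBigOP_mean_stdInfl S hc)
  refine h1.mono (HighProb.of_eventually (Eventually.of_forall fun n ω => le_of_eq ?_)) ?_
  · rw [normSum, ← mul_assoc, mul_one_div, Real.sqrt_div_self]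
  · filter_upwards with n
    rw [mul_one_div, abs_one, abs_of_nonneg (by positivity)]
    exact div_self_le_one _

lemma UniformBounds.normSum_eq {b : ℝ} (hB : UniformBounds μ K R x b B) (hK : IsKernel K)
    (hR : IsBasis R) (c : Fin d → ℝ) {n : ℕ} (hn : 0 < n) (z : ℕ → ℝ) :
    normSum μ K R x b c n z =
      √n * (popDir μ K R x b c ⬝ᵥ meanInfl μ K R x b n z) / √(popVar μ K R x b c) := by
  have hn0 : (0 : ℝ) < n := by exact_mod_cast hn
  have e1 : ∫ t, proj μ K R x b (popDir μ K R x b c) t ∂μ =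
      ∑ k, popDir μ K R x b c k * ∫ t, infl μ K R x b k t ∂μ := by
    simp only [proj]
    rw [integral_finsetSum _ fun k _ => (integrable_of_abs_le (measurable_infl hK hR b k)
      (hB.abs_infl_le hK hR k)).const_mul _]
    simp_rw [integral_const_mul]
  have e2 : popDir μ K R x b c ⬝ᵥ meanInfl μ K R x b n z =
      1 / (n : ℝ) * ∑ i ∈ Finset.range n, (proj μ K R x b (popDir μ K R x b c) (z i) -
        ∫ t, proj μ K R x b (popDir μ K R x b c) t ∂μ) := by
    rw [Finset.sum_sub_distrib, Finset.sum_const, Finset.card_range, nsmul_eq_mul, mul_sub,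
      ← mul_assoc, one_div, inv_mul_cancel₀ hn0.ne', one_mul, e1]
    simp only [proj, dotProduct, meanInfl, mul_sub, Finset.sum_sub_distrib]
    rw [Finset.sum_comm, Finset.mul_sum]
    congr 1
    refine Finset.sum_congr rfl fun k _ => ?_
    rw [← Finset.mul_sum]
    ring
  rw [e2, normSum]
  simp only [stdInfl]
  rw [← Finset.sum_div, ← mul_assoc, mul_one_div, Real.sqrt_div_self, mul_div_assoc]

/-- The studentized statistic in the direction `c`. -/
def studentized (K : ℝ → ℝ) (R : ℝ → Fin d → ℝ) (υ : ℝ → Fin d → ℝ) (x h : ℝ) (n : ℕ) (z : ℕ → ℝ)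
    (θ c : Fin d → ℝ) : ℝ :=
  √n * (hatDir K R υ x h n z c ⬝ᵥ score K R x h n z θ) / √(hatVar K R υ x h n z c)

/-- Three replacements are made: the estimated direction, the score by its projection, and the
estimated variance. Each error vanishes after scaling by $\sqrt{n/V}$. -/
theorem Design.isBigOP_studentized_sub (D : Design μ K R x h B lam) (S : IsSample P μ X)
    (hυ : IsScaling R υ) (hc : ∀ n, ‖c n‖ = 1) (θ : Fin d → ℝ)
    (hθ : Tendsto (fun n : ℕ => (n : ℝ) * rho (cdf μ) R θ x (h n) ^ 2 / h n) atTop (𝓝 0)) :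
    TendstoInMeasure P (fun n ω => studentized K R υ x (h n) n (fun i => X i ω) θ (c n) -
      normSum μ K R x (h n) (c n) n fun i => X i ω) atTop 0 := by
  obtain ⟨κ, hκ, hvar⟩ := D.exists_le_popVar hc
  have hl := D.lam_pos
  have hΓ := D.isBigOP_gamHat S hυ
  have hδ := D.isBigOP_hatVar_of_norm S hυ hc
  have hN := D.isBigOP_normSum S hc
  set C := 2 * d / lam * (d / lam) with hC
  -- Under the scaling $a=\sqrt{n/h}$, the degenerate part $\mathrm{rate}/\sqrt n$ becomes the slow
  -- rate, as does the direction error times the mean influence, $\mathrm{rate}\cdot a/\sqrt n$; the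
  -- bias becomes the second summand.
  set r : ℕ → ℝ := fun n =>
    slowRate h n + √((n : ℝ) * rho (cdf μ) R θ x (h n) ^ 2 / h n) with hr
  have hr0 : ∀ n, 0 ≤ r n := fun n => add_nonneg (slowRate_nonneg h n) (Real.sqrt_nonneg _)
  have hr_lim : Tendsto r atTop (𝓝 0) := by
    have h1 := hθ.sqrt
    rw [Real.sqrt_zero] at h1
    simpa using D.tendsto_slowRate.add h1
  set N : ℕ → Ω → ℝ := fun n ω => normSum μ K R x (h n) (c n) n fun i => X i ω with hNdef
  set δ : ℕ → Ω → ℝ := fun n ω => hatVar K R υ x (h n) n (fun i => X i ω) (c n) /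
      popVar μ K R x (h n) (c n) - 1 with hδdef
  set η : ℕ → Ω → ℝ := fun n ω => entrySum (GamHat K R υ x (h n) n (fun i => X i ω) -
    popGam μ K R x (h n)) with hη
  set a : ℕ → ℝ := fun n => √(n : ℝ) / √(h n) with ha
  have ha0 : ∀ n, 0 ≤ a n := fun n => by positivity
  set s : ℕ → Ω → ℝ := fun n ω => ∑ k, |score K R x (h n) n (fun i => X i ω) θ k -
    meanInfl μ K R x (h n) n (fun i => X i ω) k| with hs
  set m : ℕ → Ω → ℝ := fun n ω => ∑ k, |meanInfl μ K R x (h n) n (fun i => X i ω) k| with hm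
  have hmO : IsBigOP P m fun n => 1 / √(n : ℝ) :=
    IsBigOP.finset_sum _ fun k => (D.isBigOP_meanInfl S k).abs
  have hsO : IsBigOP P s fun n => rate h n / √n + rho (cdf μ) R θ x (h n) :=
    IsBigOP.finset_sum _ fun k => (D.isBigOP_score_sub S θ k).abs
  have haO : IsBigOP P (fun n _ => a n) a := isBigOP_of_eventually_le 1 (Eventually.of_forall
    fun n _ => by rw [one_mul])
  have hconst : ∀ b : ℝ, IsBigOP P (fun _ _ => b) fun _ => 1 := fun b =>
    isBigOP_of_eventually_le |b| (by simp)
  have hasO : IsBigOP P (fun n ω => a n * s n ω) r := by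
    refine (haO.mul hsO).const_scale (C := 1) ?_
    filter_upwards [eventually_gt_atTop 0] with n hn
    have hn0 : (0 : ℝ) < n := by exact_mod_cast hn
    have hp := D.pos n
    have hρ := rho_nonneg (μ := μ) (R := R) (x := x) θ (h n)
    have e1 : a n * (rate h n / √n + rho (cdf μ) R θ x (h n)) = r n := by
      simp only [ha, hr]
      rw [D.rate_eq n, Real.sqrt_div (by positivity), Real.sqrt_mul hn0.le, Real.sqrt_sq hρ]
      have h1 := (Real.sqrt_pos.2 hn0).ne'
      have h2 := (Real.sqrt_pos.2 hp).ne'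
      field_simp
    rw [e1, one_mul]
  have hηmO : IsBigOP P (fun n ω => η n ω * (a n * m n ω)) r := by
    refine (hΓ.mul (haO.mul hmO)).const_scale (C := 1) ?_
    filter_upwards [eventually_gt_atTop 0] with n hn
    have hn0 : (0 : ℝ) < n := by exact_mod_cast hn
    have hp := D.pos n
    have e1 : rate h n * (a n * (1 / √(n : ℝ))) = slowRate h n := by
      simp only [ha]
      rw [D.rate_eq n]
      have h1 := (Real.sqrt_pos.2 hn0).ne'
      have h2 := (Real.sqrt_pos.2 hp).ne'
      field_simp
    rw [e1, one_mul, abs_of_nonneg (slowRate_nonneg h n), abs_of_nonneg (hr0 n)]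
    exact le_add_of_nonneg_right (Real.sqrt_nonneg _)
  have hηsO : IsBigOP P (fun n ω => η n ω * (a n * s n ω)) r := by
    refine (hΓ.mul hasO).const_scale (C := 1) ?_
    filter_upwards [D.rate_le_one] with n hn
    rw [abs_mul, abs_of_nonneg (rate_nonneg h n)]
    exact mul_le_mul_of_nonneg_right hn (abs_nonneg _)
  set Z : ℕ → Ω → ℝ := fun n ω => 1 / √κ * (C * (η n ω * (a n * m n ω) + η n ω * (a n * s n ω)) +
    d / lam * (a n * s n ω)) with hZ
  have hZO : IsBigOP P Z r := by
    have h1 := (hconst (1 / √κ)).mul (((hconst C).mul (hηmO.add hηsO)).const_scale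
      (a := r) (C := 1) (by simp) |>.add (((hconst (d / lam)).mul hasO).const_scale
      (a := r) (C := 1) (by simp)))
    exact h1.const_scale (C := 1) (by simp)
  have hr1 : ∀ᶠ n in atTop, r n ≤ 1 := hr_lim.eventually (ge_mem_nhds one_pos)
  have hZ1 : IsBigOP P Z fun _ => 1 := hZO.const_scale (C := 1) (by
    filter_upwards [hr1] with n hn
    rwa [one_mul, abs_one, abs_of_nonneg (hr0 n)])
  have hδr : IsBigOP P δ r := hδ.const_scale (C := 1) (Eventually.of_forall fun n => by
    rw [one_mul, abs_of_nonneg (slowRate_nonneg h n), abs_of_nonneg (hr0 n)]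
    exact le_add_of_nonneg_right (Real.sqrt_nonneg _))
  have hfinal : IsBigOP P (fun n ω => 2 * |δ n ω| * (|N n ω| + Z n ω) + Z n ω) r :=
    ((((hconst 2).mul hδr.abs).mul (hN.abs.add hZ1)).const_scale (C := 1) (by simp)).add hZO
  refine (hfinal.mono_left ((((D.highProb_coercive hΓ).and
    (hδ.highProb_lt D.tendsto_slowRate one_half_pos))).mono ?_)).tendstoInMeasure hr_lim
  filter_upwards [hvar, D.norm_hatDir_sub_le (X := X) (υ := υ) hc, D.norm_popDir_le hc, D.bounds,
    eventually_gt_atTop 0] with n e1 e2 e3 e4 hn ω hω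
  have hp := D.pos n
  have hV : 0 < popVar μ K R x (h n) (c n) := lt_of_lt_of_le (by positivity) e1
  refine le_trans ?_ (le_abs_self _)
  refine abs_div_sqrt_sub_le hV hω.2.le ?_
  have hkey := abs_dotProduct_sub_dotProduct_le
    (s := score K R x (h n) n (fun i => X i ω) θ)
    (m := meanInfl μ K R x (h n) n (fun i => X i ω)) (e2 ω hω.1) e3
  have hm0 : 0 ≤ m n ω := Finset.sum_nonneg fun _ _ => abs_nonneg _
  have hs0 : 0 ≤ s n ω := Finset.sum_nonneg fun _ _ => abs_nonneg _
  have hη0 : 0 ≤ η n ω := entrySum_nonneg _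
  rw [e4.normSum_eq D.kernel D.basis (c n) hn, ← sub_div, ← mul_sub, abs_div, abs_mul,
    abs_of_nonneg (Real.sqrt_nonneg _), abs_of_nonneg (Real.sqrt_nonneg _)]
  calc _ ≤ √(n : ℝ) * (C * η n ω * (m n ω + s n ω) + d / lam * s n ω) / √(κ * h n) := by
        refine div_le_div₀ ?_ (mul_le_mul_of_nonneg_left hkey (Real.sqrt_nonneg _))
          (Real.sqrt_pos.2 (by positivity)) (Real.sqrt_le_sqrt e1)
        positivity
    _ = Z n ω := by
        simp only [hZ, ha]
        rw [Real.sqrt_mul hκ.le]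
        have h1 := (Real.sqrt_pos.2 hκ).ne'
        have h2 := (Real.sqrt_pos.2 hp).ne'
        field_simp

lemma norm_inv_smul_self {v : Fin d → ℝ} (hv : v ≠ 0) : ‖(‖v‖⁻¹ • v)‖ = 1 := by
  rw [norm_smul, norm_inv, norm_norm, inv_mul_cancel₀ (norm_ne_zero_iff.2 hv)]

/-- Numerator and standard error are both homogeneous of degree one in the direction, so
$\Upsilon_hc$ may be divided by its norm. -/
lemma dotProduct_sub_div_stdErr (hυ : IsScaling R υ) {b : ℝ} (h0 : 0 < b) {n : ℕ} (hn : 0 < n)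
    {z : ℕ → ℝ} {ϑ : Fin d → ℝ} (hmin : IsMinOn (objective K R x b n z) Set.univ ϑ)
    (θ c : Fin d → ℝ) {a : ℝ} (ha : 0 < a) (hdet : IsUnit (GamHat K R υ x b n z).det) :
    c ⬝ᵥ (ϑ - θ) / stdErr K R υ x b n z c =
      studentized K R υ x b n z θ (a⁻¹ • (diagonal (υ b) *ᵥ c)) := by
  have hn0 : (0 : ℝ) < n := by exact_mod_cast hn
  rw [dotProduct_sub_eq hυ h0 hmin θ c hdet, stdErr, studentized, hatDir, hatVar, mulVec_smul,
    smul_dotProduct, sandwich_smul, Real.sqrt_mul (sq_nonneg _),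
    Real.sqrt_sq (inv_nonneg.2 ha.le), Real.sqrt_div' _ hn0.le, smul_eq_mul, div_div_eq_mul_div,
    mul_left_comm, mul_div_mul_left _ _ (inv_pos.2 ha).ne', mul_comm]

theorem Design.isBigOP_sandwich (D : Design μ K R x h B lam) (S : IsSample P μ X)
    (hυ : IsScaling R υ) {c : Fin d → ℝ} (hc : c ≠ 0) :
    IsBigOP P (fun n ω => sandwich (GamHat K R υ x (h n) n fun i => X i ω)
      (SigHat K R υ x (h n) n fun i => X i ω) c /
        sandwich (popGam μ K R x (h n)) (popSig μ K R x (h n)) c - 1) (slowRate h) := by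
  have key := D.isBigOP_hatVar_of_norm S hυ (c := fun _ => ‖c‖⁻¹ • c)
    fun _ => norm_inv_smul_self hc
  have ha : ‖c‖⁻¹ ^ 2 ≠ 0 := pow_ne_zero 2 (inv_ne_zero (norm_ne_zero_iff.2 hc))
  simpa only [hatVar, popVar, sandwich_smul, mul_div_mul_left _ _ ha] using key

theorem Design.tendstoInDistribution (D : Design μ K R x h B lam) (S : IsSample P μ X)
    (hυ : IsScaling R υ) {c : Fin d → ℝ} (hc : c ≠ 0) (θ : Fin d → ℝ)
    {θhat : ℕ → Ω → Fin d → ℝ} (hmeas : ∀ n, Measurable (θhat n))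
    (hmin : ∀ n ω, IsMinOn (objective K R x (h n) n fun i => X i ω) Set.univ (θhat n ω))
    (hθ : Tendsto (fun n : ℕ => (n : ℝ) * rho (cdf μ) R θ x (h n) ^ 2 / h n) atTop (𝓝 0)) :
    TendstoInDistribution (fun (n : ℕ) ω => c ⬝ᵥ (θhat n ω - θ) /
      stdErr K R υ x (h n) n (fun i => X i ω) c) atTop (id : ℝ → ℝ) (fun _ => P)
      (gaussianReal 0 1) := by
  have hne : ∀ n, diagonal (υ (h n)) *ᵥ c ≠ 0 := fun n h0 => hc (funext fun k => by
    have h1 := congrFun h0 k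
    rw [mulVec_diagonal, Pi.zero_apply] at h1
    exact (mul_eq_zero.1 h1).resolve_left (hυ.pos (D.pos n) k).ne')
  have hnorm := fun n => norm_inv_smul_self (hne n)
  refine tendstoInDistribution_of_tendstoInMeasure_sub _ _
    (D.tendstoInDistribution_normSum S hnorm) ?_ fun n => ?_
  · have h1 := D.isBigOP_studentized_sub S hυ hnorm θ hθ
    rw [tendstoInMeasure_iff_norm] at h1 ⊢
    intro ε hε
    -- The statistic equals its studentized form only where $\hat\Gamma_h$ is invertible; elsewhere
    -- nothing is claimed, and that event has vanishing probability.
    have h2 := (D.highProb_coercive (D.isBigOP_gamHat S hυ)).add (h1 ε hε)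
    rw [add_zero] at h2
    refine tendsto_of_tendsto_of_tendsto_of_le_of_le' tendsto_const_nhds h2
      (Eventually.of_forall fun _ => zero_le) ?_
    filter_upwards [eventually_gt_atTop 0] with n hn
    refine (measure_mono fun ω hω => ?_).trans (measure_union_le _ _)
    by_cases hco : Coercive (GamHat K R υ x (h n) n fun i => X i ω) (lam / 2)
    · refine Or.inr ?_
      have h3 := dotProduct_sub_div_stdErr hυ (D.pos n) hn (hmin n ω) θ c
        (norm_pos_iff.2 (hne n)) (hco.isUnit_det (half_pos D.lam_pos))
      simp only [Set.mem_ofPred_eq, Pi.sub_apply] at hω ⊢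
      rwa [h3] at hω
    · exact Or.inl hco
  · have h1 : Measurable fun ω => c ⬝ᵥ (θhat n ω - θ) :=
      Finset.measurable_fun_sum _ fun k _ => measurable_const.mul
        (((measurable_pi_apply k).comp (hmeas n)).sub_const _)
    exact (h1.div (measurable_stdErr D.kernel D.basis S.meas υ x (h n) n c)).aemeasurable

end Normality

/-! ### The population matrices -/

lemma Coercive.anti {d : ℕ} {A : Matrix (Fin d) (Fin d) ℝ} {a b : ℝ} (hA : Coercive A b)
    (h : a ≤ b) : Coercive A a := fun w =>
  (mul_le_mul_of_nonneg_right h (Finset.sum_nonneg fun _ _ => mul_self_nonneg _)).trans (hA w)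

lemma exists_design {d : ℕ} {μ : Measure ℝ} [IsProbabilityMeasure μ] {f K : ℝ → ℝ}
    {R : ℝ → Fin d → ℝ} {x δ fm fp dfm dfp : ℝ} {h : ℕ → ℝ} (hδ : 0 < δ)
    (hf : HasDensityOn (cdf μ) f x δ) (hexp : TwoSidedExpansion f x δ fm fp dfm dfp)
    (hK : IsKernel K) (hR : IsBasis R)
    (hGam : MinEigenvalueBoundedAway fun h => Gam μ f K R x h)
    (hSig : MinEigenvalueBoundedAway fun h => h⁻¹ • Sig μ f K R x h)
    (hpos : ∀ n, 0 < h n) (hzero : Tendsto h atTop (𝓝 0))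
    (hinf : Tendsto (fun n : ℕ => (n : ℝ) * h n ^ 2) atTop atTop) :
    ∃ B lam, Design μ K R x h B lam ∧ ∀ᶠ n in atTop,
      Gam μ f K R x (h n) = popGam μ K R x (h n) ∧
        Sig μ f K R x (h n) = popSig μ K R x (h n) := by
  obtain ⟨C, hC0, hC⟩ := hexp.exists_le hδ
  obtain ⟨B, hB1, hB⟩ := exists_uniformBounds (μ := μ) (x := x) (δ := δ) (C := 2 * C)
    (by positivity) (fun b h0 hb => hf.measureReal_Icc_le hδ hC0 hC h0 hb) hK hR
  obtain ⟨a, ha, hG⟩ := hGam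
  obtain ⟨b, hb, hS⟩ := hSig
  have hlt : ∀ᶠ n in atTop, h n < δ := hzero.eventually (gt_mem_nhds hδ)
  have hlim : Tendsto h atTop (𝓝[>] 0) :=
    tendsto_nhdsWithin_iff.2 ⟨hzero, Eventually.of_forall hpos⟩
  have heq : ∀ᶠ n in atTop, Gam μ f K R x (h n) = popGam μ K R x (h n) ∧
      Sig μ f K R x (h n) = popSig μ K R x (h n) := by
    filter_upwards [hlt] with n hn
    have hBn := hB (h n) (hpos n) hn
    exact ⟨ext fun k l => Gam_eq hδ hf hK hR (hpos n) hn hBn k l,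
      ext fun k l => Sig_eq hδ hf hK hR (hpos n) hn hBn k l⟩
  -- One coercivity constant serves both matrices; for $\Sigma_h$ it is multiplied by $h$ when the
  -- factor $h^{-1}$ is undone.
  refine ⟨B, min a b, ⟨hK, hR, hpos, hzero, hinf, hB1, lt_min ha hb, ?_, ?_, ?_⟩, heq⟩
  · filter_upwards [hlt] with n hn using hB (h n) (hpos n) hn
  · filter_upwards [hlim.eventually hG, heq] with n h1 h2
    rw [h2.1] at h1
    exact (coercive_of_spectrum (popGam_transpose μ K R x (h n)) h1).anti (min_le_left _ _)
  · filter_upwards [hlim.eventually hS, heq] with n h1 h2 w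
    rw [h2.2] at h1
    have hp := hpos n
    have h3 := (coercive_of_spectrum
      (by rw [transpose_smul, popSig_transpose]) h1).anti (min_le_right a b) w
    rw [smul_mulVec, dotProduct_smul, smul_eq_mul, le_inv_mul_iff₀ hp] at h3
    linarith

end LocReg

end

theorem mainTheorem7
    {Ω : Type*} [MeasurableSpace Ω] (P : Measure Ω) [IsProbabilityMeasure P]
    -- a random sample from the distribution `μ`, and an evaluation point in its support
    (μ : Measure ℝ) [IsProbabilityMeasure μ] (X : ℕ → Ω → ℝ)
    (hX : ∀ i, Measurable (X i)) (hindep : iIndepFun X P) (hlaw : ∀ i, P.map (X i) = μ)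
    (x : ℝ) (hx : x ∈ μ.support)
    -- the local density
    (δ : ℝ) (hδ : 0 < δ) (f : ℝ → ℝ) (hf : LocReg.HasDensityOn (cdf μ) f x δ)
    (fm fp dfm dfp : ℝ) (hexp : LocReg.TwoSidedExpansion f x δ fm fp dfm dfp)
    -- the kernel, the basis and its scaling matrices
    (K : ℝ → ℝ) (hK : LocReg.IsKernel K)
    {d : ℕ} (R : ℝ → Fin d → ℝ) (hR : LocReg.IsBasis R)
    (υ : ℝ → Fin d → ℝ) (hυ : LocReg.IsScaling R υ)
    -- the minimum eigenvalue conditions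
    (hGam : LocReg.MinEigenvalueBoundedAway fun h => LocReg.Gam μ f K R x h)
    (hSig : LocReg.MinEigenvalueBoundedAway fun h => h⁻¹ • LocReg.Sig μ f K R x h)
    -- the bandwidths
    (h : ℕ → ℝ) (hpos : ∀ n, 0 < h n) (hzero : Tendsto h atTop (𝓝 0))
    (hinf : Tendsto (fun n : ℕ => (n : ℝ) * h n ^ 2) atTop atTop)
    (c : Fin d → ℝ) (hc : c ≠ 0) :
    LocReg.IsBigOP P
      (fun n ω =>
        |LocReg.sandwich (LocReg.GamHat K R υ x (h n) n fun i => X i ω)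
            (LocReg.SigHat K R υ x (h n) n fun i => X i ω) c /
          LocReg.sandwich (LocReg.Gam μ f K R x (h n)) (LocReg.Sig μ f K R x (h n)) c - 1|)
      (fun n => √(1 / ((n : ℝ) * h n ^ 2))) ∧
    ∀ (θ : Fin d → ℝ) (θhat : ℕ → Ω → Fin d → ℝ),
      (∀ n, Measurable (θhat n)) →
      (∀ n ω, IsMinOn (LocReg.objective K R x (h n) n fun i => X i ω) Set.univ (θhat n ω)) →
      Tendsto (fun n : ℕ => (n : ℝ) * LocReg.rho (cdf μ) R θ x (h n) ^ 2 / h n) atTop (𝓝 0) →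
      TendstoInDistribution
        (fun (n : ℕ) ω => c ⬝ᵥ (θhat n ω - θ) /
          LocReg.stdErr K R υ x (h n) n (fun i => X i ω) c)
        atTop (id : ℝ → ℝ) (fun _ => P) (gaussianReal 0 1) := by
  obtain ⟨B, lam, D, heq⟩ :=
    LocReg.exists_design hδ hf hexp hK hR hGam hSig hpos hzero hinf
  have S : LocReg.IsSample P μ X := ⟨hX, hindep, hlaw⟩
  refine ⟨?_, fun θ θhat hmeas hmin hθ => D.tendstoInDistribution S hυ hc θ hmeas hmin hθ⟩
  refine (D.isBigOP_sandwich S hυ hc).abs.mono_left (LocReg.HighProb.of_eventually ?_)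
  filter_upwards [heq] with n hn ω
  rw [hn.1, hn.2]
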